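/- Let $L$ be an even lattice of signature $(n,2)$ with $n\ge 3$, with quadratic form $Q$ and bilinear form $\langle x,y\rangle = Q(x+y)-Q(x)-Q(y)$, so that $Q(x)=\langle x,x\rangle/2$; both are extended to $L\otimes\mathbb{Q}$, $L\otimes\mathbb{R}$ and $L\otimes\mathbb{C}$. Let $\mathcal{D}$ be one of the two connected components of $\{[\mathcal{Z}]\in\mathbb{P}(L\otimes\mathbb{C}) : \langle \mathcal{Z},\mathcal{Z}\rangle=0,\ \langle \mathcal{Z},\overline{\mathcal{Z}}\rangle<0\}$, let $\mathcal{A}=\{\mathcal{Z} : [\mathcal{Z}]\in\mathcal{D}\}$ be the affine cone over it, let $\mathrm{O}^+(L)$ be the group of automorphisms of $L$ that preserve $\mathcal{D}$, and let $\Gamma\le \mathrm{O}^+(L)$ be a subgroup of finite index. A modular form of weight $k\in\mathbb{Z}$ and character $\chi:\Gamma\to\mathbb{C}^\times$ is a holomorphic function $F$ on $\mathcal{A}$ with $F(\gamma\mathcal{Z})=\chi(\gamma)F(\mathcal{Z})$ and $F(t\mathcal{Z})=t^{-k}F(\mathcal{Z})$ for all $\gamma\in\Gamma$, $t\in\mathbb{C}^\times$.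 A non-constant modular form $F$ for $\Gamma$ is called reflective if each of its zeros lies on a hyperplane $r^\perp=\{\mathcal{Z}\in\mathcal{A}:\langle\mathcal{Z},r\rangle=0\}$, $r\in L\otimes\mathbb{R}$, whose reflection $\sigma_r(v)=v-\frac{2\langle v,r\rangle}{\langle r,r\rangle}r$ lies in $\Gamma$. Let $c\in L$ be a primitive vector of norm $0$ and $c'\in L'$ a vector of the dual lattice with $\langle c,c'\rangle=1$. Let $L_{c,c'}=\{\lambda\in L : \langle\lambda,c\rangle=\langle\lambda,c'\rangle=0\}$, and regard functions $F$ on $\mathcal{A}$ as functions on the tube domain $$\mathbb{H}_{c,c'}=\{Z\in L_{c,c'}\otimes\mathbb{C} : \mathcal{Z}:=c'+Z-(Q(Z)+Q(c'))c\in\mathcal{A}\},\qquad F(Z):=F(\mathcal{Z}).$$ For a basis $e_1,\dots,e_n$ of $L_{c,c'}$ with Gram matrix $S$, inverse $S^{-1}=(s^{ij})$ and associated coordinates $z_1,\dots,z_n$, let $\mathbf{\Delta}=\frac{1}{8\pi^2}\sum_{i,j}s^{ij}\frac{\partial^2}{\partial z_i\partial z_j}$. Write $F(Z)=\sum_{\lambda\in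 L_{c,c'}\otimes\mathbb{Q}}a_F(\lambda)e^{2\pi i\langle\lambda,Z\rangle}$ for the Fourier series of a modular form, and let $D_F$ be the smallest positive integer with $D_F\,Q(\lambda)\in\mathbb{Z}$ whenever $a_F(\lambda)\ne 0$. The form $F$ is called singular modulo a prime $p$ if $p\nmid D_F$, all $a_F(\lambda)$ are integers, and $a_F(\lambda)\equiv 0 \pmod p$ for all $\lambda$ for which $Q(\lambda)$ is nonzero modulo $p$. A prime is said to divide a rational number if it divides its numerator in lowest terms. Suppose that $F$ and $G$ are reflective modular forms for $\Gamma$, of weights $k$ and $\ell$ (with arbitrary characters), that $F$ and $G$ have only simple zeros (neither vanishes to order $\ge 2$ along a hyperplane $r^\perp$), that their zeros are disjoint in the sense that there is no hyperplane $r^\perp$ on which both vanish identically, and that $\Gamma$ admits no nonzero modular form of weight $2$ with trivial character. Then on $\mathbb{H}_{c,c'}$ $$\Big(\tfrac n2-1-k\Big)\Big(\tfrac n2-1-\ell\Big)\mathbf{\Delta}(FG)=\Big(\tfrac n2-1-\ell\Big)\Big(\tfrac n2-1-k-\ell\Big)\mathbf{\Delta}(F)\,G+\Big(\tfrac n2-1-k\Big)\Big(\tfrac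 n2-1-k-\ell\Big)F\,\mathbf{\Delta}(G).$$ Suppose moreover that $F$ and $G$ have integral Fourier coefficients at $(c,c')$. Then, for primes $p$ that divide none of $D_F$, $D_G$, $D_{FG}$: 1. $F$ is singular modulo $p$ if $p$ divides $\frac n2-1-k$ but neither $\ell$ nor $\frac n2-1-\ell$; 2. $G$ is singular modulo $p$ if $p$ divides $\frac n2-1-\ell$ but neither $k$ nor $\frac n2-1-k$; 3. $FG$ is singular modulo $p$ if $p$ divides $\frac n2-1-(k+\ell)$ but neither $k$ nor $\ell$. -/

import Mathlib

open scoped Matrix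

noncomputable section

/-- An even integral lattice of signature `(n, 2)`.  A choice of `ℤ`-basis identifies the lattice with
`ℤ^(n+2)` equipped with its Gram matrix: the bilinear form is `⟨x, y⟩ = xᵀ S y` and the integral
quadratic form is `Q(x) = ⟨x, x⟩ / 2`. -/
structure EvenLattice (n : ℕ) where
  gram : Matrix (Fin (n + 2)) (Fin (n + 2)) ℤ
  symm : gram.IsSymm
  even : ∀ i, Even (gram i i)
  sigPos_eq : sigPos (gram.map (Int.cast : ℤ → ℝ)).toQuadraticForm' = n
  sigNeg_eq : sigNeg (gram.map (Int.cast : ℤ → ℝ)).toQuadraticForm' = 2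

/-- The rational number `q` is divisible by the prime `p`, i.e. `p` divides the numerator of `q`. -/
def PrimeDvd (p : ℕ) (q : ℚ) : Prop := (p : ℤ) ∣ q.num

/-- The function `F` is non-constant on the set `A`. -/
def NonConstantOn {X : Type*} (A : Set X) (F : X → ℂ) : Prop :=
  ∃ z ∈ A, ∃ w ∈ A, F z ≠ F w

namespace EvenLattice

variable {n : ℕ} (L : EvenLattice n)

/-- The bilinear form `⟨x, y⟩`, extended to `L ⊗ R = R^(n+2)`. -/
def bil (R : Type*) [CommRing R] (x y : Fin (n + 2) → R) : R :=
  x ⬝ᵥ (L.gram.map (Int.cast : ℤ → R) *ᵥ y)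

/-- The quadratic form `Q(x) = ⟨x, x⟩ / 2`, extended to `L ⊗ K` for a field `K`
(used for `K = ℚ` and `K = ℂ`). -/
def quad (K : Type*) [Field K] (x : Fin (n + 2) → K) : K :=
  L.bil K x x / 2

/-! ### The symmetric domain and modular forms -/

/-- The set of all `𝒵 ∈ L_ℂ` with `⟨𝒵, 𝒵⟩ = 0` and `⟨𝒵, conj 𝒵⟩ < 0` (the latter is a real number).
This is the affine cone over the Hermitian domain and its complex conjugate. -/
def negCone : Set (Fin (n + 2) → ℂ) :=
  {z | L.bil ℂ z z = 0 ∧ (L.bil ℂ z (star z)).re < 0}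

/-- `A` is the affine cone `𝒜` over one of the two connected components `𝒟` of
`{[𝒵] : ⟨𝒵, 𝒵⟩ = 0, ⟨𝒵, conj 𝒵⟩ < 0}`.  As `ℂˣ` is connected, these are exactly the two connected
components of the cone `negCone`. -/
def IsDomainCone (A : Set (Fin (n + 2) → ℂ)) : Prop :=
  ∃ z ∈ L.negCone, A = connectedComponentIn L.negCone z

/-- The action of `GL(L) = GL_(n+2)(ℤ)` on `L ⊗ R`. -/
def act {n : ℕ} (R : Type*) [CommRing R] (g : GL (Fin (n + 2)) ℤ) (x : Fin (n + 2) → R) :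
    Fin (n + 2) → R :=
  (g.1.map (Int.cast : ℤ → R)) *ᵥ x

theorem act_one {n : ℕ} (R : Type*) [CommRing R] (x : Fin (n + 2) → R) : act R 1 x = x := by
  simp [act]

theorem act_mul {n : ℕ} (R : Type*) [CommRing R] (g h : GL (Fin (n + 2)) ℤ)
    (x : Fin (n + 2) → R) : act R (g * h) x = act R g (act R h x) := by
  have : (g * h).1.map (Int.cast : ℤ → R)
      = g.1.map (Int.cast : ℤ → R) * h.1.map (Int.cast : ℤ → R) :=
    Matrix.map_mul (f := Int.castRingHom R)
  simp only [act, this, Matrix.mulVec_mulVec]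

/-- The group `O⁺(L)`: the automorphisms of the lattice `L` that preserve the bilinear form and
map `𝒟` (equivalently, the cone `A` over `𝒟`) to itself. -/
def OPlus (A : Set (Fin (n + 2) → ℂ)) : Subgroup (GL (Fin (n + 2)) ℤ) where
  carrier := {g | (∀ x y, L.bil ℤ (act ℤ g x) (act ℤ g y) = L.bil ℤ x y) ∧ act ℂ g '' A = A}
  one_mem' := by
    refine ⟨fun x y => by simp only [act_one], ?_⟩
    simp only [act_one, Set.image_id']
  mul_mem' := by
    rintro g h ⟨hg, hgA⟩ ⟨hh, hhA⟩
    refine ⟨fun x y => by simp only [act_mul, hg, hh], ?_⟩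
    have : act ℂ (g * h) = act ℂ g ∘ act ℂ h := funext (act_mul ℂ g h)
    rw [this, Set.image_comp, hhA, hgA]
  inv_mem' := by
    rintro g ⟨hg, hgA⟩
    have key : ∀ x : Fin (n + 2) → ℤ, act ℤ g (act ℤ g⁻¹ x) = x := fun x => by
      rw [← act_mul, mul_inv_cancel, act_one]
    refine ⟨fun x y => by rw [← hg, key, key], ?_⟩
    conv_lhs => rw [← hgA]
    rw [← Set.image_comp]
    have : act ℂ g⁻¹ ∘ act ℂ g = id := by
      funext z
      rw [Function.comp_apply, ← act_mul, inv_mul_cancel, act_one, id]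
    rw [this, Set.image_id]

/-- `F` is a modular form of integral weight `k`, level `Γ` and character `χ`: it is holomorphic on
the complex manifold `A`, `F(γ𝒵) = χ(γ) F(𝒵)` for `γ ∈ Γ`, and `F(t𝒵) = t^(-k) F(𝒵)` for
`t ∈ ℂˣ`.  Only the values of `F` on `A` matter.  As `A` is a complex submanifold of `L_ℂ`,
complex differentiability within `A` at every point of `A` is the same as holomorphy on `A`. -/
structure IsModularForm (A : Set (Fin (n + 2) → ℂ)) (Γ : Subgroup (GL (Fin (n + 2)) ℤ))
    (χ : Γ →* ℂˣ) (k : ℤ) (F : (Fin (n + 2) → ℂ) → ℂ) : Prop where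
  holomorphic : DifferentiableOn ℂ F A
  equivariant : ∀ γ : Γ, ∀ z ∈ A, F (act ℂ γ.1 z) = (χ γ : ℂ) * F z
  homogeneous : ∀ t : ℂ, t ≠ 0 → ∀ z ∈ A, F (t • z) = t ^ (-k) * F z

/-- The vector `r ∈ L_ℝ` regarded as an element of `L_ℂ`. -/
def toComplex {n : ℕ} (r : Fin (n + 2) → ℝ) : Fin (n + 2) → ℂ := fun i => (r i : ℂ)

/-- The reflection `σ_r(v) = v - (2⟨v, r⟩ / ⟨r, r⟩) r` on `L_ℝ` (meaningful for `⟨r, r⟩ ≠ 0`). -/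
def reflection (r v : Fin (n + 2) → ℝ) : Fin (n + 2) → ℝ :=
  v - (2 * L.bil ℝ v r / L.bil ℝ r r) • r

/-- `F` is a reflective modular form for `Γ`: it is a non-constant modular form, and each of its zeros
lies on a hyperplane `r^⊥` whose associated reflection `σ_r` lies in `Γ`. -/
structure IsReflective (A : Set (Fin (n + 2) → ℂ)) (Γ : Subgroup (GL (Fin (n + 2)) ℤ))
    (χ : Γ →* ℂˣ) (k : ℤ) (F : (Fin (n + 2) → ℂ) → ℂ) : Prop where
  modular : IsModularForm A Γ χ k F
  nonconstant : NonConstantOn A F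
  zeros : ∀ z ∈ A, F z = 0 → ∃ r : Fin (n + 2) → ℝ, L.bil ℝ r r ≠ 0 ∧
    L.bil ℂ z (toComplex r) = 0 ∧ ∃ γ ∈ Γ, ∀ v, act ℝ γ v = L.reflection r v

/-- `F` vanishes identically on the hyperplane `r^⊥`. -/
def VanishesOn (A : Set (Fin (n + 2) → ℂ)) (F : (Fin (n + 2) → ℂ) → ℂ)
    (r : Fin (n + 2) → ℝ) : Prop :=
  ∀ z ∈ A, L.bil ℂ z (toComplex r) = 0 → F z = 0

/-- `F` has only simple zeros: its order of vanishing along a hyperplane `r^⊥` is never `2` or more,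
i.e. `F` is not the product of `⟨𝒵, r⟩²` and a holomorphic function on `A`.  The condition
`⟨r, r⟩ > 0` means that `r^⊥` is non-empty in the domain. -/
def HasSimpleZeros (A : Set (Fin (n + 2) → ℂ)) (F : (Fin (n + 2) → ℂ) → ℂ) : Prop :=
  ∀ r : Fin (n + 2) → ℝ, 0 < L.bil ℝ r r →
    ¬ ∃ H : (Fin (n + 2) → ℂ) → ℂ, DifferentiableOn ℂ H A ∧
      ∀ z ∈ A, F z = L.bil ℂ z (toComplex r) ^ 2 * H z

/-- The zero divisors of `F` and `G` are disjoint in the sense of having no hyperplane `r^⊥`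
in common. -/
def HaveDisjointZeros (A : Set (Fin (n + 2) → ℂ)) (F G : (Fin (n + 2) → ℂ) → ℂ) : Prop :=
  ∀ r : Fin (n + 2) → ℝ, 0 < L.bil ℝ r r → ¬ (L.VanishesOn A F r ∧ L.VanishesOn A G r)

/-! ### Tube domains, Fourier series and the holomorphic Laplace operator -/

/-- `c ∈ L` is a primitive vector of norm zero and `c'` is a vector of the dual lattice `L'`
with `⟨c, c'⟩ = 1`. -/
structure IsCuspPair (c : Fin (n + 2) → ℤ) (c' : Fin (n + 2) → ℚ) : Prop where
  primitive : ∀ (d : ℤ) (x : Fin (n + 2) → ℤ), d • x = c → IsUnit d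
  isotropic : L.bil ℤ c c = 0
  dual : ∀ x : Fin (n + 2) → ℤ, ∃ m : ℤ, L.bil ℚ (fun i => (x i : ℚ)) c' = m
  pairing : L.bil ℚ (fun i => (c i : ℚ)) c' = 1

variable (c : Fin (n + 2) → ℤ) (c' : Fin (n + 2) → ℚ)

/-- The lattice `L_{c,c'} = {x ∈ L : ⟨x, c⟩ = ⟨x, c'⟩ = 0}`. -/
def cuspLattice : Submodule ℤ (Fin (n + 2) → ℤ) where
  carrier := {x | L.bil ℤ x c = 0 ∧ L.bil ℚ (fun i => (x i : ℚ)) c' = 0}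
  zero_mem' := by
    refine ⟨by simp [bil], ?_⟩
    have : (fun i => (((0 : Fin (n + 2) → ℤ) i : ℤ) : ℚ)) = 0 := by funext i; simp
    rw [this]; simp [bil]
  add_mem' := by
    rintro x y ⟨hx, hx'⟩ ⟨hy, hy'⟩
    refine ⟨by simp only [bil, add_dotProduct] at *; rw [hx, hy, add_zero], ?_⟩
    have : (fun i => (((x + y) i : ℤ) : ℚ)) = (fun i => (x i : ℚ)) + fun i => (y i : ℚ) := by
      funext i; simp
    rw [this]; simp only [bil, add_dotProduct] at *; rw [hx', hy', add_zero]
  smul_mem' := by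
    rintro a x ⟨hx, hx'⟩
    refine ⟨by simp only [bil, smul_dotProduct] at *; rw [hx, smul_zero], ?_⟩
    have : (fun i => (((a • x) i : ℤ) : ℚ)) = (a : ℚ) • fun i => (x i : ℚ) := by
      funext i; simp
    rw [this]; simp only [bil, smul_dotProduct] at *; rw [hx', smul_zero]

/-- The rational vector space `L_{c,c'} ⊗ ℚ`, inside `L ⊗ ℚ`. -/
def cuspSpace : Set (Fin (n + 2) → ℚ) :=
  {v | L.bil ℚ v (fun i => (c i : ℚ)) = 0 ∧ L.bil ℚ v c' = 0}

/-- The map `Z ↦ 𝒵 = c' + Z - (Q(Z) + Q(c')) c` from `L_{c,c'} ⊗ ℂ` to the isotropic vectors of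
`L_ℂ`.  (If `c'` has norm zero this is `c' + Z - Q(Z) c`.) -/
def tubeMap (Z : Fin (n + 2) → ℂ) : Fin (n + 2) → ℂ :=
  (fun i => (c' i : ℂ)) + Z - (L.quad ℂ Z + (L.quad ℚ c' : ℚ)) • fun i => (c i : ℂ)

/-- The tube domain `ℍ_{c,c'}`: the `Z ∈ L_{c,c'} ⊗ ℂ` for which `𝒵` lies in `A`. -/
def tubeDomain (A : Set (Fin (n + 2) → ℂ)) : Set (Fin (n + 2) → ℂ) :=
  {Z | L.bil ℂ Z (fun i => (c i : ℂ)) = 0 ∧ L.bil ℂ Z (fun i => (c' i : ℂ)) = 0 ∧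
    L.tubeMap c c' Z ∈ A}

/-- A function `F` on `A`, regarded as the function `Z ↦ F(𝒵)` on the tube domain. -/
def onTube (F : (Fin (n + 2) → ℂ) → ℂ) (Z : Fin (n + 2) → ℂ) : ℂ := F (L.tubeMap c c' Z)

/-- `F(Z) = ∑_λ a(λ) e^{2πi⟨λ, Z⟩}` on the tube domain, where `λ` runs over `L_{c,c'} ⊗ ℚ` (with
absolute convergence).  There is at most one such family `a`. -/
def IsFourierExpansion (A : Set (Fin (n + 2) → ℂ)) (F : (Fin (n + 2) → ℂ) → ℂ)
    (a : L.cuspSpace c c' → ℂ) : Prop :=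
  ∀ Z ∈ L.tubeDomain c c' A,
    HasSum (fun v : L.cuspSpace c c' =>
      a v * Complex.exp (2 * Real.pi * Complex.I * L.bil ℂ (fun i => (v.1 i : ℂ)) Z))
      (L.onTube c c' F Z)

open Classical in
/-- The Fourier coefficients `a_F(λ)` of `F` at the cusp `(c, c')` (and zero if `F` has no Fourier
expansion). -/
def fourierCoeff (A : Set (Fin (n + 2) → ℂ)) (F : (Fin (n + 2) → ℂ) → ℂ) :
    L.cuspSpace c c' → ℂ :=
  if h : ∃ a, L.IsFourierExpansion c c' A F a then h.choose else 0

/-- `F` has a Fourier expansion at `(c, c')` whose coefficients are all integers. -/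
def HasIntegralFourierCoeffs (A : Set (Fin (n + 2) → ℂ)) (F : (Fin (n + 2) → ℂ) → ℂ) : Prop :=
  L.IsFourierExpansion c c' A F (L.fourierCoeff c c' A F) ∧
    ∀ v, ∃ m : ℤ, L.fourierCoeff c c' A F v = m

/-- `D_F`: the smallest positive integer `D` such that `D · Q(λ) ∈ ℤ` for all `λ` with
`a_F(λ) ≠ 0` (and `0` if there is no such integer, which does not occur for modular forms). -/
def fourierDenom (A : Set (Fin (n + 2) → ℂ)) (F : (Fin (n + 2) → ℂ) → ℂ) : ℕ :=
  sInf {D : ℕ | 0 < D ∧ ∀ v, L.fourierCoeff c c' A F v ≠ 0 →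
    ∃ m : ℤ, (D : ℚ) * L.quad ℚ v.1 = m}

/-- `F` is singular modulo the prime `p` at the cusp `(c, c')`: `p` does not divide `D_F`, all Fourier
coefficients are integers, and `a_F(λ) ≡ 0 mod p` whenever `Q(λ)` is nonzero modulo `p`. -/
structure IsSingularMod (A : Set (Fin (n + 2) → ℂ)) (p : ℕ) (F : (Fin (n + 2) → ℂ) → ℂ) :
    Prop where
  not_dvd_denom : ¬ p ∣ L.fourierDenom c c' A F
  integral : L.HasIntegralFourierCoeffs c c' A F
  congruence : ∀ v, ¬ PrimeDvd p (L.quad ℚ v.1) →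
    ∃ m : ℤ, L.fourierCoeff c c' A F v = (p : ℂ) * m

variable {c c'}

/-- The holomorphic Laplace operator `(1 / 8π²) ∑ s^{ij} ∂²/∂z_i∂z_j` on functions on (an open subset
of) `L_{c,c'} ⊗ ℂ`, computed in a basis `e` of `L_{c,c'}`.  Here `(s^{ij})` is the inverse of the Gram
matrix of `e`, and `∂/∂z_i` is the complex derivative in the direction `e_i`. -/
def laplacian {m : ℕ} (e : Module.Basis (Fin m) ℤ (L.cuspLattice c c'))
    (f : (Fin (n + 2) → ℂ) → ℂ) (Z : Fin (n + 2) → ℂ) : ℂ :=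
  1 / (8 * (Real.pi : ℂ) ^ 2) * ∑ i, ∑ j,
    (Matrix.of fun i j => (L.bil ℤ (e i).1 (e j).1 : ℂ))⁻¹ i j *
      lineDeriv ℂ (fun Y => lineDeriv ℂ f Y (fun l => ((e j).1 l : ℂ))) Z
        (fun l => ((e i).1 l : ℂ))

end EvenLattice

end

/-!
The proof extends a modular form `F` of weight `k` from the cone `A` to an open subset of `L_ℂ` by
the projection `x ↦ x - (Q(x) / ⟨x, c⟩) c` onto the null cone along an isotropic vector `c`. The
extension does not change in the direction of `c`, so that its Laplacian `lap` with respect to the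
form of `L` restricts to a multiple of `𝚫 F` on the tube domain (`laplacian_onTube`).

A change of the vector `c` changes the Laplacian of the extension by a first order term with the
factor `n/2 - 1 - k` (`lap_comp_coneProj`). In the combination `(n/2-1-k)(n/2-1-l) 𝚫(FG) -
(n/2-1-l)(n/2-1-k-l) 𝚫(F) G - (n/2-1-k)(n/2-1-k-l) F 𝚫(G)` these terms cancel by the product rule;
hence it is a modular form of weight `k + l + 2` with the character of `FG`
(`isModularForm_bracket`). As `F` and `G` have simple and disjoint zeros, `FG` is odd under the
reflections in the mirrors on which it vanishes, so the combination is odd as well and vanishes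
there too. The quotient by `FG` is therefore holomorphic (`exists_quotient_of_simple_zeros`), which
gives a modular form of weight two with trivial character. It is zero by hypothesis
(`bracket_eq_zero`).

Holomorphy of the quotient needs some geometry of `A`: the mirrors are locally finite
(`exists_finset_mirrors`), a function which vanishes on a mirror is divisible by its linear form
(`IsDomainCone.exists_factor`), a function with a simple zero along a mirror has character `-1` at
the reflection (`IsDomainCone.order_zero_or_one`), and the quotient, which is holomorphic at the
points that lie on a single mirror, extends over the intersections of mirrors by Cauchy's formula
on discs in one fixed direction (`exists_local_quotient`).

On Fourier coefficients `𝚫` acts as multiplication by `-Q(λ)` (`IsTubeExpansion.laplacian`), and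
Fourier coefficients are unique (`IsTubeExpansion.unique`); the identity becomes a relation between
`Q(ν) a_{FG}(ν)` and the sums of `Q(λ) a_F(λ) a_G(μ)` and `Q(μ) a_F(λ) a_G(μ)` over `λ + μ = ν`. If
`p` divides `n/2 - 1 - k - l`, it reads `Q(ν) a_{FG}(ν) ≡ 0`. If `p` divides `n/2 - 1 - k`, it says
that the product of the series with coefficients `Q(λ) a_F(λ)` and `a_G(μ)` vanishes modulo `p`,
after removing the common power of `p` from `G`, and Gauss' lemma for these series
(`padicNorm_lt_one_of_convolution`) yields `Q(λ) a_F(λ) ≡ 0`. That lemma uses that there are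
finitely many nonzero terms below every height, which follows from absolute convergence as the
coefficients are integers.
-/

/-! ### Holomorphic functions of several variables -/

open Set Filter Topology Metric in
/-- Differentiation under the integral sign along a continuous curve of translates.  The Schwarz lemma
bounds the derivative of `g`, so no continuity of the derivative is required. -/
theorem differentiableAt_integral_translate {E : Type*} [NormedAddCommGroup E] [NormedSpace ℂ E]
    [FiniteDimensional ℂ E] {U : Set E} (hU : IsOpen U) {g : E → ℂ} (hg : DifferentiableOn ℂ g U)
    {κ : ℝ → E} (hκ : Continuous κ) {w : ℝ → ℂ} (hw : Continuous w) {a b : ℝ} {x₀ : E}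
    (hx₀ : ∀ θ ∈ uIcc a b, x₀ + κ θ ∈ U) :
    DifferentiableAt ℂ (fun x => ∫ θ in a..b, w θ * g (x + κ θ)) x₀ := by
  have : ProperSpace E := FiniteDimensional.proper ℂ E
  borelize E
  set K : Set E := (fun θ => x₀ + κ θ) '' uIcc a b with hK
  have hKc : IsCompact K := isCompact_uIcc.image (by fun_prop)
  have hKU : K ⊆ U := by rintro _ ⟨θ, hθ, rfl⟩; exact hx₀ θ hθ
  obtain ⟨δ, hδ, hδU⟩ := hKc.exists_cthickening_subset_open hU hKU
  obtain ⟨M, hM⟩ := (hKc.cthickening (r := δ)).exists_bound_of_continuousOn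
    (hg.continuousOn.mono hδU)
  have hmem : ∀ θ ∈ uIcc a b, ∀ y, dist y (x₀ + κ θ) < δ → y ∈ cthickening δ K := by
    intro θ hθ y hy
    exact mem_cthickening_of_dist_le y (x₀ + κ θ) δ K ⟨θ, hθ, rfl⟩ hy.le
  have hball : ∀ θ ∈ uIcc a b, ∀ x ∈ ball x₀ (δ / 2),
      ball (x + κ θ) (δ / 2) ⊆ cthickening δ K := by
    intro θ hθ x hx y hy
    refine hmem θ hθ y ?_
    have h1 : dist (x + κ θ) (x₀ + κ θ) < δ / 2 := by simpa using hx
    have h2 := dist_triangle y (x + κ θ) (x₀ + κ θ)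
    have h3 : dist y (x + κ θ) < δ / 2 := hy
    linarith
  have hδ2 : 0 < δ / 2 := by positivity
  have hcont : ∀ x ∈ ball x₀ (δ / 2), ContinuousOn (fun θ => w θ * g (x + κ θ)) (uIcc a b) := by
    intro x hx
    refine hw.continuousOn.mul (hg.continuousOn.comp (by fun_prop) ?_)
    intro θ hθ
    exact hδU (hball θ hθ x hx (mem_ball_self hδ2))
  obtain ⟨W, hW⟩ := isCompact_uIcc.exists_bound_of_continuousOn (s := uIcc a b) hw.continuousOn
  have key := intervalIntegral.hasFDerivAt_integral_of_dominated_of_fderiv_le (𝕜 := ℂ)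
    (μ := MeasureTheory.volume) (a := a) (b := b) (x₀ := x₀)
    (F := fun x θ => w θ * g (x + κ θ))
    (F' := fun x θ => w θ • fderiv ℂ g (x + κ θ)) (s := ball x₀ (δ / 2))
    (bound := fun _ => W * ((2 * M + 1) / (δ / 2)))
    (ball_mem_nhds x₀ hδ2) ?_ ?_ ?_ ?_ ?_ ?_
  · exact key.differentiableAt
  · filter_upwards [ball_mem_nhds x₀ hδ2] with x hx
    exact ((hcont x hx).mono uIoc_subset_uIcc).aestronglyMeasurable measurableSet_uIoc
  · exact (hcont x₀ (mem_ball_self hδ2)).intervalIntegrable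
  · refine AEMeasurable.aestronglyMeasurable (Measurable.aemeasurable ?_)
    exact hw.measurable.smul ((measurable_fderiv ℂ g).comp (by fun_prop))
  · refine Eventually.of_forall fun θ hθ x hx => ?_
    have hθ' := uIoc_subset_uIcc hθ
    rw [norm_smul]
    have hb := hball θ hθ' x hx
    have h1 : ‖fderiv ℂ g (x + κ θ)‖ ≤ (2 * M + 1) / (δ / 2) := by
      refine Complex.norm_fderiv_le_div_of_mapsTo_ball (hg.mono (hb.trans hδU)) ?_ hδ2
      intro y hy
      have h1 := hM y (hb hy)
      have h2 := hM _ (hb (mem_ball_self hδ2))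
      rw [mem_closedBall, dist_eq_norm]
      have := norm_sub_le (g y) (g (x + κ θ))
      linarith
    exact mul_le_mul (hW θ hθ') h1 (norm_nonneg _) ((norm_nonneg _).trans (hW θ hθ'))
  · exact intervalIntegrable_const
  · refine Eventually.of_forall fun θ hθ x hx => ?_
    have hθ' := uIoc_subset_uIcc hθ
    have hd : HasFDerivAt g (fderiv ℂ g (x + κ θ)) (x + κ θ) :=
      (hg.differentiableAt (hU.mem_nhds (hδU (hball θ hθ' x hx (mem_ball_self hδ2))))).hasFDerivAt
    have := (hd.comp x ((hasFDerivAt_id x).add_const (κ θ))).const_smul (w θ)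
    rw [ContinuousLinearMap.comp_id] at this
    exact this

open Set Filter Topology Metric in
/-- A circle integral of translates of a holomorphic function in a fixed direction is holomorphic. -/
theorem differentiableAt_circleIntegral_translate {E : Type*} [NormedAddCommGroup E]
    [NormedSpace ℂ E] [FiniteDimensional ℂ E] {U : Set E} (hU : IsOpen U) {g : E → ℂ}
    (hg : DifferentiableOn ℂ g U) {p : ℂ → ℂ} {δ : ℝ} (hδ : 0 < δ) (hp : ContinuousOn p {0}ᶜ)
    (v : E) {x₀ : E} (hx₀ : ∀ ζ ∈ sphere (0 : ℂ) δ, x₀ + ζ • v ∈ U) :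
    DifferentiableAt ℂ (fun x => ∮ ζ in C(0, δ), p ζ • g (x + ζ • v)) x₀ := by
  have hne : ∀ θ, circleMap 0 δ θ ∈ ({0}ᶜ : Set ℂ) := fun θ => by
    simpa using circleMap_ne_center (c := 0) (θ := θ) hδ.ne'
  have := differentiableAt_integral_translate hU hg (κ := fun θ => circleMap 0 δ θ • v)
    (w := fun θ => deriv (circleMap 0 δ) θ * p (circleMap 0 δ θ)) (a := 0) (b := 2 * Real.pi)
    (by fun_prop) ?_ (x₀ := x₀) ?_
  · simpa only [circleIntegral, smul_eq_mul, mul_assoc] using this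
  · refine Continuous.mul ?_ (hp.comp_continuous (by fun_prop) hne)
    have : deriv (circleMap 0 δ) = fun θ => circleMap 0 δ θ * Complex.I :=
      funext fun θ => deriv_circleMap 0 δ θ
    rw [this]
    fun_prop
  · intro θ _
    exact hx₀ _ (circleMap_mem_sphere _ hδ.le _)

open Set Filter Topology Metric in
/-- Directional derivatives of a holomorphic function of several variables are holomorphic. -/
theorem DifferentiableOn.fderiv_apply_complex {E : Type*} [NormedAddCommGroup E] [NormedSpace ℂ E]
    [FiniteDimensional ℂ E] {U : Set E} (hU : IsOpen U) {g : E → ℂ} (hg : DifferentiableOn ℂ g U)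
    (v : E) : DifferentiableOn ℂ (fun x => fderiv ℂ g x v) U := by
  intro x₀ hx₀
  refine DifferentiableAt.differentiableWithinAt ?_
  obtain ⟨ε, hε, hεU⟩ := Metric.isOpen_iff.1 hU x₀ hx₀
  obtain ⟨δ, hδ, hδv⟩ : ∃ δ : ℝ, 0 < δ ∧ δ * ‖v‖ < ε / 2 := by
    refine ⟨ε / (4 * (‖v‖ + 1)), by positivity, ?_⟩
    rw [div_mul_eq_mul_div, div_lt_iff₀ (by positivity)]
    nlinarith [norm_nonneg v]
  have hin : ∀ x ∈ ball x₀ (ε / 2), ∀ ζ ∈ closedBall (0 : ℂ) δ, x + ζ • v ∈ U := by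
    intro x hx ζ hζ
    apply hεU
    rw [mem_ball, dist_eq_norm] at *
    have h1 : ‖ζ • v‖ ≤ δ * ‖v‖ := by
      rw [norm_smul]; exact mul_le_mul_of_nonneg_right (by simpa using hζ) (norm_nonneg _)
    have h2 : x + ζ • v - x₀ = (x - x₀) + ζ • v := by abel
    rw [h2]
    linarith [norm_add_le (x - x₀) (ζ • v)]
  have hε2 : 0 < ε / 2 := by positivity
  have hrep : ∀ x ∈ ball x₀ (ε / 2), fderiv ℂ g x v =
      (2 * Real.pi * Complex.I)⁻¹ • ∮ ζ in C(0, δ), (1 / (ζ - 0) ^ 2) • g (x + ζ • v) := by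
    intro x hx
    have hd : ∀ ζ ∈ closedBall (0 : ℂ) δ,
        HasDerivAt (fun ζ : ℂ => g (x + ζ • v)) (fderiv ℂ g (x + ζ • v) v) ζ := by
      intro ζ hζ
      have h1 : HasDerivAt (fun ζ : ℂ => x + ζ • v) v ζ := by
        simpa using ((hasDerivAt_id ζ).smul_const v).const_add x
      exact (hg.differentiableAt (hU.mem_nhds (hin x hx ζ hζ))).hasFDerivAt.comp_hasDerivAt ζ h1
    have := DifferentiableOn.deriv_eq_smul_circleIntegral (c := 0) hδ
      (fun ζ hζ => (hd ζ hζ).differentiableAt.differentiableWithinAt)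
    rw [this, smul_smul, inv_mul_cancel₀ Complex.two_pi_I_ne_zero, one_smul,
      (hd 0 (mem_closedBall_self hδ.le)).deriv, zero_smul, add_zero]
  have hev : (fun x => fderiv ℂ g x v) =ᶠ[𝓝 x₀] fun x =>
      (2 * Real.pi * Complex.I : ℂ)⁻¹ • ∮ ζ in C(0, δ), (1 / (ζ - 0) ^ 2) • g (x + ζ • v) := by
    filter_upwards [ball_mem_nhds x₀ hε2] with x hx using hrep x hx
  refine DifferentiableAt.congr_of_eventuallyEq ?_ hev
  refine DifferentiableAt.const_smul (R := ℂ)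
    (differentiableAt_circleIntegral_translate hU hg hδ ?_ v ?_) _
  · intro ζ hζ
    have : ζ ≠ 0 := hζ
    refine ContinuousAt.continuousWithinAt ?_
    exact ContinuousAt.div continuousAt_const (by fun_prop) (by simpa using this)
  · intro ζ hζ
    exact hin x₀ (mem_ball_self hε2) ζ (sphere_subset_closedBall hζ)

/-- The derivative of a holomorphic function on an open subset of `ℂ^ι` is holomorphic. -/
theorem DifferentiableOn.fderiv_complex {ι : Type*} [Fintype ι] [DecidableEq ι] {U : Set (ι → ℂ)}
    (hU : IsOpen U) {g : (ι → ℂ) → ℂ} (hg : DifferentiableOn ℂ g U) :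
    DifferentiableOn ℂ (fderiv ℂ g) U := by
  have : fderiv ℂ g = fun x => ∑ i, (fderiv ℂ g x (Pi.single i 1)) •
      (ContinuousLinearMap.proj i : (ι → ℂ) →L[ℂ] ℂ) := by
    funext x
    ext v
    conv_lhs => rw [← Finset.univ_sum_single v]
    rw [map_sum, _root_.sum_apply]
    refine Finset.sum_congr rfl fun i _ => ?_
    have : Pi.single i (v i) = v i • (Pi.single i 1 : ι → ℂ) := by
      rw [← Pi.single_smul, smul_eq_mul, mul_one]
    rw [this, map_smul]
    simp [mul_comm]
  rw [this]
  refine DifferentiableOn.fun_sum fun i _ => ?_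
  exact (hg.fderiv_apply_complex hU _).smul_const _

open Set Filter Topology Metric in
/-- A quotient `b / f` of holomorphic functions extends holomorphically to a neighbourhood of `x₀` as
soon as `f` does not vanish on a small circle around `x₀` in the direction `v` and, for a dense set of
parallel discs, the quotient extends to the disc: the extension is given by Cauchy's formula along the
discs. -/
theorem exists_local_quotient {E : Type*} [NormedAddCommGroup E] [NormedSpace ℂ E]
    [FiniteDimensional ℂ E] {D : Set E} (hD : IsOpen D) {x₀ : E} (hx₀ : x₀ ∈ D) {f b : E → ℂ}
    (hf : DifferentiableOn ℂ f D) (hb : DifferentiableOn ℂ b D) {v : E} {δ : ℝ} (hδ : 0 < δ)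
    (hcirc : ∀ ζ ∈ sphere (0 : ℂ) δ, x₀ + ζ • v ∈ D ∧ f (x₀ + ζ • v) ≠ 0) {T : Set E}
    (hT : ∀ᶠ x in 𝓝 x₀, x ∈ closure T)
    (hext : ∀ᶠ x in 𝓝 x₀, x ∈ T → ∃ φ : ℂ → ℂ, DiffContOnCl ℂ φ (ball 0 δ) ∧
      ∀ ζ ∈ closedBall (0 : ℂ) δ, φ ζ * f (x + ζ • v) = b (x + ζ • v)) :
    ∃ H : E → ℂ, ∃ V ∈ 𝓝 x₀, DifferentiableOn ℂ H V ∧ ∀ x ∈ V, H x * f x = b x := by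
  set W : Set E := {x ∈ D | f x ≠ 0} with hW
  have hWo : IsOpen W := hf.continuousOn.isOpen_inter_preimage hD isOpen_ne
  have hgW : DifferentiableOn ℂ (fun x => b x * (f x)⁻¹) W :=
    (hb.mono fun _ hx => hx.1).mul ((hf.mono fun _ hx => hx.1).fun_inv fun _ hx => hx.2)
  have hev : ∀ᶠ x in 𝓝 x₀, ∀ ζ ∈ sphere (0 : ℂ) δ, x + ζ • v ∈ W := by
    refine (isCompact_sphere (0 : ℂ) δ).eventually_forall_of_forall_eventually fun ζ hζ => ?_
    have : ContinuousAt (fun q : E × ℂ => q.1 + q.2 • v) (x₀, ζ) := by fun_prop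
    exact this.eventually (hWo.mem_nhds (hcirc ζ hζ))
  obtain ⟨V, hVsub, hVo, hxV⟩ := _root_.eventually_nhds_iff.1
    (hev.and (hT.and (hext.and (hD.mem_nhds hx₀))))
  obtain ⟨J, hJ⟩ : ∃ J : E → ℂ, ∀ x, J x = ∮ ζ in C(0, δ),
      (ζ - 0)⁻¹ • (b (x + ζ • v) * (f (x + ζ • v))⁻¹) := ⟨_, fun _ => rfl⟩
  have hJd : ∀ x ∈ V, DifferentiableAt ℂ J x := by
    intro x hx
    rw [funext hJ]
    refine differentiableAt_circleIntegral_translate hWo hgW hδ ?_ v (hVsub x hx).1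
    intro ζ hζ
    exact (ContinuousAt.inv₀ (by fun_prop) (by simpa using hζ)).continuousWithinAt
  set H : E → ℂ := fun x => (2 * Real.pi * Complex.I : ℂ)⁻¹ * J x with hH
  have hHd : ∀ x ∈ V, DifferentiableAt ℂ H x := fun x hx => (hJd x hx).const_mul _
  refine ⟨H, V, hVo.mem_nhds hxV, fun x hx => (hHd x hx).differentiableWithinAt, ?_⟩
  · have hTV : ∀ x ∈ T ∩ V, H x * f x = b x := by
      rintro x ⟨hxT, hxV⟩
      obtain ⟨hs, -, he, -⟩ := hVsub x hxV
      obtain ⟨φ, hφ, hφe⟩ := he hxT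
      have h1 : H x = φ 0 := by
        rw [← hφ.two_pi_i_inv_smul_circleIntegral_sub_inv_smul (mem_ball_self hδ), smul_eq_mul]
        change _ * J x = _
        rw [hJ]
        congr 1
        refine circleIntegral.integral_congr hδ.le fun ζ hζ => ?_
        rw [← hφe ζ (sphere_subset_closedBall hζ), mul_inv_cancel_right₀ (hs ζ hζ).2]
      have h2 := hφe 0 (mem_closedBall_self hδ.le)
      rw [zero_smul, add_zero] at h2
      rw [h1, h2]
    intro x hx
    have hxD := (hVsub x hx).2.2.2
    have hcl : x ∈ closure (T ∩ V) :=
      (hVo.closure_inter) ⟨(hVsub x hx).2.1, hx⟩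
    have := mem_closure_iff_nhdsWithin_neBot.1 hcl
    have hfc : ContinuousAt f x := hf.continuousOn.continuousAt (hD.mem_nhds hxD)
    have hbc : ContinuousAt b x := hb.continuousOn.continuousAt (hD.mem_nhds hxD)
    refine tendsto_nhds_unique (f := fun y => H y * f y) (l := 𝓝[T ∩ V] x)
      ((((hHd x hx).continuousAt.mul hfc)).tendsto.mono_left nhdsWithin_le_nhds) ?_
    refine (hbc.tendsto.mono_left (nhdsWithin_le_nhds (s := T ∩ V))).congr' ?_
    filter_upwards [self_mem_nhdsWithin] with y hy using (hTV y hy).symm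

open Set Filter Topology in
/-- A function on a dense subset `N` of `A` that extends holomorphically to `A` locally does so
globally. -/
theorem exists_differentiableOn_extension {X : Type*} [NormedAddCommGroup X] [NormedSpace ℂ X]
    {A N : Set X} {φ : X → ℂ} (hNA : N ⊆ A) (hd : A ⊆ closure N)
    (hloc : ∀ z ∈ A, ∃ h : X → ℂ, ∃ V ∈ 𝓝 z, DifferentiableOn ℂ h (A ∩ V) ∧
      ∀ w ∈ N ∩ V, h w = φ w) :
    ∃ H : X → ℂ, DifferentiableOn ℂ H A ∧ ∀ w ∈ N, H w = φ w := by
  have key : ∀ z ∈ A, ∃ h : X → ℂ, ∃ V, IsOpen V ∧ z ∈ V ∧ DifferentiableOn ℂ h (A ∩ V) ∧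
      (∀ w ∈ N ∩ V, h w = φ w) ∧ ∀ w ∈ A ∩ V, limUnder (𝓝[N] w) φ = h w := by
    intro z hz
    obtain ⟨h, V, hV, hh, hφ⟩ := hloc z hz
    obtain ⟨V', hV'V, hV'o, hzV'⟩ := mem_nhds_iff.1 hV
    refine ⟨h, V', hV'o, hzV', hh.mono (inter_subset_inter_right _ hV'V),
      fun w hw => hφ w ⟨hw.1, hV'V hw.2⟩, ?_⟩
    intro w hw
    have := mem_closure_iff_nhdsWithin_neBot.1 (hd hw.1)
    have hc : Tendsto h (𝓝[A ∩ V] w) (𝓝 (h w)) := hh.continuousOn w ⟨hw.1, hV'V hw.2⟩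
    have hle : 𝓝[N] w ≤ 𝓝[A ∩ V] w := by
      rw [nhdsWithin_inter_of_mem' (nhdsWithin_le_nhds (mem_of_superset
        (hV'o.mem_nhds hw.2) hV'V))]
      exact nhdsWithin_mono _ hNA
    refine ((hc.mono_left hle).congr' ?_).limUnder_eq
    filter_upwards [self_mem_nhdsWithin, nhdsWithin_le_nhds (hV'o.mem_nhds hw.2)] with y hy hy'
      using hφ y ⟨hy, hV'V hy'⟩
  refine ⟨fun w => limUnder (𝓝[N] w) φ, fun z hz => ?_, fun w hw => ?_⟩
  · obtain ⟨h, V, hVo, hzV, hh, -, hlim⟩ := key z hz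
    have h1 : DifferentiableWithinAt ℂ h (A ∩ V) z := hh z ⟨hz, hzV⟩
    have h2 : DifferentiableWithinAt ℂ (fun w => limUnder (𝓝[N] w) φ) (A ∩ V) z :=
      h1.congr hlim (hlim z ⟨hz, hzV⟩)
    exact (differentiableWithinAt_inter (hVo.mem_nhds hzV)).1 h2
  · obtain ⟨h, V, hVo, hwV, -, hφ, hlim⟩ := key w (hNA hw)
    exact (hlim w ⟨hNA hw, hwV⟩).trans (hφ w ⟨hw, hwV⟩)

open Set Filter Topology Metric in
theorem IsOpen.exists_pos_forall_add_smul_mem {E : Type*} [NormedAddCommGroup E] [NormedSpace ℂ E]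
    {D : Set E} (hD : IsOpen D) {x₀ : E} (hx₀ : x₀ ∈ D) (v : E) :
    ∃ ρ : ℝ, 0 < ρ ∧ ∀ᶠ x in 𝓝 x₀, ∀ ζ ∈ ball (0 : ℂ) ρ, x + ζ • v ∈ D := by
  have hc : ContinuousAt (fun q : E × ℂ => q.1 + q.2 • v) (x₀, 0) := by fun_prop
  have h := hc.eventually (hD.mem_nhds (by simpa using hx₀))
  rw [nhds_prod_eq, eventually_prod_iff] at h
  obtain ⟨p, hp, q, hq, hpq⟩ := h
  obtain ⟨ρ, hρ, hρq⟩ := Metric.eventually_nhds_iff_ball.1 hq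
  exact ⟨ρ, hρ, hp.mono fun x hx ζ hζ => hpq hx (hρq ζ hζ)⟩

open Set Filter Topology Metric in
/-- The quotient of `f` by a linear functional on whose kernel `f` vanishes is holomorphic. -/
theorem exists_local_quotient_linear {E : Type*} [NormedAddCommGroup E] [NormedSpace ℂ E]
    [FiniteDimensional ℂ E] {D : Set E} (hD : IsOpen D) {x₀ : E} (hx₀ : x₀ ∈ D) {f : E → ℂ}
    (hf : DifferentiableOn ℂ f D) (ℓ : E →L[ℂ] ℂ) (hℓ : ℓ ≠ 0) (hℓx : ℓ x₀ = 0)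
    (hfℓ : ∀ x ∈ D, ℓ x = 0 → f x = 0) :
    ∃ H : E → ℂ, ∃ V ∈ 𝓝 x₀, DifferentiableOn ℂ H V ∧ ∀ x ∈ V, H x * ℓ x = f x := by
  obtain ⟨v, hv⟩ : ∃ v, ℓ v ≠ 0 := by
    by_contra! h
    exact hℓ (ContinuousLinearMap.ext h)
  obtain ⟨ρ, hρ, hin⟩ := hD.exists_pos_forall_add_smul_mem hx₀ v
  obtain ⟨δ, hδ, rfl⟩ : ∃ δ : ℝ, 0 < δ ∧ ρ = 2 * δ := ⟨ρ / 2, by positivity, by ring⟩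
  have hsub : ∀ ζ ∈ closedBall (0 : ℂ) δ, ζ ∈ ball (0 : ℂ) (2 * δ) := fun ζ hζ => by
    simp only [mem_closedBall, mem_ball] at *; linarith
  refine exists_local_quotient hD hx₀ ℓ.differentiable.differentiableOn hf hδ (v := v)
    (T := univ) ?_ (by simp) ?_
  · intro ζ hζ
    refine ⟨hin.self_of_nhds ζ (hsub ζ (sphere_subset_closedBall hζ)), ?_⟩
    rw [map_add, hℓx, zero_add, map_smul, smul_eq_mul]
    refine mul_ne_zero ?_ hv
    rintro rfl
    simp [hδ.ne] at hζ
  · have hsm : ∀ᶠ x in 𝓝 x₀, -(ℓ x / ℓ v) ∈ ball (0 : ℂ) (2 * δ) := by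
      have : ContinuousAt (fun x => -(ℓ x / ℓ v)) x₀ := by fun_prop
      refine this.eventually (isOpen_ball.mem_nhds ?_)
      simp [hℓx, hδ]
    filter_upwards [hin, hsm] with x hx hx' _
    -- on the disc through `x` the functional has the single zero `a`
    set a : ℂ := -(ℓ x / ℓ v) with ha
    have hfd : DifferentiableOn ℂ (fun ζ : ℂ => f (x + ζ • v)) (ball 0 (2 * δ)) :=
      hf.comp (by fun_prop) fun ζ hζ => hx ζ hζ
    have hℓa : ∀ ζ : ℂ, ℓ (x + ζ • v) = ℓ v * (ζ - a) := by
      intro ζ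
      rw [map_add, map_smul, smul_eq_mul, ha]
      field_simp
      ring
    have hfa : f (x + a • v) = 0 := by
      refine hfℓ _ (hx a hx') ?_
      rw [hℓa]; ring
    refine ⟨fun ζ => (ℓ v)⁻¹ * dslope (fun ζ : ℂ => f (x + ζ • v)) a ζ, ?_, ?_⟩
    · refine DifferentiableOn.diffContOnCl ?_
      rw [closure_ball _ hδ.ne']
      refine DifferentiableOn.const_mul ?_ _
      exact ((Complex.differentiableOn_dslope (isOpen_ball.mem_nhds hx')).2 hfd).mono
        fun ζ hζ => hsub ζ hζ
    · intro ζ _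
      have h1 := sub_smul_dslope (fun ζ : ℂ => f (x + ζ • v)) a ζ
      simp only [hfa, sub_zero, smul_eq_mul] at h1
      rw [hℓa, ← h1]
      field_simp

namespace EvenLattice

variable {n : ℕ} (L : EvenLattice n)

/-! ### The bilinear form -/

section Bilinear

variable {R : Type*} [CommRing R] (x y z : Fin (n + 2) → R) (a : R)

theorem bil_add_left : L.bil R (x + y) z = L.bil R x z + L.bil R y z := add_dotProduct _ _ _

theorem bil_add_right : L.bil R x (y + z) = L.bil R x y + L.bil R x z := by
  simp only [bil, Matrix.mulVec_add, dotProduct_add]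

theorem bil_smul_left : L.bil R (a • x) y = a * L.bil R x y := smul_dotProduct _ _ _

theorem bil_smul_right : L.bil R x (a • y) = a * L.bil R x y := by
  simp only [bil, Matrix.mulVec_smul, dotProduct_smul, smul_eq_mul]

theorem bil_sub_left : L.bil R (x - y) z = L.bil R x z - L.bil R y z := sub_dotProduct _ _ _

theorem bil_sub_right : L.bil R x (y - z) = L.bil R x y - L.bil R x z := by
  simp only [bil, Matrix.mulVec_sub, dotProduct_sub]

theorem bil_zero_left : L.bil R 0 y = 0 := zero_dotProduct _

theorem bil_zero_right : L.bil R x 0 = 0 := by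
  simp only [bil, Matrix.mulVec_zero, dotProduct_zero]

theorem bil_comm : L.bil R x y = L.bil R y x := by
  have h : (L.gram.map (Int.cast : ℤ → R))ᵀ = L.gram.map (Int.cast : ℤ → R) := by
    rw [← Matrix.transpose_map, L.symm.eq]
  rw [bil, bil, Matrix.dotProduct_mulVec, ← Matrix.mulVec_transpose, h, dotProduct_comm]

theorem bil_eq_sum : L.bil R x y = ∑ i, ∑ j, x i * ((L.gram i j : R) * y j) := by
  simp [bil, dotProduct, Matrix.mulVec, Finset.mul_sum]

theorem bil_map {S : Type*} [CommRing S] (f : R →+* S) :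
    L.bil S (fun i => f (x i)) (fun i => f (y i)) = f (L.bil R x y) := by
  simp [bil_eq_sum]

end Bilinear

theorem bil_star (x y : Fin (n + 2) → ℂ) :
    L.bil ℂ (star x) (star y) = star (L.bil ℂ x y) := by
  simp [bil_eq_sum]

theorem bil_toComplex (x y : Fin (n + 2) → ℝ) :
    L.bil ℂ (toComplex x) (toComplex y) = (L.bil ℝ x y : ℂ) :=
  L.bil_map x y Complex.ofRealHom

theorem star_toComplex (x : Fin (n + 2) → ℝ) : star (toComplex x) = toComplex x := by
  funext i; simp [toComplex]

theorem bil_star_toComplex (z : Fin (n + 2) → ℂ) (r : Fin (n + 2) → ℝ) :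
    L.bil ℂ (star z) (toComplex r) = star (L.bil ℂ z (toComplex r)) := by
  rw [← bil_star, star_toComplex]

/-- The real part of a vector of `L_ℂ`. -/
def reVec (z : Fin (n + 2) → ℂ) : Fin (n + 2) → ℝ := fun i => (z i).re

/-- The imaginary part of a vector of `L_ℂ`. -/
def imVec (z : Fin (n + 2) → ℂ) : Fin (n + 2) → ℝ := fun i => (z i).im

theorem eq_reVec_add_imVec (z : Fin (n + 2) → ℂ) :
    z = toComplex (reVec z) + Complex.I • toComplex (imVec z) := by
  funext i
  simp only [toComplex, reVec, imVec, Pi.add_apply, Pi.smul_apply, smul_eq_mul]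
  rw [mul_comm, Complex.re_add_im]

theorem star_eq_reVec_sub_imVec (z : Fin (n + 2) → ℂ) :
    star z = toComplex (reVec z) - Complex.I • toComplex (imVec z) := by
  funext i
  apply Complex.ext <;> simp [toComplex, reVec, imVec]

theorem bil_toComplex_right (z : Fin (n + 2) → ℂ) (r : Fin (n + 2) → ℝ) :
    L.bil ℂ z (toComplex r) = L.bil ℝ (reVec z) r + Complex.I * L.bil ℝ (imVec z) r := by
  conv_lhs => rw [eq_reVec_add_imVec z]
  rw [bil_add_left, bil_smul_left, bil_toComplex, bil_toComplex]

theorem bil_self_re (z : Fin (n + 2) → ℂ) :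
    (L.bil ℂ z z).re = L.bil ℝ (reVec z) (reVec z) - L.bil ℝ (imVec z) (imVec z) := by
  conv_lhs => rw [eq_reVec_add_imVec z]
  simp [bil_add_left, bil_add_right, bil_smul_left, bil_smul_right, bil_toComplex, sub_eq_add_neg]

theorem bil_self_im (z : Fin (n + 2) → ℂ) :
    (L.bil ℂ z z).im = 2 * L.bil ℝ (reVec z) (imVec z) := by
  conv_lhs => rw [eq_reVec_add_imVec z]
  simp only [bil_add_left, bil_add_right, bil_smul_left, bil_smul_right, bil_toComplex]
  simp [L.bil_comm (imVec z) (reVec z)]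
  ring

theorem bil_star_self (z : Fin (n + 2) → ℂ) :
    L.bil ℂ z (star z) =
      (L.bil ℝ (reVec z) (reVec z) + L.bil ℝ (imVec z) (imVec z) : ℝ) := by
  rw [star_eq_reVec_sub_imVec]
  conv_lhs => enter [3]; rw [eq_reVec_add_imVec z]
  simp only [bil_add_left, bil_sub_right, bil_smul_left, bil_smul_right, bil_toComplex]
  rw [L.bil_comm (imVec z) (reVec z)]
  push_cast
  linear_combination -(L.bil ℝ (imVec z) (imVec z) : ℂ) * Complex.I_mul_I

@[fun_prop]
theorem differentiable_bil :
    Differentiable ℂ fun p : (Fin (n + 2) → ℂ) × (Fin (n + 2) → ℂ) => L.bil ℂ p.1 p.2 := by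
  simp only [bil_eq_sum]
  fun_prop

@[fun_prop]
theorem continuous_bil {R : Type*} [CommRing R] [TopologicalSpace R] [IsTopologicalRing R] :
    Continuous fun p : (Fin (n + 2) → R) × (Fin (n + 2) → R) => L.bil R p.1 p.2 := by
  simp only [bil_eq_sum]
  fun_prop

/-- The linear functional `⟨·, w⟩` on `L_ℂ`. -/
noncomputable def bilFunctional (w : Fin (n + 2) → ℂ) : (Fin (n + 2) → ℂ) →L[ℂ] ℂ :=
  LinearMap.toContinuousLinearMap
    { toFun := fun z => L.bil ℂ z w
      map_add' := fun x y => L.bil_add_left x y w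
      map_smul' := fun a x => L.bil_smul_left x w a }

@[simp]
theorem bilFunctional_apply (w z : Fin (n + 2) → ℂ) : L.bilFunctional w z = L.bil ℂ z w := rfl

/-! ### Positivity -/

/-- As the signature is `(n, 2)`, the orthogonal complement of the negative definite plane spanned by
the real and imaginary parts of a point of the cone is positive definite. -/
theorem bil_self_pos_of_orthogonal {z : Fin (n + 2) → ℂ} (hz : z ∈ L.negCone)
    {u : Fin (n + 2) → ℝ} (hu : L.bil ℂ z (toComplex u) = 0) (hu0 : u ≠ 0) :
    0 < L.bil ℝ u u := by
  obtain ⟨hzz, hneg⟩ := hz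
  set X := reVec z
  set Y := imVec z
  have h1 : L.bil ℝ X X - L.bil ℝ Y Y = 0 := by rw [← bil_self_re, hzz]; simp
  have h2 : L.bil ℝ X Y = 0 := by
    have := L.bil_self_im z
    rw [hzz] at this
    simpa using this.symm
  have h3 : L.bil ℝ X X + L.bil ℝ Y Y < 0 := by
    rw [bil_star_self] at hneg
    simpa using hneg
  have hX : L.bil ℝ X X < 0 := by linarith
  have hY : L.bil ℝ Y Y = L.bil ℝ X X := by linarith
  rw [bil_toComplex_right] at hu
  have hXu : L.bil ℝ X u = 0 := by simpa using congrArg Complex.re hu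
  have hYu : L.bil ℝ Y u = 0 := by simpa using congrArg Complex.im hu
  have hYX : L.bil ℝ Y X = 0 := by rw [bil_comm]; exact h2
  have huX : L.bil ℝ u X = 0 := by rw [bil_comm]; exact hXu
  have huY : L.bil ℝ u Y = 0 := by rw [bil_comm]; exact hYu
  by_contra hcon
  push Not at hcon
  have hlin : LinearIndependent ℝ ![X, Y, u] := by
    rw [Fintype.linearIndependent_iff]
    intro g hg
    simp only [Fin.sum_univ_three, Matrix.cons_val_zero, Matrix.cons_val_one,
      Matrix.cons_val] at hg
    have h0 : g 0 = 0 := by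
      have := congrArg (fun v => L.bil ℝ v X) hg
      simpa [bil_add_left, bil_smul_left, bil_zero_left, hYX, huX, hX.ne] using this
    have h1 : g 1 = 0 := by
      have := congrArg (fun v => L.bil ℝ v Y) hg
      simpa [bil_add_left, bil_smul_left, bil_zero_left, h2, huY, hY, hX.ne] using this
    have h2 : g 2 = 0 := by
      rw [h0, h1] at hg
      simpa [hu0] using hg
    intro i
    fin_cases i
    exacts [h0, h1, h2]
  have hQ : ∀ x : Fin (n + 2) → ℝ,
      (L.gram.map (Int.cast : ℤ → ℝ)).toQuadraticForm' x = L.bil ℝ x x := by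
    intro x
    simp [Matrix.toQuadraticForm', Matrix.toLinearMap₂'_apply', bil]
  have hle := QuadraticForm.sigPos_add_finrank_le_of_nonpos
    (Q := (L.gram.map (Int.cast : ℤ → ℝ)).toQuadraticForm')
    (V := Submodule.span ℝ (Set.range ![X, Y, u])) (by
      intro x hx
      rw [hQ]
      obtain ⟨g, rfl⟩ := (Submodule.mem_span_range_iff_exists_fun ℝ).1 hx
      simp only [Fin.sum_univ_three, Matrix.cons_val_zero, Matrix.cons_val_one, Matrix.cons_val]
      simp only [bil_add_left, bil_add_right, bil_smul_left, bil_smul_right, h2, hXu, hYu, hYX, huX,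
        huY, hY]
      nlinarith [mul_nonneg (sq_nonneg (g 0)) (neg_nonneg.2 hX.le),
        mul_nonneg (sq_nonneg (g 1)) (neg_nonneg.2 hX.le),
        mul_nonneg (sq_nonneg (g 2)) (neg_nonneg.2 hcon)])
  rw [finrank_span_eq_card hlin] at hle
  have := L.sigPos_eq
  simp at hle
  omega

theorem bil_eq_zero_iff_of_star {z u : Fin (n + 2) → ℂ} (h : L.bil ℂ z u = 0)
    (h' : L.bil ℂ (star z) u = 0) :
    L.bil ℂ z (toComplex (reVec u)) = 0 ∧ L.bil ℂ z (toComplex (imVec u)) = 0 := by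
  have h1 : L.bil ℂ z (star u) = 0 := by
    have := L.bil_star (star z) u
    rw [h', star_star] at this
    simpa using this
  rw [eq_reVec_add_imVec u, bil_add_right, bil_smul_right] at h
  rw [star_eq_reVec_sub_imVec u, bil_sub_right, bil_smul_right] at h1
  constructor
  · linear_combination (h + h1) / 2
  · linear_combination -Complex.I / 2 * (h - h1) +
      L.bil ℂ z (toComplex (imVec u)) * Complex.I_mul_I

theorem bil_self_nonneg_of_orthogonal {z : Fin (n + 2) → ℂ} (hz : z ∈ L.negCone)
    {u : Fin (n + 2) → ℝ} (hu : L.bil ℂ z (toComplex u) = 0) : 0 ≤ L.bil ℝ u u := by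
  rcases eq_or_ne u 0 with rfl | hu0
  · rw [bil_zero_left]
  · exact (L.bil_self_pos_of_orthogonal hz hu hu0).le

/-- The triangle inequality for the positive definite complement of `z` and its conjugate.  After
multiplication of `u` by a complex number of modulus one, `⟨u, u⟩` is a nonnegative real number. -/
theorem norm_bil_self_le {z u : Fin (n + 2) → ℂ} (hz : z ∈ L.negCone) (h : L.bil ℂ z u = 0)
    (h' : L.bil ℂ (star z) u = 0) : ‖L.bil ℂ u u‖ ≤ (L.bil ℂ u (star u)).re := by
  have key : ∀ w : Fin (n + 2) → ℂ, L.bil ℂ z w = 0 → L.bil ℂ (star z) w = 0 →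
      (L.bil ℂ w w).re ≤ (L.bil ℂ w (star w)).re := by
    intro w hw hw'
    have h1 := L.bil_eq_zero_iff_of_star hw hw'
    rw [bil_self_re, bil_star_self, Complex.ofReal_re]
    linarith [L.bil_self_nonneg_of_orthogonal hz h1.2]
  obtain ⟨θ, hθ, hθu⟩ : ∃ θ : ℂ, ‖θ‖ = 1 ∧ θ * L.bil ℂ u u = ‖L.bil ℂ u u‖ := by
    rcases eq_or_ne (L.bil ℂ u u) 0 with h0 | h0
    · exact ⟨1, by simp, by simp [h0]⟩
    · have hn : (‖L.bil ℂ u u‖ : ℂ) ≠ 0 := by simpa using h0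
      refine ⟨‖L.bil ℂ u u‖ / L.bil ℂ u u, ?_, div_mul_cancel₀ _ h0⟩
      rw [norm_div, Complex.norm_real, norm_norm, div_self (norm_ne_zero_iff.2 h0)]
  obtain ⟨s, hs⟩ : ∃ s : ℂ, s ^ 2 = θ := IsAlgClosed.exists_pow_nat_eq θ two_pos
  have hs1 : ‖s‖ = 1 := by
    have : ‖s‖ ^ 2 = 1 := by rw [← norm_pow, hs, hθ]
    exact (pow_eq_one_iff_of_nonneg (norm_nonneg _) two_ne_zero).1 this
  have := key (s • u) (by rw [bil_smul_right, h, mul_zero]) (by rw [bil_smul_right, h', mul_zero])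
  have e1 : L.bil ℂ (s • u) (s • u) = ‖L.bil ℂ u u‖ := by
    rw [bil_smul_left, bil_smul_right, ← mul_assoc, ← sq, hs, hθu]
  have e2 : L.bil ℂ (s • u) (star (s • u)) = L.bil ℂ u (star u) := by
    rw [star_smul, bil_smul_left, bil_smul_right, ← mul_assoc, Complex.star_def, Complex.mul_conj,
      Complex.normSq_eq_norm_sq, hs1]
    simp
  rwa [e1, e2, Complex.ofReal_re] at this

theorem bil_star_self_eq_neg {z : Fin (n + 2) → ℂ} (hz : z ∈ L.negCone) :
    ∃ d : ℝ, 0 < d ∧ L.bil ℂ z (star z) = -(d : ℂ) := by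
  have h := hz.2
  rw [bil_star_self, Complex.ofReal_re] at h
  exact ⟨_, neg_pos.2 h, by rw [bil_star_self, Complex.ofReal_neg, neg_neg]⟩

/-- Decomposition of a vector along the hyperbolic plane spanned by `z₁` and its conjugate. -/
theorem exists_decomposition {z₁ : Fin (n + 2) → ℂ} (hz₁ : z₁ ∈ L.negCone) (w : Fin (n + 2) → ℂ) :
    ∃ a b : ℂ, ∃ u : Fin (n + 2) → ℂ, w = a • z₁ + b • star z₁ + u ∧ L.bil ℂ z₁ u = 0 ∧
      L.bil ℂ (star z₁) u = 0 ∧ L.bil ℂ w (star z₁) = a * L.bil ℂ z₁ (star z₁) ∧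
      L.bil ℂ w z₁ = b * L.bil ℂ z₁ (star z₁) := by
  obtain ⟨d, hd, hN⟩ := L.bil_star_self_eq_neg hz₁
  have hN0 : L.bil ℂ z₁ (star z₁) ≠ 0 := by
    rw [hN]; simpa using hd.ne'
  have h00 : L.bil ℂ (star z₁) (star z₁) = 0 := by rw [bil_star, hz₁.1, star_zero]
  refine ⟨L.bil ℂ w (star z₁) / L.bil ℂ z₁ (star z₁), L.bil ℂ w z₁ / L.bil ℂ z₁ (star z₁),
    w - (L.bil ℂ w (star z₁) / L.bil ℂ z₁ (star z₁)) • z₁ -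
      (L.bil ℂ w z₁ / L.bil ℂ z₁ (star z₁)) • star z₁, by abel, ?_, ?_,
    (div_mul_cancel₀ _ hN0).symm, (div_mul_cancel₀ _ hN0).symm⟩
  · rw [bil_sub_right, bil_sub_right, bil_smul_right, bil_smul_right, hz₁.1,
      div_mul_cancel₀ _ hN0, L.bil_comm w z₁]
    ring
  · rw [bil_sub_right, bil_sub_right, bil_smul_right, bil_smul_right, h00,
      L.bil_comm (star z₁) z₁, div_mul_cancel₀ _ hN0, L.bil_comm w (star z₁)]
    ring

/-- The inequality describing the cone in the coordinates of `exists_decomposition`, and the quadric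
in these coordinates. -/
theorem decomposition_bil {z₁ u : Fin (n + 2) → ℂ} (hz₁ : z₁ ∈ L.negCone)
    (hu : L.bil ℂ z₁ u = 0) (hu' : L.bil ℂ (star z₁) u = 0) (a b : ℂ) :
    L.bil ℂ (a • z₁ + b • star z₁ + u) (a • z₁ + b • star z₁ + u) =
        2 * a * b * L.bil ℂ z₁ (star z₁) + L.bil ℂ u u ∧
      (L.bil ℂ (a • z₁ + b • star z₁ + u) (star (a • z₁ + b • star z₁ + u))).re =
        (‖a‖ ^ 2 + ‖b‖ ^ 2) * (L.bil ℂ z₁ (star z₁)).re + (L.bil ℂ u (star u)).re := by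
  have h00 : L.bil ℂ (star z₁) (star z₁) = 0 := by rw [bil_star, hz₁.1, star_zero]
  have hs : L.bil ℂ z₁ (star u) = 0 := by
    have := L.bil_star (star z₁) u
    rw [hu', star_star] at this
    simpa using this
  have hs' : L.bil ℂ (star z₁) (star u) = 0 := by rw [bil_star, hu, star_zero]
  have c1 := L.bil_comm u z₁
  have c2 := L.bil_comm u (star z₁)
  have c3 := L.bil_comm (star z₁) z₁
  constructor
  · simp only [bil_add_left, bil_add_right, bil_smul_left, bil_smul_right, hz₁.1, h00, hu, hu', c1,
      c2, c3]
    ring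
  · have : L.bil ℂ (a • z₁ + b • star z₁ + u) (star (a • z₁ + b • star z₁ + u)) =
        ((‖a‖ ^ 2 + ‖b‖ ^ 2 : ℝ) : ℂ) * L.bil ℂ z₁ (star z₁) + L.bil ℂ u (star u) := by
      simp only [star_add, star_smul, star_star]
      simp only [bil_add_left, bil_add_right, bil_smul_left, bil_smul_right, hz₁.1, h00, hu, hu',
        c1, c2, c3, hs, hs', Complex.star_def]
      push_cast
      rw [← Complex.mul_conj' a, ← Complex.mul_conj' b]
      ring
    rw [this, Complex.add_re, Complex.re_ofReal_mul]

/-- For two points of the cone over both components, exactly one of `⟨z, z₁⟩` and `⟨z, conj z₁⟩` has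
the larger modulus. -/
theorem norm_bil_ne_norm_bil_star {z₁ z : Fin (n + 2) → ℂ} (hz₁ : z₁ ∈ L.negCone)
    (hz : z ∈ L.negCone) : ‖L.bil ℂ z z₁‖ ≠ ‖L.bil ℂ z (star z₁)‖ := by
  obtain ⟨a, b, u, hw, hu, hu', ha, hb⟩ := L.exists_decomposition hz₁ z
  obtain ⟨d, hd, hN⟩ := L.bil_star_self_eq_neg hz₁
  have h := L.decomposition_bil hz₁ hu hu' a b
  rw [← hw, hz.1, hN] at h
  have h2 := hz.2
  rw [h.2] at h2
  have h3 := L.norm_bil_self_le hz₁ hu hu'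
  have h4 : ‖L.bil ℂ u u‖ = 2 * ‖a‖ * ‖b‖ * d := by
    rw [show L.bil ℂ u u = 2 * a * b * d by linear_combination -h.1]
    simp [abs_of_pos hd]
  rw [h4] at h3
  rw [ha, hb, hN, norm_mul, norm_mul]
  intro heq
  have hab : ‖b‖ = ‖a‖ := by
    refine mul_right_cancel₀ (b := ‖-(d : ℂ)‖) ?_ heq
    simpa using hd.ne'
  rw [hab] at h2 h3
  simp only [Complex.neg_re, Complex.ofReal_re] at h2
  nlinarith

end EvenLattice

namespace EvenLattice

variable {n : ℕ} (L : EvenLattice n)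

/-! ### The domain as an open subset of the quadric -/

/-- The projection of `L_ℂ` to the quadric along the isotropic vector `w`. -/
noncomputable def coneProj (w x : Fin (n + 2) → ℂ) : Fin (n + 2) → ℂ :=
  x - (L.quad ℂ x / L.bil ℂ x w) • w

theorem coneProj_of_isotropic {w x : Fin (n + 2) → ℂ} (hx : L.bil ℂ x x = 0) :
    L.coneProj w x = x := by
  simp [coneProj, quad, hx]

theorem bil_coneProj_of_orthogonal {w r : Fin (n + 2) → ℂ} (hwr : L.bil ℂ w r = 0)
    (x : Fin (n + 2) → ℂ) : L.bil ℂ (L.coneProj w x) r = L.bil ℂ x r := by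
  rw [coneProj, bil_sub_left, bil_smul_left, hwr, mul_zero, sub_zero]

theorem bil_coneProj_self {w x : Fin (n + 2) → ℂ} (hw : L.bil ℂ w w = 0)
    (hx : L.bil ℂ x w ≠ 0) : L.bil ℂ (L.coneProj w x) (L.coneProj w x) = 0 := by
  have := L.bil_comm w x
  simp only [coneProj, bil_sub_left, bil_sub_right, bil_smul_left, bil_smul_right, hw, this, quad]
  field_simp
  ring

theorem differentiableAt_coneProj {w x : Fin (n + 2) → ℂ} (hx : L.bil ℂ x w ≠ 0) :
    DifferentiableAt ℂ (L.coneProj w) x := by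
  have h1 : DifferentiableAt ℂ (fun y => L.bil ℂ y y) x :=
    DifferentiableAt.comp (f := fun y => (y, y)) x (L.differentiable_bil _)
      (differentiableAt_id.prodMk differentiableAt_id)
  have h2 : DifferentiableAt ℂ (fun y => L.bil ℂ y w) x := (L.bilFunctional w).differentiableAt
  have : L.coneProj w = fun y => y - ((L.bil ℂ y y) * 2⁻¹ * (L.bil ℂ y w)⁻¹) • w := by
    funext y; simp only [coneProj, quad, div_eq_mul_inv]
  rw [this]
  exact differentiableAt_id.sub (((h1.mul_const _).mul (h2.fun_inv hx)).smul_const w)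

namespace IsDomainCone

variable {L} {A : Set (Fin (n + 2) → ℂ)} (hA : L.IsDomainCone A)

include hA

theorem subset_negCone : A ⊆ L.negCone := by
  obtain ⟨z, -, rfl⟩ := hA
  exact connectedComponentIn_subset _ _

theorem isPreconnected : IsPreconnected A := by
  obtain ⟨z, -, rfl⟩ := hA
  exact isPreconnected_connectedComponentIn

theorem nonempty : A.Nonempty := by
  obtain ⟨z, hz, rfl⟩ := hA
  exact ⟨z, mem_connectedComponentIn hz⟩

theorem bil_self {z : Fin (n + 2) → ℂ} (hz : z ∈ A) : L.bil ℂ z z = 0 := (hA.subset_negCone hz).1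

theorem subset_of_isPreconnected {S : Set (Fin (n + 2) → ℂ)} (hS : IsPreconnected S)
    (hSc : S ⊆ L.negCone) {z : Fin (n + 2) → ℂ} (hz : z ∈ S) (hzA : z ∈ A) : S ⊆ A := by
  obtain ⟨z₀, hz₀, rfl⟩ := hA
  rw [connectedComponentIn_eq hzA]
  exact hS.subset_connectedComponentIn hz hSc

open Set in
theorem smul_mem {t : ℂ} (ht : t ≠ 0) {z : Fin (n + 2) → ℂ} (hz : z ∈ A) : t • z ∈ A := by
  have hc : IsPreconnected ({0}ᶜ : Set ℂ) :=
    (isConnected_compl_singleton_of_one_lt_rank (by simp) 0).isPreconnected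
  refine hA.subset_of_isPreconnected (S := (fun t : ℂ => t • z) '' {0}ᶜ)
    (hc.image _ (by fun_prop)) ?_ (z := z) ⟨1, by simp, by simp⟩ hz ⟨t, by simpa using ht, rfl⟩
  rintro _ ⟨s, hs, rfl⟩
  have hs : s ≠ 0 := hs
  have hz' := hA.subset_negCone hz
  refine ⟨by simp [bil_smul_left, bil_smul_right, hz'.1], ?_⟩
  have e : L.bil ℂ (s • z) (star (s • z)) = ((‖s‖ ^ 2 : ℝ) : ℂ) * L.bil ℂ z (star z) := by
    rw [star_smul, bil_smul_left, bil_smul_right, ← mul_assoc, Complex.star_def, Complex.mul_conj,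
      Complex.normSq_eq_norm_sq]
  simp only [e, Complex.re_ofReal_mul]
  exact mul_neg_of_pos_of_neg (by positivity) hz'.2

open Set Filter Topology in
/-- The domain is open in the quadric. -/
theorem eventually_mem {z : Fin (n + 2) → ℂ} (hz : z ∈ A) :
    ∀ᶠ x in 𝓝 z, L.bil ℂ x x = 0 → x ∈ A := by
  have hz' := hA.subset_negCone hz
  obtain ⟨d, hd, hN⟩ := L.bil_star_self_eq_neg hz'
  have hN0 : L.bil ℂ z (star z) ≠ 0 := by rw [hN]; simpa using hd.ne'
  have hst : L.bil ℂ (star z) (star z) = 0 := by rw [bil_star, hz'.1, star_zero]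
  have hpz : L.coneProj (star z) z = z := L.coneProj_of_isotropic hz'.1
  have e1 : ∀ᶠ x in 𝓝 z, L.bil ℂ x (star z) ≠ 0 :=
    (L.bilFunctional (star z)).continuous.continuousAt.eventually_ne hN0
  have e2 : ∀ᶠ x in 𝓝 z,
      (L.bil ℂ (L.coneProj (star z) x) (star (L.coneProj (star z) x))).re < 0 := by
    have hc : ContinuousAt (fun x => L.coneProj (star z) x) z :=
      (L.differentiableAt_coneProj hN0).continuousAt
    have hc2 : ContinuousAt (fun x => L.bil ℂ (L.coneProj (star z) x)
        (star (L.coneProj (star z) x))) z :=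
      ContinuousAt.comp (f := fun x => (L.coneProj (star z) x, star (L.coneProj (star z) x)))
        L.continuous_bil.continuousAt (hc.prodMk hc.star)
    refine (Complex.continuous_re.continuousAt.comp hc2).eventually_lt continuousAt_const ?_
    simpa [hpz] using hz'.2
  obtain ⟨ε, hε, hball⟩ := Metric.eventually_nhds_iff_ball.1 (e1.and e2)
  have hsub : L.coneProj (star z) '' Metric.ball z ε ⊆ A := by
    refine hA.subset_of_isPreconnected (z := z) ?_ ?_ ⟨z, Metric.mem_ball_self hε, hpz⟩ hz
    · refine (convex_ball z ε).isPreconnected.image _ fun x hx => ?_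
      exact (L.differentiableAt_coneProj (hball x hx).1).continuousAt.continuousWithinAt
    · rintro _ ⟨x, hx, rfl⟩
      exact ⟨L.bil_coneProj_self hst (hball x hx).1, (hball x hx).2⟩
  filter_upwards [Metric.ball_mem_nhds z hε] with x hx hxx
  exact hsub ⟨x, hx, L.coneProj_of_isotropic hxx⟩

open Set Filter Topology in
/-- The set of points projected into `A` along an isotropic vector `w` is open. -/
theorem isOpen_coneProj_preimage {w : Fin (n + 2) → ℂ} (hw : L.bil ℂ w w = 0) :
    IsOpen {x | L.bil ℂ x w ≠ 0 ∧ L.coneProj w x ∈ A} := by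
  rw [isOpen_iff_mem_nhds]
  rintro x ⟨hx, hxA⟩
  have e1 : ∀ᶠ y in 𝓝 x, L.bil ℂ y w ≠ 0 :=
    (L.bilFunctional w).continuous.continuousAt.eventually_ne hx
  filter_upwards [e1, (L.differentiableAt_coneProj hx).continuousAt.eventually
    (hA.eventually_mem hxA)] with y hy hy'
  exact ⟨hy, hy' (L.bil_coneProj_self hw hy)⟩

open Set Filter Topology in
theorem norm_bil_lt_norm_bil_star {z₁ z : Fin (n + 2) → ℂ} (hz₁ : z₁ ∈ A) (hz : z ∈ A) :
    ‖L.bil ℂ z z₁‖ < ‖L.bil ℂ z (star z₁)‖ := by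
  by_contra! hcon
  have hc : ContinuousOn (fun z => ‖L.bil ℂ z (star z₁)‖ - ‖L.bil ℂ z z₁‖) A := by
    have h1 := (L.bilFunctional (star z₁)).continuous
    have h2 := (L.bilFunctional z₁).continuous
    exact (h1.norm.sub h2.norm).continuousOn
  have hz₁' := hA.subset_negCone hz₁
  have h0 : (0 : ℝ) ∈ Icc (‖L.bil ℂ z (star z₁)‖ - ‖L.bil ℂ z z₁‖)
      (‖L.bil ℂ z₁ (star z₁)‖ - ‖L.bil ℂ z₁ z₁‖) := by
    refine ⟨by linarith, ?_⟩
    rw [hz₁'.1, norm_zero, sub_zero]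
    exact norm_nonneg _
  obtain ⟨y, hy, hy0⟩ := hA.isPreconnected.intermediate_value hz hz₁ hc h0
  exact L.norm_bil_ne_norm_bil_star hz₁' (hA.subset_negCone hy) (sub_eq_zero.1 hy0).symm

/-- Any two points of the domain are joined by a holomorphic disc in the domain, which stays in every
mirror containing both points.  In the bounded realisation centred at `z₁` the domain is starlike, and
the disc is the complex radius. -/
theorem exists_disc {z₁ w : Fin (n + 2) → ℂ} (hz₁ : z₁ ∈ A) (hw : w ∈ A) :
    ∃ γ : ℂ → (Fin (n + 2) → ℂ), Differentiable ℂ γ ∧ γ 0 = z₁ ∧ γ 1 = w ∧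
      (∀ t ∈ Metric.closedBall (0 : ℂ) 1, γ t ∈ A) ∧
      ∀ r : Fin (n + 2) → ℝ, L.bil ℂ z₁ (toComplex r) = 0 → L.bil ℂ w (toComplex r) = 0 →
        ∀ t, L.bil ℂ (γ t) (toComplex r) = 0 := by
  have hz₁' := hA.subset_negCone hz₁
  have hw' := hA.subset_negCone hw
  obtain ⟨a, b, u, hwe, hu, hu', ha, hb⟩ := L.exists_decomposition hz₁' w
  obtain ⟨d, hd, hN⟩ := L.bil_star_self_eq_neg hz₁'
  have hlt := hA.norm_bil_lt_norm_bil_star hz₁ hw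
  rw [ha, hb, norm_mul, norm_mul] at hlt
  have hlt' : ‖b‖ < ‖a‖ := lt_of_mul_lt_mul_right hlt (norm_nonneg _)
  have ha0 : a ≠ 0 := norm_pos_iff.1 ((norm_nonneg b).trans_lt hlt')
  have hbil := L.decomposition_bil hz₁' hu hu' a b
  rw [← hwe, hw'.1, hN] at hbil
  have hneg := hw'.2
  rw [hbil.2] at hneg
  simp only [Complex.neg_re, Complex.ofReal_re] at hneg
  have hq : L.bil ℂ u u = 2 * a * b * d := by linear_combination -hbil.1
  have hline : ∀ t : ℂ, z₁ + (t / a) • u + (t ^ 2 * b / a) • star z₁ =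
      (1 : ℂ) • z₁ + (t ^ 2 * b / a) • star z₁ + (t / a) • u := by
    intro t; rw [one_smul]; abel
  have hdisc : (fun t : ℂ => z₁ + (t / a) • u + (t ^ 2 * b / a) • star z₁) ''
      Metric.closedBall (0 : ℂ) 1 ⊆ A := by
    refine hA.subset_of_isPreconnected (z := z₁) ?_ ?_ ⟨0, by simp, by simp⟩ hz₁
    · exact (convex_closedBall (0 : ℂ) 1).isPreconnected.image _ (by fun_prop)
    · rintro _ ⟨t, ht, rfl⟩
      have ht1 : ‖t‖ ≤ 1 := by simpa using ht
      have hbil' := L.decomposition_bil hz₁' (u := (t / a) • u)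
        (by rw [bil_smul_right, hu, mul_zero]) (by rw [bil_smul_right, hu', mul_zero]) 1
        (t ^ 2 * b / a)
      simp only [hline]
      constructor
      · rw [hbil'.1, bil_smul_left, bil_smul_right, hq, hN]
        field_simp
        ring
      · rw [hbil'.2, hN]
        have e : L.bil ℂ ((t / a) • u) (star ((t / a) • u)) =
            ((‖t / a‖ ^ 2 : ℝ) : ℂ) * L.bil ℂ u (star u) := by
          rw [star_smul, bil_smul_left, bil_smul_right, ← mul_assoc, Complex.star_def,
            Complex.mul_conj, Complex.normSq_eq_norm_sq]
        rw [e, Complex.re_ofReal_mul]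
        simp only [Complex.neg_re, Complex.ofReal_re, norm_div, norm_mul, norm_pow, norm_one]
        -- with `s = ‖t‖²` and `β = ‖b / a‖`, one has `1 + s²β² - s(1 + β²) = (1 - s)(1 - sβ²) ≥ 0`
        have hapos : 0 < ‖a‖ := norm_pos_iff.2 ha0
        set s := ‖t‖ ^ 2 with hs
        have hs0 : 0 ≤ s := by positivity
        have hs1 : s ≤ 1 := by rw [hs]; exact pow_le_one₀ (norm_nonneg _) ht1
        set α := ‖a‖ ^ 2 with hα
        have hα0 : 0 < α := by positivity
        set β := ‖b‖ ^ 2 with hβ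
        have hβ0 : 0 ≤ β := by positivity
        have hβα : β < α := by
          rw [hα, hβ]; exact pow_lt_pow_left₀ hlt' (norm_nonneg _) two_ne_zero
        set E := (L.bil ℂ u (star u)).re
        have e2 : (1 ^ 2 + (s * ‖b‖ / ‖a‖) ^ 2) * -d + (‖t‖ / ‖a‖) ^ 2 * E =
            (-(α + s ^ 2 * β) * d + s * E) / α := by
          rw [hα, hβ, hs]; field_simp
        rw [e2]
        refine div_neg_of_neg_of_pos ?_ hα0
        rcases eq_or_lt_of_le hs0 with h0 | h0
        · rw [← h0]; nlinarith
        · have h1 : s * E < s * ((α + β) * d) := mul_lt_mul_of_pos_left (by linarith) h0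
          have h2 : 0 ≤ (1 - s) * (α - s * β) := mul_nonneg (by linarith) (by nlinarith)
          nlinarith [mul_nonneg h2 hd.le]
  refine ⟨fun t => Complex.exp (t * Complex.log a) •
    (z₁ + (t / a) • u + (t ^ 2 * b / a) • star z₁), ?_, by simp, ?_, ?_, ?_⟩
  · intro t
    fun_prop
  · simp only [one_mul, Complex.exp_log ha0, smul_add, smul_smul, one_pow]
    rw [hwe, mul_div_cancel₀ _ ha0, mul_div_cancel₀ _ ha0, one_smul]
    abel
  · intro t ht
    exact hA.smul_mem (Complex.exp_ne_zero _) (hdisc ⟨t, ht, rfl⟩)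
  · intro r hr hrw t
    have h1 : L.bil ℂ (star z₁) (toComplex r) = 0 := by
      rw [bil_star_toComplex, hr, star_zero]
    have h2 : L.bil ℂ u (toComplex r) = 0 := by
      rw [hwe] at hrw
      simpa [bil_add_left, bil_smul_left, hr, h1] using hrw
    simp [bil_add_left, bil_smul_left, hr, h1, h2]

open Set Filter Topology in
/-- The identity theorem on a mirror. -/
theorem eq_zero_of_eventually_eq_zero {K : (Fin (n + 2) → ℂ) → ℂ} (hK : DifferentiableOn ℂ K A)
    {r : Fin (n + 2) → ℝ} {z₁ w : Fin (n + 2) → ℂ} (hz₁ : z₁ ∈ A)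
    (hr : L.bil ℂ z₁ (toComplex r) = 0)
    (h0 : ∀ᶠ z in 𝓝 z₁, z ∈ A → L.bil ℂ z (toComplex r) = 0 → K z = 0)
    (hw : w ∈ A) (hrw : L.bil ℂ w (toComplex r) = 0) : K w = 0 := by
  obtain ⟨γ, hγ, hγ0, hγ1, hγA, hγr⟩ := hA.exists_disc hz₁ hw
  have hd : DifferentiableOn ℂ (fun t => K (γ t)) (Metric.closedBall 0 1) :=
    hK.comp hγ.differentiableOn hγA
  have han := (hd.mono Metric.ball_subset_closedBall).analyticOnNhd Metric.isOpen_ball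
  have hev : (fun t => K (γ t)) =ᶠ[𝓝 0] 0 := by
    have hc : Tendsto γ (𝓝 0) (𝓝 z₁) := by
      have := hγ.continuous.continuousAt (x := 0)
      rwa [ContinuousAt, hγ0] at this
    filter_upwards [hc.eventually h0, Metric.closedBall_mem_nhds (0 : ℂ) one_pos] with t ht ht'
    exact ht (hγA t ht') (hγr r hr hrw t)
  have hz := han.eqOn_zero_of_preconnected_of_eventuallyEq_zero
    (convex_ball (0 : ℂ) 1).isPreconnected (Metric.mem_ball_self one_pos) hev
  have hcl : EqOn (fun t => K (γ t)) 0 (Metric.closedBall 0 1) := by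
    refine hz.of_subset_closure hd.continuousOn continuousOn_const Metric.ball_subset_closedBall ?_
    rw [closure_ball _ one_ne_zero]
  have := hcl (x := 1) (by simp)
  simpa [hγ1] using this

end IsDomainCone

end EvenLattice

namespace EvenLattice

variable {n : ℕ} (L : EvenLattice n)

/-! ### Automorphisms and mirrors -/

section Action

variable {R : Type*} [CommRing R] (g : GL (Fin (n + 2)) ℤ)

theorem act_add (x y : Fin (n + 2) → R) : act R g (x + y) = act R g x + act R g y :=
  Matrix.mulVec_add _ _ _

theorem act_smul (a : R) (x : Fin (n + 2) → R) : act R g (a • x) = a • act R g x :=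
  Matrix.mulVec_smul _ _ _

theorem act_map {S : Type*} [CommRing S] (f : R →+* S) (x : Fin (n + 2) → R) :
    act S g (fun i => f (x i)) = fun i => f (act R g x i) := by
  funext i
  simp [act, Matrix.mulVec, dotProduct]

theorem act_toComplex (x : Fin (n + 2) → ℝ) : act ℂ g (toComplex x) = toComplex (act ℝ g x) :=
  act_map g Complex.ofRealHom x

theorem continuous_act : Continuous (act ℂ g) := by
  unfold act
  fun_prop

end Action

theorem transpose_mul_gram_mul {A : Set (Fin (n + 2) → ℂ)} {g : GL (Fin (n + 2)) ℤ}
    (hg : g ∈ L.OPlus A) : g.1ᵀ * L.gram * g.1 = L.gram := by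
  ext i j
  have h := hg.1 (Pi.single i 1) (Pi.single j 1)
  have e : L.gram.map (Int.cast : ℤ → ℤ) = L.gram := by ext; simp
  have e' : g.1.map (Int.cast : ℤ → ℤ) = g.1 := by ext; simp
  simp only [bil, act, e, e', Matrix.mulVec_single_one,
    single_one_dotProduct] at h
  rw [show L.gram i j = L.gram.col j i from rfl, ← h, Matrix.mul_assoc, Matrix.mul_apply]
  rfl

theorem bil_act {R : Type*} [CommRing R] {A : Set (Fin (n + 2) → ℂ)} {g : GL (Fin (n + 2)) ℤ}
    (hg : g ∈ L.OPlus A) (x y : Fin (n + 2) → R) :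
    L.bil R (act R g x) (act R g y) = L.bil R x y := by
  have h := congrArg (fun M : Matrix _ _ ℤ => M.map (Int.castRingHom R))
    (L.transpose_mul_gram_mul hg)
  simp only [Matrix.map_mul] at h
  rw [Matrix.transpose_map] at h
  simp only [bil, act]
  rw [Matrix.mulVec_mulVec, Matrix.dotProduct_mulVec, Matrix.vecMul_mulVec, ← Matrix.dotProduct_mulVec]
  change x ⬝ᵥ _ *ᵥ y = x ⬝ᵥ (L.gram.map (Int.castRingHom R)) *ᵥ y
  rw [← h]
  congr 2
  simp only [Int.coe_castRingHom, Matrix.mul_assoc]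

theorem act_mem {A : Set (Fin (n + 2) → ℂ)} {g : GL (Fin (n + 2)) ℤ} (hg : g ∈ L.OPlus A)
    {z : Fin (n + 2) → ℂ} (hz : z ∈ A) : act ℂ g z ∈ A := by
  rw [← hg.2]
  exact ⟨z, hz, rfl⟩

/-- The element `γ` of `Γ` is the reflection in the anisotropic real vector `r`. -/
structure IsReflectionIn (Γ : Subgroup (GL (Fin (n + 2)) ℤ)) (γ : GL (Fin (n + 2)) ℤ)
    (r : Fin (n + 2) → ℝ) : Prop where
  mem : γ ∈ Γ
  anisotropic : L.bil ℝ r r ≠ 0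
  act_eq : ∀ v, act ℝ γ v = L.reflection r v

namespace IsReflectionIn

variable {L} {Γ : Subgroup (GL (Fin (n + 2)) ℤ)} {γ : GL (Fin (n + 2)) ℤ} {r : Fin (n + 2) → ℝ}
  (h : L.IsReflectionIn Γ γ r)

include h

theorem ne_zero : r ≠ 0 := by
  rintro rfl
  exact h.anisotropic (L.bil_zero_left _)

theorem toComplex_ne_zero : toComplex r ≠ 0 := by
  intro h0
  refine h.ne_zero (funext fun i => ?_)
  simpa [toComplex] using congrFun h0 i

theorem act_complex (z : Fin (n + 2) → ℂ) :
    act ℂ γ z = z - (2 * L.bil ℂ z (toComplex r) / (L.bil ℝ r r : ℂ)) • toComplex r := by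
  have hr : ∀ v : Fin (n + 2) → ℝ, act ℂ γ (toComplex v) = toComplex v -
      (2 * L.bil ℂ (toComplex v) (toComplex r) / (L.bil ℝ r r : ℂ)) • toComplex r := by
    intro v
    rw [act_toComplex, h.act_eq, bil_toComplex]
    funext i
    simp [toComplex, reflection]
  conv_lhs => rw [eq_reVec_add_imVec z]
  rw [act_add, act_smul, hr, hr]
  conv_rhs => rw [eq_reVec_add_imVec z]
  rw [bil_add_left, bil_smul_left]
  funext i
  simp only [Pi.add_apply, Pi.sub_apply, Pi.smul_apply, smul_eq_mul]
  ring

theorem bil_act_complex (z : Fin (n + 2) → ℂ) :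
    L.bil ℂ (act ℂ γ z) (toComplex r) = -L.bil ℂ z (toComplex r) := by
  have h0 : (L.bil ℝ r r : ℂ) ≠ 0 := by exact_mod_cast h.anisotropic
  rw [h.act_complex, bil_sub_left, bil_smul_left, bil_toComplex]
  field_simp
  ring

theorem act_eq_self_iff {z : Fin (n + 2) → ℂ} :
    act ℂ γ z = z ↔ L.bil ℂ z (toComplex r) = 0 := by
  have h0 : (L.bil ℝ r r : ℂ) ≠ 0 := by exact_mod_cast h.anisotropic
  rw [h.act_complex, sub_eq_self, smul_eq_zero, or_iff_left h.toComplex_ne_zero, div_eq_zero_iff,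
    or_iff_left h0, mul_eq_zero, or_iff_right two_ne_zero]

theorem pos {z : Fin (n + 2) → ℂ} (hz : z ∈ L.negCone) (hzr : L.bil ℂ z (toComplex r) = 0) :
    0 < L.bil ℝ r r :=
  L.bil_self_pos_of_orthogonal hz hzr h.ne_zero

end IsReflectionIn

open Set Filter Topology in
/-- Local finiteness: only finitely many reflections of the lattice have a mirror that meets a small
neighbourhood of `z₀`.  If `r` is orthogonal to a point near `z₀`, then `⟨r, r⟩` is bounded below by a
multiple of `|r|²`, so the entries of the integral matrix of the reflection are bounded. -/
theorem exists_finite_reflections {z₀ : Fin (n + 2) → ℂ} (hz₀ : z₀ ∈ L.negCone)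
    (Γ : Subgroup (GL (Fin (n + 2)) ℤ)) :
    ∃ Φ : Set (GL (Fin (n + 2)) ℤ), Φ.Finite ∧ ∀ᶠ z in 𝓝 z₀, ∀ γ r, L.IsReflectionIn Γ γ r →
      L.bil ℂ z (toComplex r) = 0 → γ ∈ Φ := by
  have hcont : Continuous fun q : (Fin (n + 2) → ℂ) × (Fin (n + 2) → ℝ) =>
      L.bil ℂ q.1 (toComplex q.2) := by
    refine L.continuous_bil.comp (continuous_fst.prodMk ?_)
    exact continuous_pi fun i =>
      Complex.continuous_ofReal.comp ((continuous_apply i).comp continuous_snd)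
  have hcr : Continuous fun r : Fin (n + 2) → ℝ => L.bil ℝ r r :=
    L.continuous_bil.comp (continuous_id.prodMk continuous_id)
  obtain ⟨m, hm, hmr⟩ : ∃ m : ℝ, 0 < m ∧ ∀ r ∈ Metric.sphere (0 : Fin (n + 2) → ℝ) 1,
      L.bil ℂ z₀ (toComplex r) = 0 → m ≤ L.bil ℝ r r := by
    have hK : IsCompact (Metric.sphere (0 : Fin (n + 2) → ℝ) 1 ∩
        {r | L.bil ℂ z₀ (toComplex r) = 0}) :=
      (isCompact_sphere _ _).inter_right
        (isClosed_eq (hcont.comp (continuous_const.prodMk continuous_id)) continuous_const)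
    rcases eq_empty_or_nonempty (Metric.sphere (0 : Fin (n + 2) → ℝ) 1 ∩
        {r | L.bil ℂ z₀ (toComplex r) = 0}) with he | hne
    · refine ⟨1, one_pos, fun r hr hr' => ?_⟩
      have : r ∈ (∅ : Set (Fin (n + 2) → ℝ)) := he ▸ mem_inter hr hr'
      exact absurd this (notMem_empty r)
    · obtain ⟨r₀, hr₀, hmin⟩ := hK.exists_isMinOn hne hcr.continuousOn
      refine ⟨_, L.bil_self_pos_of_orthogonal hz₀ hr₀.2 ?_, fun r hr hr' => hmin ⟨hr, hr'⟩⟩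
      rintro rfl
      simpa using hr₀.1
  obtain ⟨C, hC⟩ := ((isCompact_closedBall (0 : Fin (n + 2) → ℝ) 1).prod
    (isCompact_closedBall (0 : Fin (n + 2) → ℝ) 1)).exists_bound_of_continuousOn
    (f := fun q => L.bil ℝ q.1 q.2) L.continuous_bil.continuousOn
  have hev : ∀ᶠ z in 𝓝 z₀, ∀ r ∈ Metric.sphere (0 : Fin (n + 2) → ℝ) 1,
      L.bil ℂ z (toComplex r) = 0 → m / 2 < L.bil ℝ r r := by
    refine (isCompact_sphere _ _).eventually_forall_of_forall_eventually fun r hr => ?_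
    by_cases h0 : L.bil ℂ z₀ (toComplex r) = 0
    · have h1 : m / 2 < L.bil ℝ r r := by linarith [hmr r hr h0]
      have := (hcr.comp continuous_snd).continuousAt (x := (z₀, r))
      filter_upwards [this.eventually_const_lt h1] with q hq _ using hq
    · filter_upwards [hcont.continuousAt.eventually_ne h0] with q hq hq' using absurd hq' hq
  set M : ℝ := 1 + 2 * C / (m / 2) with hM
  refine ⟨{γ | ∀ i j, γ.1 i j ∈ Icc (-⌈M⌉) ⌈M⌉}, ?_, ?_⟩
  · refine Set.Finite.of_finite_image (f := fun γ : GL (Fin (n + 2)) ℤ => γ.1) ?_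
      (fun _ _ _ _ h => Units.ext h)
    refine (Set.Finite.pi' (t := fun _ : Fin (n + 2) =>
      {v : Fin (n + 2) → ℤ | ∀ j, v j ∈ Icc (-⌈M⌉) ⌈M⌉}) fun i =>
        Set.Finite.pi' fun j => finite_Icc _ _).subset ?_
    rintro _ ⟨γ, hγ, rfl⟩
    exact hγ
  · filter_upwards [hev] with z hz γ r hγ hzr i j
    have hr0 : 0 < ‖r‖ := norm_pos_iff.2 hγ.ne_zero
    -- normalise `r` to a unit vector `s` of the supremum norm
    set s : Fin (n + 2) → ℝ := ‖r‖⁻¹ • r with hs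
    have hsn : s ∈ Metric.sphere (0 : Fin (n + 2) → ℝ) 1 := by
      simp [hs, norm_smul, hr0.ne']
    have hzs : L.bil ℂ z (toComplex s) = 0 := by
      have : toComplex s = ((‖r‖⁻¹ : ℝ) : ℂ) • toComplex r := by
        funext i; simp [toComplex, hs]
      rw [this, bil_smul_right, hzr, mul_zero]
    have hss := hz s hsn hzs
    have hact := congrFun (hγ.act_eq (Pi.single j 1)) i
    have hrs : L.reflection r (Pi.single j 1) = L.reflection s (Pi.single j 1) := by
      have hrr := hγ.anisotropic
      funext i
      simp only [reflection, hs, bil_smul_left, bil_smul_right, Pi.sub_apply, Pi.smul_apply,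
        smul_eq_mul]
      field_simp
    rw [hrs] at hact
    have e1 : act ℝ γ (Pi.single j 1) i = (γ.1 i j : ℝ) := by
      simp [act]
    rw [e1] at hact
    have hb : |L.bil ℝ (Pi.single j 1) s| ≤ C := by
      refine hC (Pi.single j 1, s) ⟨?_, Metric.sphere_subset_closedBall hsn⟩
      rw [mem_closedBall_zero_iff, pi_norm_le_iff_of_nonneg zero_le_one]
      intro k
      rcases eq_or_ne k j with rfl | hkj
      · simp
      · simp [Pi.single_eq_of_ne hkj]
    have hsi : |s i| ≤ 1 := by
      have := norm_le_pi_norm s i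
      rwa [mem_sphere_zero_iff_norm.1 hsn] at this
    have h1 : |(Pi.single j 1 : Fin (n + 2) → ℝ) i| ≤ 1 := by
      rcases eq_or_ne i j with rfl | hij
      · simp
      · simp [Pi.single_eq_of_ne hij]
    have hbound : |(γ.1 i j : ℝ)| ≤ M := by
      rw [hact]
      simp only [reflection, Pi.sub_apply, Pi.smul_apply, smul_eq_mul]
      refine (abs_sub _ _).trans (add_le_add h1 ?_)
      rw [abs_mul, abs_div, abs_mul, abs_two, abs_of_pos (lt_trans (by positivity) hss)]
      have hC0 : 0 ≤ C := (abs_nonneg _).trans hb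
      calc 2 * |L.bil ℝ (Pi.single j 1) s| / L.bil ℝ s s * |s i|
          ≤ 2 * C / (m / 2) * 1 := by gcongr
        _ = 2 * C / (m / 2) := mul_one _
    have h2 : (|γ.1 i j| : ℝ) ≤ (⌈M⌉ : ℤ) := hbound.trans (Int.le_ceil M)
    rw [mem_Icc, ← abs_le]
    exact_mod_cast h2

/-! ### Divisibility by the equation of a mirror -/

namespace IsDomainCone

variable {L} {A : Set (Fin (n + 2) → ℂ)} (hA : L.IsDomainCone A)

include hA

open Set Filter Topology in
theorem eventually_coneProj_mem {z : Fin (n + 2) → ℂ} (hz : z ∈ A) :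
    ∀ᶠ x in 𝓝 z, L.bil ℂ x (star z) ≠ 0 ∧ L.coneProj (star z) x ∈ A := by
  have hz' := hA.subset_negCone hz
  obtain ⟨d, hd, hN⟩ := L.bil_star_self_eq_neg hz'
  have hst : L.bil ℂ (star z) (star z) = 0 := by rw [bil_star, hz'.1, star_zero]
  refine (hA.isOpen_coneProj_preimage hst).mem_nhds ⟨by rw [hN]; simpa using hd.ne', ?_⟩
  rwa [L.coneProj_of_isotropic hz'.1]

open Set Filter Topology in
theorem mem_closure_compl_mirror {r : Fin (n + 2) → ℝ} (hr : 0 < L.bil ℝ r r)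
    {z : Fin (n + 2) → ℂ} (hz : z ∈ A) :
    z ∈ closure {w ∈ A | L.bil ℂ w (toComplex r) ≠ 0} := by
  by_cases h0 : L.bil ℂ z (toComplex r) = 0
  · have hstr : L.bil ℂ (star z) (toComplex r) = 0 := by rw [bil_star_toComplex, h0, star_zero]
    have hz' := hA.subset_negCone hz
    have hc : ContinuousAt (fun t : ℂ => z + t • toComplex r) 0 := by fun_prop
    have hev := hA.eventually_coneProj_mem hz
    have hcc : ContinuousAt (fun t : ℂ => L.coneProj (star z) (z + t • toComplex r)) 0 := by
      refine ContinuousAt.comp (f := fun t : ℂ => z + t • toComplex r)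
        (g := L.coneProj (star z)) ?_ hc
      simpa using (L.differentiableAt_coneProj (hev.self_of_nhds).1).continuousAt
    have ht : Tendsto (fun t : ℂ => L.coneProj (star z) (z + t • toComplex r)) (𝓝[≠] 0) (𝓝 z) := by
      have := hcc.tendsto
      rw [zero_smul, add_zero, L.coneProj_of_isotropic hz'.1] at this
      exact this.mono_left nhdsWithin_le_nhds
    refine mem_closure_of_tendsto ht ?_
    have hc' : Tendsto (fun t : ℂ => z + t • toComplex r) (𝓝 0) (𝓝 z) := by
      simpa using hc.tendsto
    filter_upwards [nhdsWithin_le_nhds (hc'.eventually hev), self_mem_nhdsWithin] with t ht ht0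
    refine ⟨ht.2, ?_⟩
    rw [L.bil_coneProj_of_orthogonal hstr, bil_add_left, h0, zero_add, bil_smul_left,
      bil_toComplex]
    exact mul_ne_zero ht0 (by exact_mod_cast hr.ne')
  · exact subset_closure ⟨hz, h0⟩

open Set Filter Topology in
/-- A holomorphic function that vanishes on a mirror is divisible by its equation. -/
theorem exists_factor {r : Fin (n + 2) → ℝ} (hr : 0 < L.bil ℝ r r)
    {f : (Fin (n + 2) → ℂ) → ℂ} (hf : DifferentiableOn ℂ f A) (hfr : L.VanishesOn A f r) :
    ∃ h : (Fin (n + 2) → ℂ) → ℂ, DifferentiableOn ℂ h A ∧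
      ∀ z ∈ A, f z = L.bil ℂ z (toComplex r) * h z := by
  have key := exists_differentiableOn_extension
    (A := A) (N := {w ∈ A | L.bil ℂ w (toComplex r) ≠ 0})
    (φ := fun z => f z * (L.bil ℂ z (toComplex r))⁻¹) (fun z hz => hz.1)
    (fun z hz => hA.mem_closure_compl_mirror hr hz) ?_
  · obtain ⟨h, hh, hφ⟩ := key
    refine ⟨h, hh, fun z hz => ?_⟩
    by_cases h0 : L.bil ℂ z (toComplex r) = 0
    · rw [h0, zero_mul, hfr z hz h0]
    · rw [hφ z ⟨hz, h0⟩]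
      field_simp
  · intro z₀ hz₀
    by_cases h0 : L.bil ℂ z₀ (toComplex r) = 0
    · have hstr : L.bil ℂ (star z₀) (toComplex r) = 0 := by
        rw [bil_star_toComplex, h0, star_zero]
      have hz' := hA.subset_negCone hz₀
      have hst : L.bil ℂ (star z₀) (star z₀) = 0 := by rw [bil_star, hz'.1, star_zero]
      have hne : L.bilFunctional (toComplex r) ≠ 0 := by
        intro h
        have := DFunLike.congr_fun h (toComplex r)
        rw [bilFunctional_apply, bil_toComplex, _root_.zero_apply] at this
        exact hr.ne' (by exact_mod_cast this)
      obtain ⟨H, V, hV, hH, hHf⟩ := exists_local_quotient_linear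
        (hA.isOpen_coneProj_preimage hst) (hA.eventually_coneProj_mem hz₀).self_of_nhds
        (f := fun x => f (L.coneProj (star z₀) x))
        (hf.comp (fun x hx => (L.differentiableAt_coneProj hx.1).differentiableWithinAt)
          fun x hx => hx.2) (L.bilFunctional (toComplex r)) hne h0
        (fun x hx hx0 => hfr _ hx.2 (by rwa [L.bil_coneProj_of_orthogonal hstr]))
      refine ⟨H, V, hV, hH.mono inter_subset_right, ?_⟩
      rintro w ⟨⟨hwA, hw0⟩, hwV⟩
      have := hHf w hwV
      simp only [bilFunctional_apply, L.coneProj_of_isotropic (hA.bil_self hwA)] at this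
      rw [← this, mul_inv_cancel_right₀ hw0]
    · refine ⟨fun z => f z * (L.bil ℂ z (toComplex r))⁻¹, {z | L.bil ℂ z (toComplex r) ≠ 0},
        (L.bilFunctional (toComplex r)).continuous.continuousAt.eventually_ne h0, ?_,
        fun w _ => rfl⟩
      refine (hf.mono inter_subset_left).mul (DifferentiableOn.fun_inv ?_ fun z hz => hz.2)
      exact (L.bilFunctional (toComplex r)).differentiable.differentiableOn

end IsDomainCone

/-- The function `K` does not vanish identically on any non-empty open part of the mirror of `r`. -/
def GenericallyNonzeroOn (A : Set (Fin (n + 2) → ℂ)) (K : (Fin (n + 2) → ℂ) → ℂ)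
    (r : Fin (n + 2) → ℝ) : Prop :=
  ∀ z ∈ A, L.bil ℂ z (toComplex r) = 0 →
    ∃ᶠ w in nhds z, w ∈ A ∧ L.bil ℂ w (toComplex r) = 0 ∧ K w ≠ 0

open Set Filter Topology in
theorem GenericallyNonzeroOn.mul {L : EvenLattice n} {A : Set (Fin (n + 2) → ℂ)}
    {K₁ K₂ : (Fin (n + 2) → ℂ) → ℂ} {r : Fin (n + 2) → ℝ} (h₁ : L.GenericallyNonzeroOn A K₁ r)
    (h₂ : L.GenericallyNonzeroOn A K₂ r) (hc : ContinuousOn K₁ A) :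
    L.GenericallyNonzeroOn A (fun z => K₁ z * K₂ z) r := by
  intro z hz hzr
  rw [frequently_nhds_iff]
  intro U hzU hU
  obtain ⟨w, hwU, hwA, hwr, hw⟩ := frequently_nhds_iff.1 (h₁ z hz hzr) U hzU hU
  have he : ∀ᶠ x in 𝓝 w, x ∈ A → K₁ x ≠ 0 :=
    eventually_nhdsWithin_iff.1 ((hc w hwA).eventually_ne hw)
  obtain ⟨x, ⟨hxA, hxr, hx⟩, hx1, hxU⟩ :=
    ((h₂ w hwA hwr).and_eventually (he.and (hU.mem_nhds hwU))).exists
  exact ⟨x, hxU, hxA, hxr, mul_ne_zero (hx1 hxA) hx⟩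

namespace IsDomainCone

variable {L} {A : Set (Fin (n + 2) → ℂ)} (hA : L.IsDomainCone A)

include hA

open Set Filter Topology in
theorem genericallyNonzeroOn {r : Fin (n + 2) → ℝ} {K : (Fin (n + 2) → ℂ) → ℂ}
    (hK : DifferentiableOn ℂ K A) (hKr : ¬ L.VanishesOn A K r) :
    L.GenericallyNonzeroOn A K r := by
  intro z hz hzr
  by_contra hcon
  refine hKr fun w hw hwr => hA.eq_zero_of_eventually_eq_zero hK hz hzr ?_ hw hwr
  filter_upwards [not_frequently.1 hcon] with x hx hxA hxr
  by_contra h0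
  exact hx ⟨hxA, hxr, h0⟩

open Set Filter Topology in
/-- A form with simple zeros has order `0` or `1` along the mirror of a reflection in `Γ`, and its
multiplier at the reflection is `1` or `-1` accordingly. -/
theorem order_zero_or_one {Γ : Subgroup (GL (Fin (n + 2)) ℤ)} (hΓ : Γ ≤ L.OPlus A)
    {γ : GL (Fin (n + 2)) ℤ} {r : Fin (n + 2) → ℝ} (hγ : L.IsReflectionIn Γ γ r)
    (hr : 0 < L.bil ℝ r r) {F : (Fin (n + 2) → ℂ) → ℂ} (hF : DifferentiableOn ℂ F A) {ε : ℂ}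
    (hε : ∀ z ∈ A, F (act ℂ γ z) = ε * F z) (hsimple : L.HasSimpleZeros A F) :
    (ε = 1 ∧ L.GenericallyNonzeroOn A F r) ∨
      (ε = -1 ∧ L.VanishesOn A F r ∧ ∃ K : (Fin (n + 2) → ℂ) → ℂ, DifferentiableOn ℂ K A ∧
        (∀ z ∈ A, F z = L.bil ℂ z (toComplex r) * K z) ∧ L.GenericallyNonzeroOn A K r) := by
  by_cases hv : L.VanishesOn A F r
  · right
    obtain ⟨K, hK, hFK⟩ := hA.exists_factor hr hF hv
    have hKv : ¬ L.VanishesOn A K r := by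
      intro hKv
      obtain ⟨K', hK', hKK'⟩ := hA.exists_factor hr hK hKv
      exact hsimple r hr ⟨K', hK', fun z hz => by rw [hFK z hz, hKK' z hz]; ring⟩
    refine ⟨?_, hv, K, hK, hFK, hA.genericallyNonzeroOn hK hKv⟩
    have heq : EqOn (fun z => K (act ℂ γ z)) (fun z => -ε * K z) A := by
      have h1 : EqOn (fun z => K (act ℂ γ z)) (fun z => -ε * K z)
          {w ∈ A | L.bil ℂ w (toComplex r) ≠ 0} := by
        rintro z ⟨hz, hz0⟩
        have h2 := hε z hz
        rw [hFK z hz, hFK _ (L.act_mem (hΓ hγ.mem) hz), hγ.bil_act_complex] at h2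
        apply mul_left_cancel₀ hz0
        linear_combination -h2
      refine h1.of_subset_closure ?_ (hK.continuousOn.const_mul _ : ContinuousOn _ A)
        (fun z hz => hz.1) fun z hz => hA.mem_closure_compl_mirror hr hz
      exact hK.continuousOn.comp (continuous_act γ).continuousOn
        fun z hz => L.act_mem (hΓ hγ.mem) hz
    simp only [VanishesOn] at hKv
    push Not at hKv
    obtain ⟨w, hw, hwr, hw0⟩ := hKv
    have h3 := heq hw
    simp only [hγ.act_eq_self_iff.2 hwr] at h3
    apply mul_right_cancel₀ hw0
    linear_combination h3
  · left
    refine ⟨?_, hA.genericallyNonzeroOn hF hv⟩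
    simp only [VanishesOn] at hv
    push Not at hv
    obtain ⟨w, hw, hwr, hw0⟩ := hv
    have h3 := hε w hw
    rw [hγ.act_eq_self_iff.2 hwr] at h3
    apply mul_right_cancel₀ hw0
    linear_combination -h3

end IsDomainCone

end EvenLattice

namespace EvenLattice

variable {n : ℕ} {L : EvenLattice n}

/-! ### Division by a function with simple zeros along mirrors -/

open Set Filter Topology in
/-- Near `z₀` the zeros of `f` lie on finitely many mirrors, all of which contain `z₀`. -/
theorem exists_finset_mirrors {A : Set (Fin (n + 2) → ℂ)} (hA : L.IsDomainCone A)
    {Γ : Subgroup (GL (Fin (n + 2)) ℤ)} {f : (Fin (n + 2) → ℂ) → ℂ}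
    (hzeros : ∀ z ∈ A, f z = 0 → ∃ γ r, L.IsReflectionIn Γ γ r ∧ L.bil ℂ z (toComplex r) = 0)
    {z₀ : Fin (n + 2) → ℂ} (hz₀ : z₀ ∈ A) :
    ∃ (S : Set (GL (Fin (n + 2)) ℤ)) (ρ : GL (Fin (n + 2)) ℤ → (Fin (n + 2) → ℝ)), S.Finite ∧
      (∀ γ ∈ S, L.IsReflectionIn Γ γ (ρ γ) ∧ L.bil ℂ z₀ (toComplex (ρ γ)) = 0) ∧
      ∀ᶠ z in 𝓝 z₀, z ∈ A → f z = 0 → ∃ γ ∈ S, L.bil ℂ z (toComplex (ρ γ)) = 0 := by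
  classical
  obtain ⟨Φ, hΦ, hev⟩ := L.exists_finite_reflections (hA.subset_negCone hz₀) Γ
  set S : Set (GL (Fin (n + 2)) ℤ) :=
    {γ ∈ Φ | ∃ r, L.IsReflectionIn Γ γ r ∧ L.bil ℂ z₀ (toComplex r) = 0} with hS
  have hch : ∀ γ, ∃ r, γ ∈ S → L.IsReflectionIn Γ γ r ∧ L.bil ℂ z₀ (toComplex r) = 0 := by
    intro γ
    by_cases h : γ ∈ S
    · obtain ⟨r, hr⟩ := h.2
      exact ⟨r, fun _ => hr⟩
    · exact ⟨0, fun h' => absurd h' h⟩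
  choose ρ hρ using hch
  refine ⟨S, ρ, hΦ.subset fun γ hγ => hγ.1, hρ, ?_⟩
  have hmove : ∀ᶠ z in 𝓝 z₀, ∀ γ ∈ Φ, act ℂ γ z₀ ≠ z₀ → act ℂ γ z ≠ z := by
    rw [Filter.eventually_all_finite hΦ]
    intro γ _
    by_cases h : act ℂ γ z₀ = z₀
    · exact Eventually.of_forall fun z h' => absurd h h'
    · have hc : ContinuousAt (fun z => act ℂ γ z - z) z₀ :=
        ((continuous_act γ).sub continuous_id).continuousAt
      filter_upwards [hc.eventually_ne (sub_ne_zero.2 h)] with z hz _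
      exact sub_ne_zero.1 hz
  filter_upwards [hev, hmove] with z hz hzm hzA hfz
  obtain ⟨γ, r, hγ, hzr⟩ := hzeros z hzA hfz
  have hγΦ := hz γ r hγ hzr
  have hfix : act ℂ γ z = z := hγ.act_eq_self_iff.2 hzr
  have hz₀γ : act ℂ γ z₀ = z₀ := by
    by_contra h
    exact hzm γ hγΦ h hfix
  have hγS : γ ∈ S := ⟨hγΦ, r, hγ, hγ.act_eq_self_iff.1 hz₀γ⟩
  exact ⟨γ, hγS, (hρ γ hγS).1.act_eq_self_iff.1 hfix⟩

open Set Filter Topology in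
/-- In the chart at `z₀`, the generic points of the mirror of `r` are dense among the translates in a
transversal direction `v`: arbitrarily close to `x` there are points whose projection to the mirror
along `v` is not a zero of `K`. -/
theorem exists_generic_translate {A : Set (Fin (n + 2) → ℂ)} (hA : L.IsDomainCone A)
    {w₀ : Fin (n + 2) → ℂ} (hw₀ : L.bil ℂ w₀ w₀ = 0) {r : Fin (n + 2) → ℝ}
    (hwr : L.bil ℂ w₀ (toComplex r) = 0) {K : (Fin (n + 2) → ℂ) → ℂ}
    (hKr : L.GenericallyNonzeroOn A K r) {v : Fin (n + 2) → ℂ}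
    (hv : L.bil ℂ v (toComplex r) ≠ 0) {x : Fin (n + 2) → ℂ} {U : Set (Fin (n + 2) → ℂ)}
    (hU : IsOpen U) (hxU : x ∈ U)
    (hx : L.bil ℂ (x - (L.bil ℂ x (toComplex r) / L.bil ℂ v (toComplex r)) • v) w₀ ≠ 0 ∧
      L.coneProj w₀ (x - (L.bil ℂ x (toComplex r) / L.bil ℂ v (toComplex r)) • v) ∈ A) :
    ∃ y ∈ U, K (L.coneProj w₀
      (y - (L.bil ℂ y (toComplex r) / L.bil ℂ v (toComplex r)) • v)) ≠ 0 := by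
  set p := x - (L.bil ℂ x (toComplex r) / L.bil ℂ v (toComplex r)) • v with hp
  have hpr : L.bil ℂ p (toComplex r) = 0 := by
    rw [hp, bil_sub_left, bil_smul_left, div_mul_cancel₀ _ hv, sub_self]
  set q := L.coneProj w₀ p with hq
  have hqr : L.bil ℂ q (toComplex r) = 0 := by
    rw [hq, L.bil_coneProj_of_orthogonal hwr, hpr]
  have hqw : L.bil ℂ q w₀ ≠ 0 := by
    rw [hq, L.bil_coneProj_of_orthogonal hw₀]
    exact hx.1
  have hc : Tendsto (fun w => x + (w - q)) (𝓝 q) (𝓝 x) := by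
    have : ContinuousAt (fun w => x + (w - q)) q := by fun_prop
    simpa using this.tendsto
  have hqw' : ∀ᶠ w in 𝓝 q, L.bil ℂ w w₀ ≠ 0 :=
    (L.bilFunctional w₀).continuous.continuousAt.eventually_ne hqw
  obtain ⟨w, ⟨hwA, hwr', hKw⟩, hwU, hww⟩ :=
    ((hKr q hx.2 hqr).and_eventually ((hc.eventually (hU.mem_nhds hxU)).and hqw')).exists
  refine ⟨x + (w - q), hwU, ?_⟩
  -- the projection of the translate is `w` up to a multiple of `w₀`
  have e1 : L.bil ℂ (x + (w - q)) (toComplex r) = L.bil ℂ x (toComplex r) := by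
    rw [bil_add_left, bil_sub_left, hwr', hqr, sub_zero, add_zero]
  have e2 : x + (w - q) - (L.bil ℂ x (toComplex r) / L.bil ℂ v (toComplex r)) • v =
      w + (L.quad ℂ p / L.bil ℂ p w₀) • w₀ := by
    have : q = p - (L.quad ℂ p / L.bil ℂ p w₀) • w₀ := rfl
    rw [this, hp]
    abel
  have e3 : L.coneProj w₀ (w + (L.quad ℂ p / L.bil ℂ p w₀) • w₀) = w := by
    have hbw : L.bil ℂ w w = 0 := hA.bil_self hwA
    simp only [coneProj, quad, bil_add_left, bil_add_right, bil_smul_left, bil_smul_right, hw₀, hbw,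
      L.bil_comm w₀ w, mul_zero, add_zero, zero_add]
    have : ∀ s : ℂ, (s * L.bil ℂ w w₀ + s * L.bil ℂ w w₀) / 2 / L.bil ℂ w w₀ = s := by
      intro s; field_simp; ring
    rw [this]
    abel
  rw [e1, e2, e3]
  exact hKw

open Set Filter Topology Metric in
/-- If the zeros of `f` lie on mirrors, along each of which `f` has order at most one and `B` vanishes
whenever `f` does, then `B / f` is holomorphic, and the complement of the zero set of `f` is dense.

Near `z₀` the quotient is given by Cauchy's formula along discs in a direction transversal to the
finitely many mirrors through `z₀`; these are hyperplanes in the chart given by the projection along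
the conjugate of `z₀`.  A generic disc meets each mirror in a point at which `f` has a simple zero. -/
theorem exists_quotient_of_simple_zeros {A : Set (Fin (n + 2) → ℂ)} (hA : L.IsDomainCone A)
    {Γ : Subgroup (GL (Fin (n + 2)) ℤ)} {f B : (Fin (n + 2) → ℂ) → ℂ}
    (hf : DifferentiableOn ℂ f A) (hB : DifferentiableOn ℂ B A)
    (hzeros : ∀ z ∈ A, f z = 0 → ∃ γ r, L.IsReflectionIn Γ γ r ∧ L.bil ℂ z (toComplex r) = 0)
    (horder : ∀ γ r, L.IsReflectionIn Γ γ r → 0 < L.bil ℝ r r → L.GenericallyNonzeroOn A f r ∨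
      ∃ K b : (Fin (n + 2) → ℂ) → ℂ, DifferentiableOn ℂ K A ∧ DifferentiableOn ℂ b A ∧
        (∀ z ∈ A, f z = L.bil ℂ z (toComplex r) * K z) ∧
        (∀ z ∈ A, B z = L.bil ℂ z (toComplex r) * b z) ∧ L.GenericallyNonzeroOn A K r) :
    A ⊆ closure {z ∈ A | f z ≠ 0} ∧ ∃ H : (Fin (n + 2) → ℂ) → ℂ, DifferentiableOn ℂ H A ∧
      ∀ z ∈ A, H z * f z = B z := by
  have hmain : ∀ z₀ ∈ A, z₀ ∈ closure {z ∈ A | f z ≠ 0} ∧ ∃ h : (Fin (n + 2) → ℂ) → ℂ,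
      ∃ V ∈ 𝓝 z₀, DifferentiableOn ℂ h (A ∩ V) ∧ ∀ z ∈ A ∩ V, h z * f z = B z := by
    intro z₀ hz₀
    obtain ⟨S, ρ, hSfin, hS, hSev⟩ := exists_finset_mirrors hA hzeros hz₀
    have hz₀' := hA.subset_negCone hz₀
    set w₀ := star z₀ with hw₀def
    have hw₀ : L.bil ℂ w₀ w₀ = 0 := by rw [hw₀def, bil_star, hz₀'.1, star_zero]
    have hwr : ∀ γ ∈ S, L.bil ℂ w₀ (toComplex (ρ γ)) = 0 := fun γ hγ => by
      rw [hw₀def, bil_star_toComplex, (hS γ hγ).2, star_zero]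
    have hpz : L.coneProj w₀ z₀ = z₀ := L.coneProj_of_isotropic hz₀'.1
    have hpos : ∀ γ ∈ S, 0 < L.bil ℝ (ρ γ) (ρ γ) := fun γ hγ => (hS γ hγ).1.pos hz₀' (hS γ hγ).2
    -- the chart
    set D₀ : Set (Fin (n + 2) → ℂ) := {x | L.bil ℂ x w₀ ≠ 0 ∧ L.coneProj w₀ x ∈ A} with hD₀
    have hD₀o : IsOpen D₀ := hA.isOpen_coneProj_preimage hw₀
    have hz₀D₀ : z₀ ∈ D₀ := (hA.eventually_coneProj_mem hz₀).self_of_nhds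
    have hpd : ∀ x ∈ D₀, DifferentiableAt ℂ (L.coneProj w₀) x :=
      fun x hx => L.differentiableAt_coneProj hx.1
    have hpc : ContinuousAt (L.coneProj w₀) z₀ := (hpd z₀ hz₀D₀).continuousAt
    have hev : ∀ᶠ x in 𝓝 z₀, x ∈ D₀ ∧
        (f (L.coneProj w₀ x) = 0 → ∃ γ ∈ S, L.bil ℂ x (toComplex (ρ γ)) = 0) := by
      rw [← hpz] at hSev
      filter_upwards [hD₀o.mem_nhds hz₀D₀, hpc.eventually hSev] with x hx hx'
      refine ⟨hx, fun h0 => ?_⟩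
      obtain ⟨γ, hγ, h⟩ := hx' hx.2 h0
      exact ⟨γ, hγ, by rwa [L.bil_coneProj_of_orthogonal (hwr γ hγ)] at h⟩
    obtain ⟨D, hD, hDo, hz₀D⟩ := _root_.eventually_nhds_iff.1 hev
    have hfD : ∀ {g : (Fin (n + 2) → ℂ) → ℂ}, DifferentiableOn ℂ g A →
        DifferentiableOn ℂ (fun x => g (L.coneProj w₀ x)) D := fun hg =>
      hg.comp (fun x hx => (hpd x (hD x hx).1).differentiableWithinAt) fun x hx => (hD x hx).1.2
    -- a direction transversal to all mirrors through `z₀`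
    obtain ⟨v, hv⟩ : ∃ v, ∀ γ ∈ S, L.bil ℂ v (toComplex (ρ γ)) ≠ 0 := by
      have := hSfin.to_subtype
      obtain ⟨v, hv⟩ := Module.Dual.exists_forall_ne_zero_of_forall_exists
        (fun γ : S => (L.bilFunctional (toComplex (ρ γ))).toLinearMap) fun γ =>
          ⟨toComplex (ρ γ), by
            change L.bil ℂ _ _ ≠ 0
            rw [bil_toComplex]
            exact_mod_cast (hpos γ γ.2).ne'⟩
      exact ⟨v, fun γ hγ => hv ⟨γ, hγ⟩⟩
    obtain ⟨δ₂, hδ₂, hin⟩ := hDo.exists_pos_forall_add_smul_mem hz₀D v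
    obtain ⟨δ, hδ, rfl⟩ : ∃ δ : ℝ, 0 < δ ∧ δ₂ = 2 * δ := ⟨δ₂ / 2, by positivity, by ring⟩
    have hsub : closedBall (0 : ℂ) δ ⊆ ball (0 : ℂ) (2 * δ) :=
      closedBall_subset_ball (by linarith)
    -- on the disc through `z₀`, only the centre is a zero
    have hline : ∀ ζ ∈ ball (0 : ℂ) (2 * δ), ζ ≠ 0 → f (L.coneProj w₀ (z₀ + ζ • v)) ≠ 0 := by
      intro ζ hζ hζ0 h0
      obtain ⟨γ, hγ, h⟩ := (hD _ (hin.self_of_nhds ζ hζ)).2 h0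
      rw [bil_add_left, (hS γ hγ).2, zero_add, bil_smul_left] at h
      exact mul_ne_zero hζ0 (hv γ hγ) h
    refine ⟨?_, ?_⟩
    · have hc : ContinuousAt (fun ζ : ℂ => L.coneProj w₀ (z₀ + ζ • v)) 0 := by
        refine ContinuousAt.comp (f := fun ζ : ℂ => z₀ + ζ • v) (g := L.coneProj w₀) ?_
          (by fun_prop)
        simpa using hpc
      have ht : Tendsto (fun ζ : ℂ => L.coneProj w₀ (z₀ + ζ • v)) (𝓝[≠] 0) (𝓝 z₀) := by
        have := hc.tendsto
        rw [zero_smul, add_zero, hpz] at this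
        exact this.mono_left nhdsWithin_le_nhds
      refine mem_closure_of_tendsto ht ?_
      filter_upwards [nhdsWithin_le_nhds (ball_mem_nhds (0 : ℂ) hδ₂), self_mem_nhdsWithin]
        with ζ hζ hζ0
      exact ⟨(hD _ (hin.self_of_nhds ζ hζ)).1.2, hline ζ hζ hζ0⟩
    -- along each mirror, the factor of `f` that does not vanish generically
    have hfac : ∀ γ, ∃ K : (Fin (n + 2) → ℂ) → ℂ, γ ∈ S → DifferentiableOn ℂ K A ∧
        L.GenericallyNonzeroOn A K (ρ γ) ∧ ((∀ z, K z = f z) ∨ ∃ b : (Fin (n + 2) → ℂ) → ℂ,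
          DifferentiableOn ℂ b A ∧ (∀ z ∈ A, f z = L.bil ℂ z (toComplex (ρ γ)) * K z) ∧
          ∀ z ∈ A, B z = L.bil ℂ z (toComplex (ρ γ)) * b z) := by
      intro γ
      by_cases hγ : γ ∈ S
      · rcases horder γ (ρ γ) (hS γ hγ).1 (hpos γ hγ) with h | ⟨K, b, hK, hb, hfK, hBb, hgen⟩
        · exact ⟨f, fun _ => ⟨hf, h, Or.inl fun _ => rfl⟩⟩
        · exact ⟨K, fun _ => ⟨hK, hgen, Or.inr ⟨b, hb, hfK, hBb⟩⟩⟩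
      · exact ⟨0, fun h => absurd h hγ⟩
    choose K hK using hfac
    set p : GL (Fin (n + 2)) ℤ → (Fin (n + 2) → ℂ) → (Fin (n + 2) → ℂ) := fun γ x =>
      x - (L.bil ℂ x (toComplex (ρ γ)) / L.bil ℂ v (toComplex (ρ γ))) • v with hp
    have hpcont : ∀ γ, Continuous (p γ) := by
      intro γ
      have := (L.bilFunctional (toComplex (ρ γ))).continuous
      exact continuous_id.sub ((this.div_const _).smul continuous_const)
    have hpz₀ : ∀ γ ∈ S, p γ z₀ = z₀ := by
      intro γ hγ
      simp only [hp, (hS γ hγ).2, zero_div, zero_smul, sub_zero]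
    set T : Set (Fin (n + 2) → ℂ) := {x | ∀ γ ∈ S, K γ (L.coneProj w₀ (p γ x)) ≠ 0} with hT
    have hΩev : ∀ᶠ x in 𝓝 z₀, ∀ γ ∈ S, p γ x ∈ D₀ := by
      rw [Filter.eventually_all_finite hSfin]
      intro γ hγ
      refine (hpcont γ).continuousAt.eventually (hD₀o.mem_nhds ?_)
      rwa [hpz₀ γ hγ]
    obtain ⟨Ω, hΩ, hΩo, hz₀Ω⟩ := _root_.eventually_nhds_iff.1 hΩev
    have hTdense : ∀ S' : Set (GL (Fin (n + 2)) ℤ), S'.Finite → S' ⊆ S →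
        ∀ U : Set (Fin (n + 2) → ℂ), IsOpen U → U.Nonempty → U ⊆ Ω →
          ∃ U' ⊆ U, IsOpen U' ∧ U'.Nonempty ∧
            ∀ x ∈ U', ∀ γ ∈ S', K γ (L.coneProj w₀ (p γ x)) ≠ 0 := by
      intro S' hS'
      induction S', hS' using Set.Finite.induction_on with
      | empty => exact fun _ U hU hne _ => ⟨U, Subset.rfl, hU, hne, by simp⟩
      | @insert γ S' _ _ ih =>
        intro hS'S U hU hne hUΩ
        have hγ : γ ∈ S := hS'S (mem_insert _ _)
        obtain ⟨U₁, hU₁U, hU₁o, ⟨x, hx⟩, hU₁⟩ :=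
          ih ((subset_insert _ _).trans hS'S) U hU hne hUΩ
        obtain ⟨y, hyU₁, hy⟩ := exists_generic_translate hA hw₀ (hwr γ hγ) (hK γ hγ).2.1 (hv γ hγ)
          hU₁o hx (hΩ x (hUΩ (hU₁U hx)) γ hγ)
        refine ⟨U₁ ∩ {x | K γ (L.coneProj w₀ (p γ x)) ≠ 0}, inter_subset_left.trans hU₁U, ?_,
          ⟨y, hyU₁, hy⟩, ?_⟩
        · have hc : ContinuousOn (fun x => K γ (L.coneProj w₀ (p γ x))) U₁ := by
            refine (hK γ hγ).1.continuousOn.comp ?_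
              fun x hx => (hΩ x (hUΩ (hU₁U hx)) γ hγ).2
            intro x hx
            refine ContinuousAt.continuousWithinAt (ContinuousAt.comp
              (f := p γ) (g := L.coneProj w₀) ?_ (hpcont γ).continuousAt)
            exact (hpd _ (hΩ x (hUΩ (hU₁U hx)) γ hγ)).continuousAt
          exact hc.isOpen_inter_preimage hU₁o isOpen_ne
        · rintro x ⟨hx, hx'⟩ γ' (rfl | hγ')
          exacts [hx', hU₁ x hx γ' hγ']
    have hTcl : ∀ᶠ x in 𝓝 z₀, x ∈ closure T := by
      filter_upwards [hΩo.mem_nhds hz₀Ω] with x hx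
      rw [_root_.mem_closure_iff]
      intro U hU hxU
      obtain ⟨U', hU'U, -, ⟨y, hy⟩, hU'⟩ := hTdense S hSfin Subset.rfl (U ∩ Ω) (hU.inter hΩo)
        ⟨x, hxU, hx⟩ inter_subset_right
      exact ⟨y, (hU'U hy).1, hU' y hy⟩
    obtain ⟨H, V, hV, hH, hHf⟩ := exists_local_quotient hDo hz₀D (hfD hf) (hfD hB) hδ (v := v)
      (fun ζ hζ => by
        have hζ' := hsub (sphere_subset_closedBall hζ)
        refine ⟨hin.self_of_nhds ζ hζ', hline ζ hζ' ?_⟩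
        rintro rfl
        simp [hδ.ne] at hζ) hTcl (by
      filter_upwards [hin] with x hx hxT
      have hdl : DifferentiableOn ℂ (fun ζ : ℂ => x + ζ • v) (ball 0 (2 * δ)) := by fun_prop
      have hfl : ∀ {g : (Fin (n + 2) → ℂ) → ℂ}, DifferentiableOn ℂ g A → DifferentiableOn ℂ
          (fun ζ : ℂ => g (L.coneProj w₀ (x + ζ • v))) (ball 0 (2 * δ)) :=
        fun hg => (hfD hg).comp hdl hx
      -- the zeros on the disc are among the finitely many points on mirrors
      have hroot : ∀ ζ ∈ ball (0 : ℂ) (2 * δ), f (L.coneProj w₀ (x + ζ • v)) = 0 →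
          ∃ γ ∈ S, ζ = -(L.bil ℂ x (toComplex (ρ γ)) / L.bil ℂ v (toComplex (ρ γ))) := by
        intro ζ hζ h0
        obtain ⟨γ, hγ, h⟩ := (hD _ (hx ζ hζ)).2 h0
        refine ⟨γ, hγ, ?_⟩
        rw [bil_add_left, bil_smul_left] at h
        have := hv γ hγ
        field_simp
        linear_combination h
      set N : Set ℂ := {ζ ∈ ball (0 : ℂ) (2 * δ) | f (L.coneProj w₀ (x + ζ • v)) ≠ 0} with hN
      have hNd : ball (0 : ℂ) (2 * δ) ⊆ closure N := by
        have hfin : ((fun γ => -(L.bil ℂ x (toComplex (ρ γ)) / L.bil ℂ v (toComplex (ρ γ)))) ''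
          S).Finite := hSfin.image _
        refine ((hfin.countable.dense_compl ℝ).open_subset_closure_inter isOpen_ball).trans
          (closure_mono ?_)
        rintro ζ ⟨hζ, hζ'⟩
        refine ⟨hζ, fun h0 => hζ' ?_⟩
        obtain ⟨γ, hγ, h⟩ := hroot ζ hζ h0
        exact ⟨γ, hγ, h.symm⟩
      obtain ⟨φ, hφ, hφN⟩ := exists_differentiableOn_extension (A := ball (0 : ℂ) (2 * δ)) (N := N)
        (φ := fun ζ => B (L.coneProj w₀ (x + ζ • v)) * (f (L.coneProj w₀ (x + ζ • v)))⁻¹)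
        (fun ζ hζ => hζ.1) hNd (by
        intro ζ₀ hζ₀
        have hlocal : ∀ {b K : (Fin (n + 2) → ℂ) → ℂ}, DifferentiableOn ℂ b A →
            DifferentiableOn ℂ K A → K (L.coneProj w₀ (x + ζ₀ • v)) ≠ 0 →
            ∃ V ∈ 𝓝 ζ₀, DifferentiableOn ℂ (fun ζ : ℂ => b (L.coneProj w₀ (x + ζ • v)) *
              (K (L.coneProj w₀ (x + ζ • v)))⁻¹) (ball 0 (2 * δ) ∩ V) ∧
              ∀ ζ ∈ V, K (L.coneProj w₀ (x + ζ • v)) ≠ 0 := by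
          intro b K hb hK hK0
          have hc := ((hfl hK).continuousOn.continuousAt (isOpen_ball.mem_nhds hζ₀))
          refine ⟨{ζ | K (L.coneProj w₀ (x + ζ • v)) ≠ 0}, hc.eventually_ne hK0, ?_,
            fun ζ hζ => hζ⟩
          exact ((hfl hb).mono inter_subset_left).mul
            (((hfl hK).mono inter_subset_left).fun_inv fun ζ hζ => hζ.2)
        by_cases h0 : f (L.coneProj w₀ (x + ζ₀ • v)) = 0
        · obtain ⟨γ, hγ, hζγ⟩ := hroot ζ₀ hζ₀ h0
          have hpx : x + ζ₀ • v = p γ x := by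
            rw [hζγ, hp, neg_smul, ← sub_eq_add_neg]
          have hKx := hxT γ hγ
          rw [← hpx] at hKx
          obtain ⟨hKd, -, hKf | ⟨b, hb, hfK, hBb⟩⟩ := hK γ hγ
          · exact absurd h0 (by rwa [← hKf])
          · obtain ⟨V, hV, hd, hV0⟩ := hlocal hb hKd hKx
            refine ⟨_, V, hV, hd, ?_⟩
            rintro ζ ⟨⟨hζ, hζ0⟩, hζV⟩
            have hmem := (hD _ (hx ζ hζ)).1.2
            rw [hfK _ hmem] at hζ0
            have h1 := left_ne_zero_of_mul hζ0
            have h2 := right_ne_zero_of_mul hζ0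
            rw [hfK _ hmem, hBb _ hmem]
            field_simp
        · obtain ⟨V, hV, hd, -⟩ := hlocal hB hf h0
          exact ⟨_, V, hV, hd, fun _ _ => rfl⟩)
      refine ⟨φ, DifferentiableOn.diffContOnCl ?_, ?_⟩
      · rw [closure_ball _ hδ.ne']
        exact hφ.mono hsub
      · have heq : EqOn (fun ζ => φ ζ * f (L.coneProj w₀ (x + ζ • v)))
            (fun ζ => B (L.coneProj w₀ (x + ζ • v))) N := by
          rintro ζ hζ
          simp only
          rw [hφN ζ hζ, inv_mul_cancel_right₀ hζ.2]
        have := heq.of_subset_closure (hφ.continuousOn.mul (hfl hf).continuousOn)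
          (hfl hB).continuousOn (fun ζ hζ => hζ.1) hNd
        exact fun ζ hζ => this (hsub hζ))
    refine ⟨H, V, hV, hH.mono inter_subset_right, ?_⟩
    rintro z ⟨hz, hzV⟩
    have := hHf z hzV
    rwa [L.coneProj_of_isotropic (hA.bil_self hz)] at this
  refine ⟨fun z hz => (hmain z hz).1, ?_⟩
  obtain ⟨H, hH, hHN⟩ := exists_differentiableOn_extension (A := A) (N := {z ∈ A | f z ≠ 0})
    (φ := fun z => B z * (f z)⁻¹) (fun z hz => hz.1) (fun z hz => (hmain z hz).1) (by
      intro z₀ hz₀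
      obtain ⟨h, V, hV, hh, hhf⟩ := (hmain z₀ hz₀).2
      refine ⟨h, V, hV, hh, ?_⟩
      rintro z ⟨⟨hz, hz0⟩, hzV⟩
      rw [← hhf z ⟨hz, hzV⟩, mul_inv_cancel_right₀ hz0])
  refine ⟨H, hH, ?_⟩
  have heq : EqOn (fun z => H z * f z) B {z ∈ A | f z ≠ 0} := by
    rintro z hz
    simp only
    rw [hHN z hz, inv_mul_cancel_right₀ hz.2]
  exact heq.of_subset_closure (hH.continuousOn.mul hf.continuousOn) hB.continuousOn
    (fun z hz => hz.1) fun z hz => (hmain z hz).1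

end EvenLattice

namespace EvenLattice

variable {n : ℕ} (L : EvenLattice n)

/-! ### The Laplace operator of the quadratic form -/

theorem IsDomainCone.det_gram_ne_zero {L : EvenLattice n} {A : Set (Fin (n + 2) → ℂ)}
    (hA : L.IsDomainCone A) : L.gram.det ≠ 0 := by
  intro h0
  obtain ⟨z, hz⟩ := hA.nonempty
  have h1 : (L.gram.map (Int.cast : ℤ → ℝ)).det = 0 := by
    have := (Int.castRingHom ℝ).map_det L.gram
    rw [h0, map_zero] at this
    exact this.symm
  obtain ⟨v, hv, hv0⟩ := Matrix.exists_mulVec_eq_zero_iff.2 h1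
  have hb : ∀ x, L.bil ℝ x v = 0 := fun x => by rw [bil, hv0, dotProduct_zero]
  have hzv : L.bil ℂ z (toComplex v) = 0 := by
    rw [bil_toComplex_right, hb, hb]; simp
  exact (L.bil_self_pos_of_orthogonal (hA.subset_negCone hz) hzv hv).ne' (hb v)

variable {L} in
theorem eq_zero_of_forall_bil_eq_zero {K : Type*} [Field K] [CharZero K] (hL : L.gram.det ≠ 0)
    {x : Fin (n + 2) → K} (hx : ∀ y, L.bil K y x = 0) : x = 0 := by
  have hdet : (L.gram.map (Int.cast : ℤ → K)).det ≠ 0 := by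
    have := (Int.castRingHom K).map_det L.gram
    change _ = (L.gram.map (Int.cast : ℤ → K)).det at this
    rw [← this]
    simpa using hL
  have h0 : L.gram.map (Int.cast : ℤ → K) *ᵥ x = 0 := by
    funext i
    have := hx (Pi.single i 1)
    rwa [bil, single_one_dotProduct] at this
  exact Matrix.eq_zero_of_mulVec_eq_zero hdet h0

/-- The complex Gram matrix. -/
abbrev gramC : Matrix (Fin (n + 2)) (Fin (n + 2)) ℂ := L.gram.map (Int.cast : ℤ → ℂ)

theorem gramC_isSymm : L.gramCᵀ = L.gramC := by
  rw [gramC, ← Matrix.transpose_map, L.symm.eq]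

variable {L} in
theorem isUnit_det_gramC (hL : L.gram.det ≠ 0) : IsUnit L.gramC.det := by
  have := (Int.castRingHom ℂ).map_det L.gram
  change _ = L.gramC.det at this
  rw [← this, isUnit_iff_ne_zero]
  simpa using hL

/-- The trace of a bilinear form on `L_ℂ` with respect to the form of the lattice. -/
noncomputable def formTrace (B : (Fin (n + 2) → ℂ) → (Fin (n + 2) → ℂ) → ℂ) : ℂ :=
  (L.gramC⁻¹ * Matrix.of fun i j => B (Pi.single i 1) (Pi.single j 1)).trace

theorem formTrace_add (B C : (Fin (n + 2) → ℂ) → (Fin (n + 2) → ℂ) → ℂ) :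
    L.formTrace (fun v w => B v w + C v w) = L.formTrace B + L.formTrace C := by
  rw [formTrace, formTrace, formTrace, ← Matrix.trace_add, ← Matrix.mul_add]
  rfl

theorem formTrace_const_mul (a : ℂ) (B : (Fin (n + 2) → ℂ) → (Fin (n + 2) → ℂ) → ℂ) :
    L.formTrace (fun v w => a * B v w) = a * L.formTrace B := by
  rw [formTrace, formTrace, ← smul_eq_mul a (Matrix.trace _), ← Matrix.trace_smul, ← Matrix.mul_smul]
  rfl

theorem bil_single_left (i : Fin (n + 2)) (x : Fin (n + 2) → ℂ) :
    L.bil ℂ (Pi.single i 1) x = (L.gramC *ᵥ x) i := by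
  rw [bil, single_one_dotProduct]

variable {L} in
theorem formTrace_bil (hL : L.gram.det ≠ 0) : L.formTrace (fun v w => L.bil ℂ v w) = n + 2 := by
  have : (Matrix.of fun i j => L.bil ℂ (Pi.single i 1) (Pi.single j 1)) = L.gramC := by
    ext i j
    simp [bil_single_left]
  rw [formTrace, this, Matrix.nonsing_inv_mul _ (isUnit_det_gramC hL), Matrix.trace_one]
  simp

variable {L} in
theorem formTrace_mul_bil_right (hL : L.gram.det ≠ 0) (φ : (Fin (n + 2) → ℂ) →ₗ[ℂ] ℂ)
    (x : Fin (n + 2) → ℂ) : L.formTrace (fun v w => φ v * L.bil ℂ w x) = φ x := by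
  have : (Matrix.of fun i j => φ (Pi.single i 1) * L.bil ℂ (Pi.single j 1) x) =
      Matrix.vecMulVec (fun i => φ (Pi.single i 1)) (L.gramC *ᵥ x) := by
    ext i j
    simp [bil_single_left, Matrix.vecMulVec_apply]
  rw [formTrace, this, Matrix.mul_vecMulVec, Matrix.trace_vecMulVec, dotProduct_comm,
    ← Matrix.vecMul_transpose, gramC_isSymm, ← Matrix.dotProduct_mulVec, Matrix.mulVec_mulVec,
    Matrix.mul_nonsing_inv _ (isUnit_det_gramC hL), Matrix.one_mulVec, dotProduct,
    LinearMap.pi_apply_eq_sum_univ φ x]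
  refine Finset.sum_congr rfl fun i _ => ?_
  rw [smul_eq_mul]
  congr 2
  funext j
  simp [Pi.single_apply, eq_comm]

variable {L} in
theorem formTrace_bil_mul_left (hL : L.gram.det ≠ 0) (φ : (Fin (n + 2) → ℂ) →ₗ[ℂ] ℂ)
    (x : Fin (n + 2) → ℂ) : L.formTrace (fun v w => L.bil ℂ v x * φ w) = φ x := by
  rw [← formTrace_mul_bil_right hL φ x, formTrace, formTrace, ← Matrix.trace_transpose,
    Matrix.transpose_mul, Matrix.transpose_nonsing_inv, gramC_isSymm, Matrix.trace_mul_comm]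
  congr 2
  ext i j
  simp [mul_comm]

theorem formTrace_act {A : Set (Fin (n + 2) → ℂ)} {L : EvenLattice n} (hL : L.gram.det ≠ 0)
    {g : GL (Fin (n + 2)) ℤ} (hg : g ∈ L.OPlus A)
    (B : (Fin (n + 2) → ℂ) →ₗ[ℂ] (Fin (n + 2) → ℂ) →ₗ[ℂ] ℂ) :
    L.formTrace (fun v w => B (act ℂ g v) (act ℂ g w)) = L.formTrace (fun v w => B v w) := by
  set M := Matrix.of fun i j => B (Pi.single i 1) (Pi.single j 1) with hM
  set γ := g.1.map (Int.cast : ℤ → ℂ) with hγ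
  have hBM : ∀ v w, B v w = v ⬝ᵥ (M *ᵥ w) := by
    intro v w
    conv_lhs => rw [← Finset.univ_sum_single v, ← Finset.univ_sum_single w]
    simp only [map_sum, LinearMap.sum_apply]
    rw [dotProduct]
    rw [Finset.sum_comm]
    refine Finset.sum_congr rfl fun i _ => ?_
    rw [Matrix.mulVec, dotProduct, Finset.mul_sum]
    refine Finset.sum_congr rfl fun j _ => ?_
    rw [← mul_one (v i), ← mul_one (w j), ← smul_eq_mul (v i), ← smul_eq_mul (w j), Pi.single_smul,
      Pi.single_smul, map_smul, map_smul, LinearMap.smul_apply, hM]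
    simp only [Matrix.of_apply, smul_eq_mul]
    ring
  have h1 : (Matrix.of fun i j => B (act ℂ g (Pi.single i 1)) (act ℂ g (Pi.single j 1))) =
      γᵀ * M * γ := by
    ext i j
    rw [Matrix.of_apply, hBM, act, act, Matrix.mulVec_mulVec, Matrix.mulVec_single_one,
      Matrix.mulVec_single_one, Matrix.mul_assoc, Matrix.mul_apply]
    rfl
  have h2 : γᵀ * L.gramC * γ = L.gramC := by
    have h := congrArg (fun M : Matrix _ _ ℤ => M.map (Int.castRingHom ℂ))
      (L.transpose_mul_gram_mul hg)
    simp only [Matrix.map_mul] at h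
    rwa [Matrix.transpose_map] at h
  have hS := isUnit_det_gramC hL
  -- the inverse Gram matrix is invariant as well
  have h3 : γ * L.gramC⁻¹ * γᵀ = L.gramC⁻¹ := by
    have e1 : (L.gramC⁻¹ * γᵀ * L.gramC) * γ = 1 := by
      rw [Matrix.mul_assoc, Matrix.mul_assoc, ← Matrix.mul_assoc γᵀ, h2,
        Matrix.nonsing_inv_mul _ hS]
    have e2 := mul_eq_one_comm.1 e1
    calc γ * L.gramC⁻¹ * γᵀ = γ * (L.gramC⁻¹ * γᵀ * L.gramC) * L.gramC⁻¹ := by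
          simp only [Matrix.mul_assoc]
          rw [Matrix.mul_nonsing_inv _ hS, Matrix.mul_one]
      _ = L.gramC⁻¹ := by rw [e2, Matrix.one_mul]
  rw [formTrace, formTrace, h1, ← Matrix.mul_assoc, ← Matrix.mul_assoc, Matrix.trace_mul_comm,
    ← Matrix.mul_assoc, ← Matrix.mul_assoc, h3]

/-- The Laplace operator of the complex quadratic space `L_ℂ`. -/
noncomputable def lap (f : (Fin (n + 2) → ℂ) → ℂ) (x : Fin (n + 2) → ℂ) : ℂ :=
  L.formTrace fun v w => fderiv ℂ (fderiv ℂ f) x v w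

open Filter Topology in
theorem lap_congr {f g : (Fin (n + 2) → ℂ) → ℂ} {x : Fin (n + 2) → ℂ} (h : f =ᶠ[𝓝 x] g) :
    L.lap f x = L.lap g x := by
  rw [lap, lap, h.fderiv.fderiv_eq]

theorem differentiableOn_lap {U : Set (Fin (n + 2) → ℂ)} (hU : IsOpen U)
    {f : (Fin (n + 2) → ℂ) → ℂ} (hf : DifferentiableOn ℂ f U) :
    DifferentiableOn ℂ (L.lap f) U := by
  have h1 : ∀ w, DifferentiableOn ℂ (fun x => fderiv ℂ f x w) U :=
    fun w => hf.fderiv_apply_complex hU w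
  have h2 : ∀ v w, DifferentiableOn ℂ (fun x => fderiv ℂ (fderiv ℂ f) x v w) U := by
    intro v w
    refine ((h1 w).fderiv_apply_complex hU v).congr fun x hx => ?_
    have hd := (hf.fderiv_complex hU).differentiableAt (hU.mem_nhds hx)
    rw [fderiv_clm_apply hd (differentiableAt_const w)]
    simp
  have : L.lap f = fun x => ∑ i, ∑ j, L.gramC⁻¹ i j *
      fderiv ℂ (fderiv ℂ f) x (Pi.single j 1) (Pi.single i 1) := by
    funext x
    simp [lap, formTrace, Matrix.trace, Matrix.mul_apply]
  rw [this]
  exact DifferentiableOn.fun_sum fun i _ => DifferentiableOn.fun_sum fun j _ =>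
    (h2 _ _).const_mul _

theorem lap_const_mul {U : Set (Fin (n + 2) → ℂ)} (hU : IsOpen U)
    {f : (Fin (n + 2) → ℂ) → ℂ} (hf : DifferentiableOn ℂ f U) (a : ℂ) {x : Fin (n + 2) → ℂ}
    (hx : x ∈ U) : L.lap (fun y => a * f y) x = a * L.lap f x := by
  have h1 : fderiv ℂ (fun y => a * f y) =ᶠ[nhds x] fun y => a • fderiv ℂ f y := by
    filter_upwards [hU.mem_nhds hx] with y hy
    exact fderiv_const_mul (hf.differentiableAt (hU.mem_nhds hy)) a
  have h2 : fderiv ℂ (fun y => a • fderiv ℂ f y) x = a • fderiv ℂ (fderiv ℂ f) x :=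
    fderiv_fun_const_smul ((hf.fderiv_complex hU).differentiableAt (hU.mem_nhds hx)) a
  rw [lap, lap, ← formTrace_const_mul, h1.fderiv_eq, h2]
  rfl

theorem fderiv_fderiv_comp_clm {U : Set (Fin (n + 2) → ℂ)} (hU : IsOpen U)
    {f : (Fin (n + 2) → ℂ) → ℂ} (hf : DifferentiableOn ℂ f U)
    (g : (Fin (n + 2) → ℂ) →L[ℂ] (Fin (n + 2) → ℂ)) {x : Fin (n + 2) → ℂ} (hx : g x ∈ U)
    (v w : Fin (n + 2) → ℂ) :
    fderiv ℂ (fderiv ℂ fun y => f (g y)) x v w = fderiv ℂ (fderiv ℂ f) (g x) (g v) (g w) := by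
  have hgU : ∀ᶠ y in nhds x, g y ∈ U := g.continuous.continuousAt.eventually (hU.mem_nhds hx)
  have h1 : (fderiv ℂ fun y => f (g y)) =ᶠ[nhds x] fun y => (fderiv ℂ f (g y)).comp g := by
    filter_upwards [hgU] with y hy
    rw [fderiv_fun_comp (g := f) (f := g) y (hf.differentiableAt (hU.mem_nhds hy))
      g.differentiableAt, g.fderiv]
  have hd : HasFDerivAt (fun y => fderiv ℂ f (g y)) ((fderiv ℂ (fderiv ℂ f) (g x)).comp g) x :=
    ((hf.fderiv_complex hU).differentiableAt (hU.mem_nhds hx)).hasFDerivAt.comp x g.hasFDerivAt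
  have h2 := hd.clm_comp (hasFDerivAt_const g x)
  rw [h1.fderiv_eq, h2.fderiv]
  simp

end EvenLattice

namespace EvenLattice

variable {n : ℕ} (L : EvenLattice n)

/-! ### The change of the projection to the quadric -/

/-- The derivative of the coefficient `Q(x) / ⟨x, w⟩` in the projection along `w`. -/
noncomputable def projCoeff (w x v : Fin (n + 2) → ℂ) : ℂ :=
  L.bil ℂ x v * (L.bil ℂ x w)⁻¹ - L.bil ℂ x x * 2⁻¹ * (L.bil ℂ w v * ((L.bil ℂ x w)⁻¹) ^ 2)

theorem hasFDerivAt_bil_left (u x : Fin (n + 2) → ℂ) :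
    HasFDerivAt (fun y => L.bil ℂ y u) (L.bilFunctional u) x :=
  (L.bilFunctional u).hasFDerivAt

theorem hasFDerivAt_bil_self (x : Fin (n + 2) → ℂ) :
    HasFDerivAt (fun y => L.bil ℂ y y) ((2 : ℂ) • L.bilFunctional x) x := by
  have h : HasFDerivAt (fun y => (L.bil ℂ y y : ℂ)) (fderiv ℂ (fun y => L.bil ℂ y y) x) x := by
    refine DifferentiableAt.hasFDerivAt ?_
    exact DifferentiableAt.comp (f := fun y => (y, y)) x (L.differentiable_bil _)
      (differentiableAt_id.prodMk differentiableAt_id)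
  convert h using 1
  ext v
  -- the derivative along the line through `x` in the direction of a basis vector
  have key : ∀ v, fderiv ℂ (fun y => L.bil ℂ y y) x v = 2 * L.bil ℂ v x := by
    intro v
    have h1 : HasDerivAt (fun t : ℂ => x + t • v) v 0 := by
      simpa using ((hasDerivAt_id (0 : ℂ)).smul_const v).const_add x
    have h2 : HasDerivAt (fun t : ℂ => L.bil ℂ (x + t • v) (x + t • v))
        (fderiv ℂ (fun y => L.bil ℂ y y) x v) 0 := by
      have h' := h
      rw [show x = x + (0 : ℂ) • v by simp] at h'
      have := h'.comp_hasDerivAt (0 : ℂ) h1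
      simpa [Function.comp_def] using this
    have h3 : HasDerivAt (fun t : ℂ => L.bil ℂ x x + t * (2 * L.bil ℂ v x) + t ^ 2 * L.bil ℂ v v)
        (2 * L.bil ℂ v x) 0 := by
      have := (((hasDerivAt_id (0 : ℂ)).mul_const (2 * L.bil ℂ v x)).const_add
        (L.bil ℂ x x)).fun_add ((hasDerivAt_pow 2 (0 : ℂ)).mul_const (L.bil ℂ v v))
      simpa using this
    have h4 : (fun t : ℂ => L.bil ℂ (x + t • v) (x + t • v)) =
        fun t => L.bil ℂ x x + t * (2 * L.bil ℂ v x) + t ^ 2 * L.bil ℂ v v := by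
      funext t
      simp only [bil_add_left, bil_add_right, bil_smul_left, bil_smul_right, L.bil_comm x v]
      ring
    rw [h4] at h2
    exact h2.unique h3
  simp [key]

theorem hasFDerivAt_inv_bil_left {w x : Fin (n + 2) → ℂ} (hx : L.bil ℂ x w ≠ 0) :
    HasFDerivAt (fun y => (L.bil ℂ y w)⁻¹) (-((L.bil ℂ x w)⁻¹ ^ 2) • L.bilFunctional w) x := by
  have := (hasDerivAt_inv hx).comp_hasFDerivAt x (L.hasFDerivAt_bil_left w x)
  simpa [Function.comp_def, inv_pow] using this

theorem fderiv_coneProj {w x : Fin (n + 2) → ℂ} (hx : L.bil ℂ x w ≠ 0) (v : Fin (n + 2) → ℂ) :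
    fderiv ℂ (L.coneProj w) x v = v - L.projCoeff w x v • w := by
  have h1 := ((((L.hasFDerivAt_bil_self x).mul_const (2⁻¹ : ℂ)).mul
    (L.hasFDerivAt_inv_bil_left hx)).smul_const w)
  have h2 := (hasFDerivAt_id (𝕜 := ℂ) x).sub h1
  have h3 := h2.congr_of_eventuallyEq (f₁ := L.coneProj w)
    (Filter.EventuallyEq.of_eq (funext fun y => by
      simp only [coneProj, quad, div_eq_mul_inv]
      rfl))
  rw [h3.fderiv]
  simp only [projCoeff, L.bil_comm x v, L.bil_comm w v]
  simp
  congr 1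
  ring

theorem fderiv_projCoeff {w z : Fin (n + 2) → ℂ} (hz : L.bil ℂ z z = 0) (hzw : L.bil ℂ z w ≠ 0)
    (u v : Fin (n + 2) → ℂ) :
    ∃ D : (Fin (n + 2) → ℂ) →L[ℂ] ℂ, HasFDerivAt (fun x => L.projCoeff w x u) D z ∧
      D v = L.bil ℂ v u * (L.bil ℂ z w)⁻¹ -
        (L.bil ℂ z u * L.bil ℂ v w + L.bil ℂ v z * L.bil ℂ w u) * ((L.bil ℂ z w)⁻¹) ^ 2 := by
  have h1 := (L.hasFDerivAt_bil_left u z).mul (L.hasFDerivAt_inv_bil_left hzw)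
  have h2 := ((L.hasFDerivAt_bil_self z).mul_const (2⁻¹ : ℂ)).mul
    (((L.hasFDerivAt_inv_bil_left hzw).pow 2).const_mul (L.bil ℂ w u))
  refine ⟨_, h1.sub h2, ?_⟩
  simp [hz]
  ring

open Filter Topology in
/-- The Hessian of `f ∘ π`, where `π` is the projection to the quadric, at a point of the quadric. -/
theorem fderiv_fderiv_comp_coneProj {U : Set (Fin (n + 2) → ℂ)} (hU : IsOpen U)
    {f : (Fin (n + 2) → ℂ) → ℂ} (hf : DifferentiableOn ℂ f U) {w z : Fin (n + 2) → ℂ} (hzU : z ∈ U)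
    (hz : L.bil ℂ z z = 0) (hzw : L.bil ℂ z w ≠ 0) (v u : Fin (n + 2) → ℂ) :
    fderiv ℂ (fderiv ℂ fun x => f (L.coneProj w x)) z v u =
      fderiv ℂ (fderiv ℂ f) z (v - (L.bil ℂ z v * (L.bil ℂ z w)⁻¹) • w)
        (u - (L.bil ℂ z u * (L.bil ℂ z w)⁻¹) • w) -
      fderiv ℂ f z w * (L.bil ℂ v u * (L.bil ℂ z w)⁻¹ -
        (L.bil ℂ z u * L.bil ℂ v w + L.bil ℂ v z * L.bil ℂ w u) * ((L.bil ℂ z w)⁻¹) ^ 2) := by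
  have hpz : L.coneProj w z = z := L.coneProj_of_isotropic hz
  have hpd := L.differentiableAt_coneProj hzw
  have hev : ∀ᶠ x in 𝓝 z, L.bil ℂ x w ≠ 0 ∧ L.coneProj w x ∈ U := by
    refine ((L.bilFunctional w).continuous.continuousAt.eventually_ne hzw).and
      (hpd.continuousAt.eventually (hU.mem_nhds ?_))
    rwa [hpz]
  obtain ⟨V, hV, hVo, hzV⟩ := eventually_nhds_iff.1 hev
  have hfd : ∀ x ∈ V, DifferentiableAt ℂ f (L.coneProj w x) := fun x hx =>
    hf.differentiableAt (hU.mem_nhds (hV x hx).2)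
  have hgd : DifferentiableOn ℂ (fun x => f (L.coneProj w x)) V := fun x hx =>
    ((hfd x hx).comp x (L.differentiableAt_coneProj (hV x hx).1)).differentiableWithinAt
  have h1 : ∀ x ∈ V, fderiv ℂ (fun x => f (L.coneProj w x)) x u =
      fderiv ℂ f (L.coneProj w x) u - L.projCoeff w x u * fderiv ℂ f (L.coneProj w x) w := by
    intro x hx
    rw [fderiv_fun_comp (g := f) (f := L.coneProj w) x (hfd x hx)
      (L.differentiableAt_coneProj (hV x hx).1), ContinuousLinearMap.comp_apply,
      L.fderiv_coneProj (hV x hx).1, map_sub, map_smul, smul_eq_mul]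
  have h2 : fderiv ℂ (fderiv ℂ fun x => f (L.coneProj w x)) z v u =
      fderiv ℂ (fun x => fderiv ℂ (fun x => f (L.coneProj w x)) x u) z v := by
    have hd := (hgd.fderiv_complex hVo).differentiableAt (hVo.mem_nhds hzV)
    rw [fderiv_clm_apply hd (differentiableAt_const u)]
    simp
  have h3 : (fun x => fderiv ℂ (fun x => f (L.coneProj w x)) x u) =ᶠ[𝓝 z] fun x =>
      fderiv ℂ f (L.coneProj w x) u - L.projCoeff w x u * fderiv ℂ f (L.coneProj w x) w := by
    filter_upwards [hVo.mem_nhds hzV] with x hx using h1 x hx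
  have hf' : HasFDerivAt (fun x => fderiv ℂ f (L.coneProj w x))
      ((fderiv ℂ (fderiv ℂ f) z).comp (fderiv ℂ (L.coneProj w) z)) z := by
    have h := ((hf.fderiv_complex hU).differentiableAt (hU.mem_nhds hzU)).hasFDerivAt
    rw [← hpz] at h
    have := h.comp z hpd.hasFDerivAt
    rwa [hpz] at this
  have hap : ∀ y, HasFDerivAt (fun x => fderiv ℂ f (L.coneProj w x) y)
      ((ContinuousLinearMap.apply ℂ ℂ y).comp
        ((fderiv ℂ (fderiv ℂ f) z).comp (fderiv ℂ (L.coneProj w) z))) z := fun y =>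
    (ContinuousLinearMap.apply ℂ ℂ y).hasFDerivAt.comp z hf'
  obtain ⟨D, hD, hDv⟩ := L.fderiv_projCoeff hz hzw u v
  have h4 := (hap u).sub (hD.mul (hap w))
  have hpc : ∀ y, L.projCoeff w z y = L.bil ℂ z y * (L.bil ℂ z w)⁻¹ := by
    intro y; simp [projCoeff, hz]
  have h5 : fderiv ℂ (fun x => fderiv ℂ f (L.coneProj w x) u -
      L.projCoeff w x u * fderiv ℂ f (L.coneProj w x) w) z = _ := h4.fderiv
  rw [h2, h3.fderiv_eq, h5]
  simp only [_root_.sub_apply, _root_.add_apply, _root_.smul_apply,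
    ContinuousLinearMap.comp_apply, ContinuousLinearMap.apply_apply, hpz, hDv,
    L.fderiv_coneProj hzw, hpc, map_sub, map_smul, smul_eq_mul]
  ring

variable {L} in
/-- The Laplacian of a homogeneous function, transported to the quadric by projections along two
different isotropic vectors, changes by a first order term, which is proportional to
`n / 2 - 1 - k`. -/
theorem lap_comp_coneProj (hL : L.gram.det ≠ 0) {U : Set (Fin (n + 2) → ℂ)} (hU : IsOpen U)
    {f : (Fin (n + 2) → ℂ) → ℂ} (hf : DifferentiableOn ℂ f U) {w z : Fin (n + 2) → ℂ} (hzU : z ∈ U)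
    (hz : L.bil ℂ z z = 0) (hzw : L.bil ℂ z w ≠ 0) {k : ℂ}
    (heuler : ∀ x ∈ U, fderiv ℂ f x x = -k * f x) :
    L.lap (fun x => f (L.coneProj w x)) z =
      L.lap f z - 2 * ((n : ℂ) / 2 - 1 - k) * (fderiv ℂ f z w * (L.bil ℂ z w)⁻¹) := by
  set f' := fderiv ℂ f z with hf'
  set f'' := fderiv ℂ (fderiv ℂ f) z with hf''
  set s := (L.bil ℂ z w)⁻¹ with hs
  have hfd : HasFDerivAt (fderiv ℂ f) f'' z :=
    ((hf.fderiv_complex hU).differentiableAt (hU.mem_nhds hzU)).hasFDerivAt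
  have hsymm : ∀ v u, f'' v u = f'' u v := by
    refine second_derivative_symmetric_of_eventually (f := f) ?_ hfd
    filter_upwards [hU.mem_nhds hzU] with x hx
    exact (hf.differentiableAt (hU.mem_nhds hx)).hasFDerivAt
  -- differentiating Euler's relation
  have hE : f'' w z = -(k + 1) * f' w := by
    have h1 : HasFDerivAt (fun x => fderiv ℂ f x x)
        (f'.comp (ContinuousLinearMap.id ℂ _) + f''.flip z) z := hfd.clm_apply (hasFDerivAt_id z)
    have h2 : HasFDerivAt (fun x => -k * f x) (-k • f') z :=
      (hf.differentiableAt (hU.mem_nhds hzU)).hasFDerivAt.const_mul (-k)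
    have h3 : (fun x => fderiv ℂ f x x) =ᶠ[nhds z] fun x => -k * f x := by
      filter_upwards [hU.mem_nhds hzU] with x hx using heuler x hx
    have h4 := DFunLike.congr_fun ((h1.congr_of_eventuallyEq h3.symm).unique h2) w
    simp only [_root_.add_apply, ContinuousLinearMap.comp_apply, ContinuousLinearMap.flip_apply,
      ContinuousLinearMap.coe_id', id_eq, _root_.smul_apply, smul_eq_mul] at h4
    linear_combination h4
  have hlap : L.lap (fun x => f (L.coneProj w x)) z = L.formTrace (fun v u =>
      f'' v u + ((-s * f''.flip w v) * L.bil ℂ u z + (L.bil ℂ v z * (-s * f'' w u) +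
        ((s ^ 2 * f'' w w * L.bil ℂ v z) * L.bil ℂ u z + ((-s * f' w) * L.bil ℂ v u +
        ((s ^ 2 * f' w * L.bil ℂ v w) * L.bil ℂ u z +
          (s ^ 2 * f' w * L.bil ℂ v z) * L.bil ℂ u w)))))) := by
    rw [lap]
    congr 1
    funext v u
    rw [L.fderiv_fderiv_comp_coneProj hU hf hzU hz hzw]
    simp only [map_sub, map_smul, _root_.sub_apply, _root_.smul_apply, smul_eq_mul,
      ContinuousLinearMap.flip_apply, L.bil_comm z v, L.bil_comm z u, L.bil_comm w u, ← hs, ← hf',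
      ← hf'']
    ring
  have t1 : L.formTrace (fun v u => (-s * f''.flip w v) * L.bil ℂ u z) = -s * f'' z w :=
    formTrace_mul_bil_right hL (-s • (f''.flip w).toLinearMap) z
  have t2 : L.formTrace (fun v u => L.bil ℂ v z * (-s * f'' w u)) = -s * f'' w z :=
    formTrace_bil_mul_left hL (-s • (f'' w).toLinearMap) z
  have t3 : L.formTrace (fun v u => (s ^ 2 * f'' w w * L.bil ℂ v z) * L.bil ℂ u z) =
      s ^ 2 * f'' w w * L.bil ℂ z z :=
    formTrace_mul_bil_right hL ((s ^ 2 * f'' w w) • (L.bilFunctional z).toLinearMap) z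
  have t4 : L.formTrace (fun v u => (-s * f' w) * L.bil ℂ v u) = (-s * f' w) * (n + 2) := by
    rw [formTrace_const_mul, formTrace_bil hL]
  have t5 : L.formTrace (fun v u => (s ^ 2 * f' w * L.bil ℂ v w) * L.bil ℂ u z) =
      s ^ 2 * f' w * L.bil ℂ z w :=
    formTrace_mul_bil_right hL ((s ^ 2 * f' w) • (L.bilFunctional w).toLinearMap) z
  have t6 : L.formTrace (fun v u => (s ^ 2 * f' w * L.bil ℂ v z) * L.bil ℂ u w) =
      s ^ 2 * f' w * L.bil ℂ w z :=
    formTrace_mul_bil_right hL ((s ^ 2 * f' w) • (L.bilFunctional z).toLinearMap) w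
  rw [hlap]
  simp only [formTrace_add]
  rw [t1, t2, t3, t4, t5, t6, hsymm z w, hE, hz, L.bil_comm w z]
  have hs1 : s * L.bil ℂ z w = 1 := inv_mul_cancel₀ hzw
  have hl : L.formTrace (fun v u => f'' v u) = L.lap f z := rfl
  rw [hl]
  linear_combination (2 * s * f' w) * hs1

end EvenLattice

namespace EvenLattice

variable {n : ℕ} {L : EvenLattice n}

/-! ### The bracket of two modular forms -/

theorem IsModularForm.mul {A : Set (Fin (n + 2) → ℂ)} {Γ : Subgroup (GL (Fin (n + 2)) ℤ)}
    {χF χG : Γ →* ℂˣ} {k l : ℤ} {F G : (Fin (n + 2) → ℂ) → ℂ} (hF : IsModularForm A Γ χF k F)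
    (hG : IsModularForm A Γ χG l G) : IsModularForm A Γ (χF * χG) (k + l) (F * G) where
  holomorphic := hF.holomorphic.mul hG.holomorphic
  equivariant γ z hz := by
    simp only [Pi.mul_apply, hF.equivariant γ z hz, hG.equivariant γ z hz, MonoidHom.mul_apply,
      Units.val_mul]
    ring
  homogeneous t ht z hz := by
    simp only [Pi.mul_apply, hF.homogeneous t ht z hz, hG.homogeneous t ht z hz]
    rw [neg_add, zpow_add₀ ht]
    ring

section Extension

variable {A : Set (Fin (n + 2) → ℂ)} (hA : L.IsDomainCone A) {Γ : Subgroup (GL (Fin (n + 2)) ℤ)}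
  {χ : Γ →* ℂˣ} {k : ℤ} {F : (Fin (n + 2) → ℂ) → ℂ} {c : Fin (n + 2) → ℂ}

variable (L A c) in
/-- The open neighbourhood of `A` in `L_ℂ` to which functions on `A` are extended by the projection
along `c`. -/
def extDomain : Set (Fin (n + 2) → ℂ) := {x | L.bil ℂ x c ≠ 0 ∧ L.coneProj c x ∈ A}

variable (L F c) in
/-- The extension of a function on `A` by the projection along `c`. -/
noncomputable def extend : (Fin (n + 2) → ℂ) → ℂ := fun x => F (L.coneProj c x)

include hA in
theorem isOpen_extDomain (hc : L.bil ℂ c c = 0) : IsOpen (L.extDomain A c) :=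
  hA.isOpen_coneProj_preimage hc

include hA in
theorem subset_extDomain (hcA : ∀ z ∈ A, L.bil ℂ z c ≠ 0) : A ⊆ L.extDomain A c := fun z hz =>
  ⟨hcA z hz, by rwa [L.coneProj_of_isotropic (hA.bil_self hz)]⟩

include hA in
theorem extend_of_mem {z : Fin (n + 2) → ℂ} (hz : z ∈ A) : L.extend F c z = F z := by
  rw [extend, L.coneProj_of_isotropic (hA.bil_self hz)]

theorem differentiableOn_extend (hF : DifferentiableOn ℂ F A) :
    DifferentiableOn ℂ (L.extend F c) (L.extDomain A c) :=
  hF.comp (fun _ hx => (L.differentiableAt_coneProj hx.1).differentiableWithinAt) fun _ hx => hx.2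

theorem coneProj_smul {t : ℂ} (ht : t ≠ 0) (x : Fin (n + 2) → ℂ) :
    L.coneProj c (t • x) = t • L.coneProj c x := by
  simp only [coneProj, quad, bil_smul_left, bil_smul_right, smul_sub, smul_smul]
  congr 2
  rw [mul_div_assoc, mul_div_mul_left _ _ ht, ← mul_div_assoc, ← mul_div_assoc]

include hA in
theorem smul_mem_extDomain {t : ℂ} (ht : t ≠ 0) {x : Fin (n + 2) → ℂ}
    (hx : x ∈ L.extDomain A c) : t • x ∈ L.extDomain A c := by
  refine ⟨by rw [bil_smul_left]; exact mul_ne_zero ht hx.1, ?_⟩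
  rw [coneProj_smul ht]
  exact hA.smul_mem ht hx.2

theorem IsModularForm.extend_smul (hF : IsModularForm A Γ χ k F) {t : ℂ} (ht : t ≠ 0)
    {x : Fin (n + 2) → ℂ} (hx : x ∈ L.extDomain A c) :
    L.extend F c (t • x) = t ^ (-k) * L.extend F c x := by
  rw [extend, extend, coneProj_smul ht]
  exact hF.homogeneous t ht _ hx.2

include hA in
/-- Euler's relation for the homogeneous extension. -/
theorem IsModularForm.fderiv_extend_self (hF : IsModularForm A Γ χ k F) (hc : L.bil ℂ c c = 0)
    {x : Fin (n + 2) → ℂ} (hx : x ∈ L.extDomain A c) :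
    fderiv ℂ (L.extend F c) x x = -k * L.extend F c x := by
  have hd : HasFDerivAt (L.extend F c) (fderiv ℂ (L.extend F c) x) x :=
    ((differentiableOn_extend hF.holomorphic).differentiableAt
      ((isOpen_extDomain hA hc).mem_nhds hx)).hasFDerivAt
  have h1 : HasDerivAt (fun t : ℂ => t • x) x 1 := by
    simpa using (hasDerivAt_id (1 : ℂ)).smul_const x
  have h2 : HasDerivAt (fun t : ℂ => L.extend F c (t • x)) (fderiv ℂ (L.extend F c) x x) 1 := by
    have hd' : HasFDerivAt (L.extend F c) (fderiv ℂ (L.extend F c) x) ((1 : ℂ) • x) := by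
      rwa [one_smul]
    have := HasFDerivAt.comp_hasDerivAt (l := L.extend F c) (f := fun t : ℂ => t • x) (1 : ℂ) hd' h1
    exact this
  have h3 : HasDerivAt (fun t : ℂ => t ^ (-k) * L.extend F c x) (-k * L.extend F c x) 1 := by
    have := (hasDerivAt_zpow (-k) (1 : ℂ) (Or.inl one_ne_zero)).mul_const (L.extend F c x)
    simpa using this
  refine h2.unique (h3.congr_of_eventuallyEq ?_)
  filter_upwards [isOpen_ne.mem_nhds (one_ne_zero : (1 : ℂ) ≠ 0)] with t ht
  exact hF.extend_smul ht hx

include hA in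
theorem IsModularForm.lap_extend_smul (hF : IsModularForm A Γ χ k F) (hc : L.bil ℂ c c = 0)
    {t : ℂ} (ht : t ≠ 0) {x : Fin (n + 2) → ℂ} (hx : x ∈ L.extDomain A c) :
    L.lap (L.extend F c) (t • x) = t ^ (-(k + 2)) * L.lap (L.extend F c) x := by
  have hU := isOpen_extDomain hA hc
  have hd := differentiableOn_extend (L := L) (c := c) hF.holomorphic
  have h1 : L.lap (fun y => L.extend F c (t • y)) x = t ^ 2 * L.lap (L.extend F c) (t • x) := by
    rw [lap, lap, ← formTrace_const_mul]
    congr 1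
    funext v w
    have := fderiv_fderiv_comp_clm hU hd (t • ContinuousLinearMap.id ℂ (Fin (n + 2) → ℂ)) (x := x)
      (by simpa using smul_mem_extDomain hA ht hx) v w
    simp only [_root_.smul_apply, ContinuousLinearMap.coe_id', id_eq, map_smul, smul_eq_mul] at this
    rw [this]
    ring
  have h2 : L.lap (fun y => L.extend F c (t • y)) x = t ^ (-k) * L.lap (L.extend F c) x := by
    rw [← L.lap_const_mul hU hd _ hx]
    refine L.lap_congr ?_
    filter_upwards [hU.mem_nhds hx] with y hy using hF.extend_smul ht hy
  rw [h2] at h1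
  rw [show -(k + 2) = -k - 2 by ring, zpow_sub₀ ht]
  have : (t ^ (2 : ℤ) : ℂ) = t ^ 2 := by norm_cast
  rw [this, div_mul_eq_mul_div, h1]
  field_simp

theorem coneProj_act {g : GL (Fin (n + 2)) ℤ} (hg : g ∈ L.OPlus A) (x : Fin (n + 2) → ℂ) :
    L.coneProj c (act ℂ g x) = act ℂ g (L.coneProj (act ℂ g⁻¹ c) x) := by
  have h1 : act ℂ g (act ℂ g⁻¹ c) = c := by rw [← act_mul, mul_inv_cancel, act_one]
  have h2 : L.bil ℂ x (act ℂ g⁻¹ c) = L.bil ℂ (act ℂ g x) c := by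
    rw [← L.bil_act hg x, h1]
  rw [coneProj, coneProj, sub_eq_add_neg, sub_eq_add_neg, act_add, ← neg_smul, ← neg_smul,
    act_smul, h1, h2, quad, quad, L.bil_act hg]

include hA in
/-- The Laplacian of the extension of a modular form transforms like a modular form of weight `k + 2`,
up to a first order term. -/
theorem IsModularForm.lap_extend_act (hF : IsModularForm A Γ χ k F) (hc : L.bil ℂ c c = 0)
    (hcA : ∀ z ∈ A, L.bil ℂ z c ≠ 0) (hΓ : Γ ≤ L.OPlus A) (γ : Γ) {z : Fin (n + 2) → ℂ}
    (hz : z ∈ A) :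
    L.lap (L.extend F c) (act ℂ γ.1 z) = (χ γ : ℂ) * (L.lap (L.extend F c) z -
      2 * ((n : ℂ) / 2 - 1 - k) * (fderiv ℂ (L.extend F c) z (act ℂ γ.1⁻¹ c) *
        (L.bil ℂ z (act ℂ γ.1⁻¹ c))⁻¹)) := by
  have hL := hA.det_gram_ne_zero
  have hγ := hΓ γ.2
  have hU := isOpen_extDomain hA hc
  have hd := differentiableOn_extend (L := L) (c := c) hF.holomorphic
  set w := act ℂ γ.1⁻¹ c with hw
  have h1 : act ℂ γ.1 w = c := by rw [hw, ← act_mul, mul_inv_cancel, act_one]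
  have hww : L.bil ℂ w w = 0 := by rw [← L.bil_act hγ, h1, hc]
  have hwA : ∀ z ∈ A, L.bil ℂ z w ≠ 0 := fun z hz => by
    rw [← L.bil_act hγ, h1]
    exact hcA _ (L.act_mem hγ hz)
  have hzU := subset_extDomain hA hcA hz
  have hzW := subset_extDomain hA hwA hz
  have hgzU := subset_extDomain hA hcA (L.act_mem hγ hz)
  set gl : (Fin (n + 2) → ℂ) →L[ℂ] (Fin (n + 2) → ℂ) :=
    LinearMap.toContinuousLinearMap (Matrix.mulVecLin (γ.1.1.map (Int.cast : ℤ → ℂ))) with hgl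
  have hga : ∀ x, gl x = act ℂ γ.1 x := fun x => rfl
  -- the Laplacian is invariant under automorphisms
  have e1 : L.lap (fun x => L.extend F c (act ℂ γ.1 x)) z =
      L.lap (L.extend F c) (act ℂ γ.1 z) := by
    have key := formTrace_act hL hγ (ContinuousLinearMap.coeLM ℂ ∘ₗ
      (fderiv ℂ (fderiv ℂ (L.extend F c)) (act ℂ γ.1 z)).toLinearMap)
    refine Eq.trans ?_ key
    rw [lap]
    congr 1
    funext v u
    exact fderiv_fderiv_comp_clm hU hd gl hgzU v u
  -- the automorphism changes the vector along which the extension is taken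
  have e2 : (fun x => L.extend F c (act ℂ γ.1 x)) =ᶠ[nhds z]
      fun x => (χ γ : ℂ) * L.extend F w x := by
    filter_upwards [(isOpen_extDomain hA hww).mem_nhds hzW] with x hx
    rw [extend, coneProj_act hγ, hF.equivariant γ _ hx.2]
    rfl
  have e3 : L.extend F w =ᶠ[nhds z] fun x => L.extend F c (L.coneProj w x) := by
    filter_upwards [(isOpen_extDomain hA hww).mem_nhds hzW] with x hx
    rw [extend, extend, L.coneProj_of_isotropic (L.bil_coneProj_self hww hx.1)]
  rw [← e1, L.lap_congr e2, L.lap_const_mul (isOpen_extDomain hA hww)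
    (differentiableOn_extend hF.holomorphic) _ hzW, L.lap_congr e3,
    lap_comp_coneProj hL hU hd hzU (hA.bil_self hz) (hwA z hz) (k := (k : ℂ))
      fun x hx => hF.fderiv_extend_self hA hc hx]

end Extension

variable (L) in
/-- The bracket of `F` and `G`: the combination of Laplacians of extensions of `FG`, `F` and `G` in
which the first order terms cancel that obstruct modularity. -/
noncomputable def bracket (c : Fin (n + 2) → ℂ) (k l : ℤ) (F G : (Fin (n + 2) → ℂ) → ℂ)
    (z : Fin (n + 2) → ℂ) : ℂ :=
  ((n : ℂ) / 2 - 1 - k) * ((n : ℂ) / 2 - 1 - l) * L.lap (L.extend (F * G) c) z -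
    ((n : ℂ) / 2 - 1 - l) * ((n : ℂ) / 2 - 1 - k - l) * (L.lap (L.extend F c) z * G z) -
    ((n : ℂ) / 2 - 1 - k) * ((n : ℂ) / 2 - 1 - k - l) * (F z * L.lap (L.extend G c) z)

/-- The bracket of modular forms of weights `k` and `l` is a modular form of weight `k + l + 2`. -/
theorem isModularForm_bracket {A : Set (Fin (n + 2) → ℂ)} (hA : L.IsDomainCone A)
    {Γ : Subgroup (GL (Fin (n + 2)) ℤ)} (hΓ : Γ ≤ L.OPlus A) {χF χG : Γ →* ℂˣ} {k l : ℤ}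
    {F G : (Fin (n + 2) → ℂ) → ℂ} (hF : IsModularForm A Γ χF k F) (hG : IsModularForm A Γ χG l G)
    {c : Fin (n + 2) → ℂ} (hc : L.bil ℂ c c = 0) (hcA : ∀ z ∈ A, L.bil ℂ z c ≠ 0) :
    IsModularForm A Γ (χF * χG) (k + l + 2) (L.bracket c k l F G) where
  holomorphic := by
    have hU := isOpen_extDomain hA hc
    have hlap : ∀ {f : (Fin (n + 2) → ℂ) → ℂ}, DifferentiableOn ℂ f A →
        DifferentiableOn ℂ (L.lap (L.extend f c)) A := fun hf =>
      (L.differentiableOn_lap hU (differentiableOn_extend hf)).mono (subset_extDomain hA hcA)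
    exact (((hlap (hF.mul hG).holomorphic).const_mul _).sub
      (((hlap hF.holomorphic).mul hG.holomorphic).const_mul _)).sub
      ((hF.holomorphic.mul (hlap hG.holomorphic)).const_mul _)
  equivariant γ z hz := by
    have hU := isOpen_extDomain hA hc
    have hzU := subset_extDomain hA hcA hz
    have hdF := (differentiableOn_extend (L := L) (c := c) hF.holomorphic).differentiableAt
      (hU.mem_nhds hzU)
    have hdG := (differentiableOn_extend (L := L) (c := c) hG.holomorphic).differentiableAt
      (hU.mem_nhds hzU)
    have hprod : fderiv ℂ (L.extend (F * G) c) z (act ℂ γ.1⁻¹ c) =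
        F z * fderiv ℂ (L.extend G c) z (act ℂ γ.1⁻¹ c) +
          G z * fderiv ℂ (L.extend F c) z (act ℂ γ.1⁻¹ c) := by
      have : L.extend (F * G) c = fun x => L.extend F c x * L.extend G c x := rfl
      rw [this, fderiv_fun_mul hdF hdG, extend_of_mem hA hz, extend_of_mem hA hz]
      simp
    simp only [bracket]
    rw [(hF.mul hG).lap_extend_act hA hc hcA hΓ γ hz, hF.lap_extend_act hA hc hcA hΓ γ hz,
      hG.lap_extend_act hA hc hcA hΓ γ hz, hF.equivariant γ z hz, hG.equivariant γ z hz, hprod,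
      MonoidHom.mul_apply, Units.val_mul]
    push_cast
    ring
  homogeneous t ht z hz := by
    have hzU := subset_extDomain hA hcA hz
    simp only [bracket]
    rw [(hF.mul hG).lap_extend_smul hA hc ht hzU, hF.lap_extend_smul hA hc ht hzU,
      hG.lap_extend_smul hA hc ht hzU, hF.homogeneous t ht z hz, hG.homogeneous t ht z hz]
    have e1 : t ^ (-(k + l + 2)) = t ^ (-(k + 2)) * t ^ (-l) := by
      rw [← zpow_add₀ ht]; congr 1; ring
    have e2 : t ^ (-(k + 2)) * t ^ (-l) = t ^ (-k) * t ^ (-(l + 2)) := by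
      rw [← zpow_add₀ ht, ← zpow_add₀ ht]; congr 1; ring
    rw [e1]
    linear_combination (((n : ℂ) / 2 - 1 - k) * ((n : ℂ) / 2 - 1 - k - l) *
      (F z * L.lap (L.extend G c) z)) * e2

/-- The bracket of two reflective forms with simple and disjoint zeros vanishes.  It is odd under the
reflections in the mirrors on which `FG` vanishes, so that its quotient by `FG` is a holomorphic
modular form of weight two with trivial character. -/
theorem bracket_eq_zero {A : Set (Fin (n + 2) → ℂ)} (hA : L.IsDomainCone A)
    {Γ : Subgroup (GL (Fin (n + 2)) ℤ)} (hΓ : Γ ≤ L.OPlus A) {χF χG : Γ →* ℂˣ} {k l : ℤ}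
    {F G : (Fin (n + 2) → ℂ) → ℂ} (hF : L.IsReflective A Γ χF k F)
    (hG : L.IsReflective A Γ χG l G) (hFs : L.HasSimpleZeros A F) (hGs : L.HasSimpleZeros A G)
    (hdisj : L.HaveDisjointZeros A F G)
    (hwt2 : ∀ H : (Fin (n + 2) → ℂ) → ℂ, IsModularForm A Γ 1 2 H → ∀ z ∈ A, H z = 0)
    {c : Fin (n + 2) → ℂ} (hc : L.bil ℂ c c = 0) (hcA : ∀ z ∈ A, L.bil ℂ z c ≠ 0) :
    ∀ z ∈ A, L.bracket c k l F G z = 0 := by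
  have hB := isModularForm_bracket hA hΓ hF.modular hG.modular hc hcA
  have hFG := hF.modular.mul hG.modular
  obtain ⟨hdense, H, hH, hHf⟩ := exists_quotient_of_simple_zeros hA (Γ := Γ) (f := F * G)
    hFG.holomorphic hB.holomorphic (by
      intro z hz h0
      have : ∃ r : Fin (n + 2) → ℝ, L.bil ℝ r r ≠ 0 ∧
          L.bil ℂ z (toComplex r) = 0 ∧ ∃ γ ∈ Γ, ∀ v, act ℝ γ v = L.reflection r v := by
        rcases mul_eq_zero.1 h0 with h0 | h0
        · exact hF.zeros z hz h0
        · exact hG.zeros z hz h0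
      obtain ⟨r, hr, hzr, γ, hγ, hγr⟩ := this
      exact ⟨γ, r, ⟨hγ, hr, hγr⟩, hzr⟩) (by
      intro γ r hγ hr
      have hdF := hA.order_zero_or_one hΓ hγ hr hF.modular.holomorphic
        (fun z hz => hF.modular.equivariant ⟨γ, hγ.mem⟩ z hz) hFs
      have hdG := hA.order_zero_or_one hΓ hγ hr hG.modular.holomorphic
        (fun z hz => hG.modular.equivariant ⟨γ, hγ.mem⟩ z hz) hGs
      have hodd : ((χF ⟨γ, hγ.mem⟩ : ℂ)) * (χG ⟨γ, hγ.mem⟩ : ℂ) = -1 →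
          L.VanishesOn A (L.bracket c k l F G) r := by
        intro hε z hz hzr
        have h1 := hB.equivariant ⟨γ, hγ.mem⟩ z hz
        rw [MonoidHom.mul_apply, Units.val_mul, hε, hγ.act_eq_self_iff.2 hzr] at h1
        linear_combination h1 / 2
      rcases hdF with ⟨hεF, hgF⟩ | ⟨hεF, hvF, K, hK, hFK, hgF⟩
      · rcases hdG with ⟨hεG, hgG⟩ | ⟨hεG, hvG, K, hK, hGK, hgG⟩
        · exact Or.inl (hgF.mul hgG hF.modular.holomorphic.continuousOn)
        · obtain ⟨b, hb, hBb⟩ := hA.exists_factor hr hB.holomorphic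
            (hodd (by rw [hεF, hεG, one_mul]))
          refine Or.inr ⟨fun z => F z * K z, b, hF.modular.holomorphic.mul hK, hb, ?_, hBb,
            hgF.mul hgG hF.modular.holomorphic.continuousOn⟩
          intro z hz
          rw [Pi.mul_apply, hGK z hz]
          ring
      · rcases hdG with ⟨hεG, hgG⟩ | ⟨hεG, hvG, -⟩
        · obtain ⟨b, hb, hBb⟩ := hA.exists_factor hr hB.holomorphic
            (hodd (by rw [hεF, hεG, mul_one]))
          refine Or.inr ⟨fun z => K z * G z, b, hK.mul hG.modular.holomorphic, hb, ?_, hBb,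
            hgF.mul hgG hK.continuousOn⟩
          intro z hz
          rw [Pi.mul_apply, hFK z hz]
          ring
        · exact absurd ⟨hvF, hvG⟩ (hdisj r hr))
  have hHmod : IsModularForm A Γ 1 2 H := by
    refine ⟨hH, fun γ z hz => ?_, fun t ht z hz => ?_⟩
    · have heq : Set.EqOn (fun z => H (act ℂ γ.1 z)) (fun z => ((1 : Γ →* ℂˣ) γ : ℂ) * H z)
          {z ∈ A | (F * G) z ≠ 0} := by
        rintro z ⟨hz, h0⟩
        have h1 := hHf _ (L.act_mem (hΓ γ.2) hz)
        rw [hB.equivariant γ z hz, hFG.equivariant γ z hz, ← hHf z hz] at h1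
        simp only [MonoidHom.one_apply, Units.val_one, one_mul]
        have hχ : (((χF * χG) γ : ℂˣ) : ℂ) ≠ 0 := Units.ne_zero _
        exact mul_right_cancel₀ (mul_ne_zero hχ h0) (by linear_combination h1)
      exact heq.of_subset_closure (hH.continuousOn.comp (continuous_act γ.1).continuousOn
        fun z hz => L.act_mem (hΓ γ.2) hz) (hH.continuousOn.const_mul _ : ContinuousOn _ A)
        (fun z hz => hz.1) hdense hz
    · have heq : Set.EqOn (fun z => H (t • z)) (fun z => t ^ (-2 : ℤ) * H z)
          {z ∈ A | (F * G) z ≠ 0} := by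
        rintro z ⟨hz, h0⟩
        have h1 := hHf _ (hA.smul_mem ht hz)
        rw [hB.homogeneous t ht z hz, hFG.homogeneous t ht z hz, ← hHf z hz,
          show -(k + l + 2) = -2 + -(k + l) by ring, zpow_add₀ ht] at h1
        exact mul_right_cancel₀ (mul_ne_zero (zpow_ne_zero (-(k + l)) ht) h0)
          (by linear_combination h1)
      exact heq.of_subset_closure (hH.continuousOn.comp (continuous_const_smul t).continuousOn
        fun z hz => hA.smul_mem ht hz) (hH.continuousOn.const_mul _ : ContinuousOn _ A)
        (fun z hz => hz.1) hdense hz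
  intro z hz
  rw [← hHf z hz, hwt2 H hHmod z hz, zero_mul]

end EvenLattice

namespace EvenLattice

variable {n : ℕ} {L : EvenLattice n}

/-! ### The Laplace operator on the tube domain -/

theorem bil_intCast {K : Type*} [Field K] (x y : Fin (n + 2) → ℤ) :
    L.bil K (fun i => (x i : K)) (fun i => (y i : K)) = (L.bil ℤ x y : K) :=
  L.bil_map x y (Int.castRingHom K)

theorem bil_ratCast {K : Type*} [Field K] [CharZero K] (x y : Fin (n + 2) → ℚ) :
    L.bil K (fun i => (x i : K)) (fun i => (y i : K)) = (L.bil ℚ x y : K) :=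
  L.bil_map x y (Rat.castHom K)

variable (L) in
/-- The orthogonal projection to the complement of the hyperbolic plane spanned by an isotropic
vector `c` and a vector `c'` with `⟨c, c'⟩ = 1`. -/
def cuspProj {K : Type*} [Field K] (c c' y : Fin (n + 2) → K) : Fin (n + 2) → K :=
  y - L.bil K y c • c' - (L.bil K y c' - L.bil K y c * L.bil K c' c') • c

section CuspProj

variable {K : Type*} [Field K] {c c' : Fin (n + 2) → K}

theorem bil_cuspProj_isotropic (hc : L.bil K c c = 0) (hcc : L.bil K c c' = 1)
    (y : Fin (n + 2) → K) : L.bil K (L.cuspProj c c' y) c = 0 := by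
  have := L.bil_comm c' c
  simp only [cuspProj, bil_sub_left, bil_smul_left, hc, this, hcc]
  ring

theorem bil_cuspProj_dual (hcc : L.bil K c c' = 1) (y : Fin (n + 2) → K) :
    L.bil K (L.cuspProj c c' y) c' = 0 := by
  simp only [cuspProj, bil_sub_left, bil_smul_left, hcc]
  ring

theorem bil_cuspProj_of_orthogonal {x : Fin (n + 2) → K} (hx : L.bil K x c = 0)
    (hx' : L.bil K x c' = 0) (y : Fin (n + 2) → K) :
    L.bil K (L.cuspProj c c' y) x = L.bil K y x := by
  rw [L.bil_comm] at hx hx'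
  simp only [cuspProj, bil_sub_left, bil_smul_left, hx, hx']
  ring

end CuspProj

theorem bil_sum_right {R : Type*} [CommRing R] {ι : Type*} (s : Finset ι) (y : Fin (n + 2) → R)
    (f : ι → Fin (n + 2) → R) : L.bil R y (∑ i ∈ s, f i) = ∑ i ∈ s, L.bil R y (f i) := by
  classical
  induction s using Finset.induction_on with
  | empty => simp [bil_zero_right]
  | insert i s his ih => rw [Finset.sum_insert his, Finset.sum_insert his, bil_add_right, ih]

theorem exists_int_multiple (u : Fin (n + 2) → ℚ) :
    ∃ D : ℤ, D ≠ 0 ∧ ∃ x : Fin (n + 2) → ℤ, ∀ i, (x i : ℚ) = D * u i := by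
  obtain ⟨b, hb⟩ := IsLocalization.exist_integer_multiples_of_finite (nonZeroDivisors ℤ) u
  choose x hx using hb
  refine ⟨b, nonZeroDivisors.ne_zero b.2, x, fun i => ?_⟩
  have := hx i
  simpa [Algebra.smul_def] using this

namespace IsCuspPair

variable {c : Fin (n + 2) → ℤ} {c' : Fin (n + 2) → ℚ} (hc : L.IsCuspPair c c')

include hc

theorem ne_zero : c ≠ 0 := by
  rintro rfl
  exact not_isUnit_zero (hc.primitive 0 0 (by simp))

theorem isotropic_cast (K : Type*) [Field K] :
    L.bil K (fun i => (c i : K)) (fun i => (c i : K)) = 0 := by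
  rw [bil_intCast, hc.isotropic, Int.cast_zero]

theorem pairing_cast (K : Type*) [Field K] [CharZero K] :
    L.bil K (fun i => (c i : K)) (fun i => (c' i : K)) = 1 := by
  have := bil_ratCast (L := L) (K := K) (fun i => (c i : ℚ)) c'
  rw [hc.pairing] at this
  simpa using this

omit hc in
theorem bil_lattice_isotropic (K : Type*) [Field K] (x : L.cuspLattice c c') :
    L.bil K (fun i => (x.1 i : K)) (fun i => (c i : K)) = 0 := by
  rw [bil_intCast, x.2.1, Int.cast_zero]

omit hc in
theorem bil_lattice_dual (K : Type*) [Field K] [CharZero K] (x : L.cuspLattice c c') :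
    L.bil K (fun i => (x.1 i : K)) (fun i => (c' i : K)) = 0 := by
  have := bil_ratCast (L := L) (K := K) (fun i => (x.1 i : ℚ)) c'
  rw [x.2.2] at this
  simpa using this

/-- `L ⊗ K` is spanned by `L_{c,c'}`, `c` and `c'`; the form of the lattice being nondegenerate, only
zero is orthogonal to these. -/
theorem eq_zero_of_orthogonal {K : Type*} [Field K] [CharZero K] (hL : L.gram.det ≠ 0) {m : ℕ}
    (e : Module.Basis (Fin m) ℤ (L.cuspLattice c c')) {d : Fin (n + 2) → K}
    (hd : L.bil K (fun i => (c i : K)) d = 0) (hd' : L.bil K (fun i => (c' i : K)) d = 0)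
    (he : ∀ k, L.bil K (fun i => ((e k).1 i : K)) d = 0) : d = 0 := by
  -- vectors of the lattice `L_{c,c'}`
  have h1 : ∀ x : L.cuspLattice c c', L.bil K (fun i => (x.1 i : K)) d = 0 := by
    intro x
    induction e.mem_span x using Submodule.span_induction with
    | zero => simp [bil_eq_sum]
    | mem x hx =>
      obtain ⟨k, rfl⟩ := hx
      exact he k
    | add x y _ _ hx hy =>
      have : (fun i => (((x + y : L.cuspLattice c c').1 i : ℤ) : K)) =
          (fun i => (x.1 i : K)) + fun i => (y.1 i : K) := by funext i; simp
      rw [this, bil_add_left, hx, hy, add_zero]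
    | smul a x _ hx =>
      have : (fun i => (((a • x : L.cuspLattice c c').1 i : ℤ) : K)) =
          (a : K) • fun i => (x.1 i : K) := by funext i; simp
      rw [this, bil_smul_left, hx, mul_zero]
  -- rational vectors of `L_{c,c'} ⊗ ℚ`
  have h2 : ∀ u : Fin (n + 2) → ℚ, L.bil ℚ u (fun i => (c i : ℚ)) = 0 → L.bil ℚ u c' = 0 →
      L.bil K (fun i => (u i : K)) d = 0 := by
    intro u hu hu'
    obtain ⟨D, hD, x, hx⟩ := exists_int_multiple u
    have hxu : (fun i => (x i : ℚ)) = (D : ℚ) • u := funext hx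
    have hmem : x ∈ L.cuspLattice c c' := by
      refine ⟨?_, by rw [hxu, bil_smul_left, hu', mul_zero]⟩
      have := bil_intCast (L := L) (K := ℚ) x c
      rw [hxu, bil_smul_left, hu, mul_zero] at this
      exact_mod_cast this.symm
    have := h1 ⟨x, hmem⟩
    have hxK : (fun i => (x i : K)) = (D : K) • fun i => (u i : K) := by
      funext i
      have := congrArg (Rat.cast : ℚ → K) (hx i)
      simpa using this
    change L.bil K (fun i => (x i : K)) d = 0 at this
    rw [hxK, bil_smul_left] at this
    exact (mul_eq_zero.1 this).resolve_left (Int.cast_ne_zero.2 hD)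
  refine eq_zero_of_forall_bil_eq_zero hL fun y => ?_
  have h3 : ∀ i, L.bil K (Pi.single i 1) d = 0 := by
    intro i
    set y : Fin (n + 2) → ℚ := Pi.single i 1 with hy
    have hp := h2 (L.cuspProj (fun i => (c i : ℚ)) c' y)
      (bil_cuspProj_isotropic (hc.isotropic_cast ℚ) hc.pairing y) (bil_cuspProj_dual hc.pairing y)
    have hyK : (Pi.single i 1 : Fin (n + 2) → K) =
        (fun i => ((L.cuspProj (fun i => (c i : ℚ)) c' y i : ℚ) : K)) +
          (L.bil ℚ y (fun i => (c i : ℚ)) : K) • (fun i => (c' i : K)) +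
          ((L.bil ℚ y c' - L.bil ℚ y (fun i => (c i : ℚ)) * L.bil ℚ c' c' : ℚ) : K) •
            (fun i => (c i : K)) := by
      funext j
      have : (Pi.single i 1 : Fin (n + 2) → K) j = ((y j : ℚ) : K) := by
        rw [hy]
        rcases eq_or_ne j i with rfl | hij
        · simp
        · simp [hij]
      rw [this]
      simp only [cuspProj, Pi.add_apply, Pi.smul_apply, Pi.sub_apply, smul_eq_mul]
      push_cast
      ring
    rw [hyK, bil_add_left, bil_add_left, bil_smul_left, bil_smul_left, hp, hd, hd']
    ring
  rw [← Finset.univ_sum_single y, bil_comm, bil_sum_right]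
  refine Finset.sum_eq_zero fun i _ => ?_
  rw [show (Pi.single i (y i) : Fin (n + 2) → K) = y i • Pi.single i 1 by
    rw [← Pi.single_smul, smul_eq_mul, mul_one], bil_smul_right, bil_comm, h3, mul_zero]

omit hc in
/-- The Gram matrix of a basis of `L_{c,c'}`. -/
noncomputable def cuspGram {m : ℕ} (e : Module.Basis (Fin m) ℤ (L.cuspLattice c c')) : Matrix (Fin m) (Fin m) ℂ :=
  Matrix.of fun i j => (L.bil ℤ (e i).1 (e j).1 : ℂ)

theorem isUnit_det_cuspGram (hL : L.gram.det ≠ 0) {m : ℕ}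
    (e : Module.Basis (Fin m) ℤ (L.cuspLattice c c')) : IsUnit (cuspGram e).det := by
  have h0 : (Matrix.of fun i j => L.bil ℤ (e i).1 (e j).1).det ≠ 0 := by
    intro h0
    obtain ⟨v, hv, hv0⟩ := Matrix.exists_mulVec_eq_zero_iff.2 h0
    set x : L.cuspLattice c c' := ∑ j, v j • e j with hx
    have hxe : ∀ k, L.bil ℤ (e k).1 x.1 = 0 := by
      intro k
      have h1 := congrFun hv0 k
      rw [hx, Submodule.coe_sum, bil_sum_right]
      simp only [Submodule.coe_smul, bil_smul_right]
      simpa [Matrix.mulVec, dotProduct, mul_comm] using h1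
    have hx0 : (fun i => ((x.1 i : ℤ) : ℚ)) = 0 := by
      refine hc.eq_zero_of_orthogonal hL e ?_ ?_ fun k => ?_
      · rw [bil_comm]; exact bil_lattice_isotropic ℚ x
      · rw [bil_comm]; exact bil_lattice_dual ℚ x
      · rw [bil_intCast, hxe, Int.cast_zero]
    have hx0' : x = 0 := by
      apply Subtype.ext
      funext i
      have := congrFun hx0 i
      simpa using this
    apply hv
    funext j
    have := Fintype.linearIndependent_iff.1 e.linearIndependent v (by rw [← hx, hx0']) j
    exact this
  have := (Int.castRingHom ℂ).map_det (Matrix.of fun i j => L.bil ℤ (e i).1 (e j).1)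
  have h1 : (cuspGram e).det = ((Matrix.of fun i j => L.bil ℤ (e i).1 (e j).1).det : ℤ) :=
    this.symm
  rw [h1, isUnit_iff_ne_zero]
  exact_mod_cast h0

/-- The expansion of a vector of `L_{c,c'} ⊗ ℂ` in terms of a basis and its dual basis. -/
theorem sum_inv_gram_smul (hL : L.gram.det ≠ 0) {m : ℕ}
    (e : Module.Basis (Fin m) ℤ (L.cuspLattice c c')) {w : Fin (n + 2) → ℂ}
    (hw : L.bil ℂ w (fun i => (c i : ℂ)) = 0) (hw' : L.bil ℂ w (fun i => (c' i : ℂ)) = 0) :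
    ∑ i, ∑ j, ((cuspGram e)⁻¹ i j * L.bil ℂ w (fun l => ((e i).1 l : ℂ))) •
      (fun l => ((e j).1 l : ℂ)) = w := by
  set E : Fin m → Fin (n + 2) → ℂ := fun i l => ((e i).1 l : ℂ) with hE
  have hEE : ∀ i j, L.bil ℂ (E i) (E j) = cuspGram e i j := fun i j => bil_intCast _ _
  have hsum : ∀ y, L.bil ℂ y (∑ i, ∑ j, ((cuspGram e)⁻¹ i j * L.bil ℂ w (E i)) • E j) =
      ∑ i, ∑ j, ((cuspGram e)⁻¹ i j * L.bil ℂ w (E i)) * L.bil ℂ y (E j) := by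
    intro y
    simp only [bil_sum_right, bil_smul_right]
  refine sub_eq_zero.1 (hc.eq_zero_of_orthogonal hL e ?_ ?_ fun k => ?_)
  · rw [bil_sub_right, hsum, L.bil_comm _ w, hw, sub_zero]
    refine Finset.sum_eq_zero fun i _ => Finset.sum_eq_zero fun j _ => ?_
    rw [L.bil_comm _ (E j), hE, bil_lattice_isotropic, mul_zero]
  · rw [bil_sub_right, hsum, L.bil_comm _ w, hw', sub_zero]
    refine Finset.sum_eq_zero fun i _ => Finset.sum_eq_zero fun j _ => ?_
    rw [L.bil_comm _ (E j), hE, bil_lattice_dual, mul_zero]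
  · change L.bil ℂ (E k) _ = 0
    rw [bil_sub_right, hsum, L.bil_comm _ w, sub_eq_zero]
    have h1 : ∀ i, ∑ j, ((cuspGram e)⁻¹ i j * L.bil ℂ w (E i)) * L.bil ℂ (E k) (E j) =
        L.bil ℂ w (E i) * ((cuspGram e)⁻¹ * cuspGram e) i k := by
      intro i
      rw [Matrix.mul_apply, Finset.mul_sum]
      refine Finset.sum_congr rfl fun j _ => ?_
      rw [L.bil_comm (E k), hEE]
      ring
    rw [Finset.sum_congr rfl fun i _ => h1 i,
      Matrix.nonsing_inv_mul _ (hc.isUnit_det_cuspGram hL e)]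
    simp [Matrix.one_apply]

/-- The trace of a bilinear form with `c` in both kernels is its trace on `L_{c,c'} ⊗ ℂ`. -/
theorem formTrace_eq_sum (hL : L.gram.det ≠ 0) {m : ℕ}
    (e : Module.Basis (Fin m) ℤ (L.cuspLattice c c'))
    (B : (Fin (n + 2) → ℂ) →ₗ[ℂ] (Fin (n + 2) → ℂ) →ₗ[ℂ] ℂ)
    (hl : ∀ w, B (fun i => (c i : ℂ)) w = 0) (hr : ∀ v, B v (fun i => (c i : ℂ)) = 0) :
    L.formTrace (fun v w => B v w) = ∑ i, ∑ j, (cuspGram e)⁻¹ i j *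
      B (fun l => ((e i).1 l : ℂ)) (fun l => ((e j).1 l : ℂ)) := by
  set E : Fin m → Fin (n + 2) → ℂ := fun i l => ((e i).1 l : ℂ) with hE
  set C : Fin (n + 2) → ℂ := fun i => (c i : ℂ) with hC
  set C' : Fin (n + 2) → ℂ := fun i => (c' i : ℂ) with hC'
  have hCC := hc.isotropic_cast ℂ
  have hCC' := hc.pairing_cast ℂ
  have hdec : ∀ w, w = ∑ i, ∑ j, ((cuspGram e)⁻¹ i j * L.bil ℂ w (E i)) • E j +
      L.bil ℂ w C • C' + (L.bil ℂ w C' - L.bil ℂ w C * L.bil ℂ C' C') • C := by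
    intro w
    have h := hc.sum_inv_gram_smul hL e (bil_cuspProj_isotropic hCC hCC' w)
      (bil_cuspProj_dual hCC' w)
    have h2 : ∀ i, L.bil ℂ (L.cuspProj C C' w) (fun l => ((e i).1 l : ℂ)) = L.bil ℂ w (E i) :=
      fun i => bil_cuspProj_of_orthogonal (bil_lattice_isotropic ℂ _) (bil_lattice_dual ℂ _) w
    simp only [← hC, ← hC', h2] at h
    change ∑ i, ∑ j, ((cuspGram e)⁻¹ i j * L.bil ℂ w (E i)) • E j = _ at h
    rw [h, cuspProj]
    abel
  have hB : (fun v w => B v w) = fun v w => (∑ i, ∑ j, (cuspGram e)⁻¹ i j *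
      ((B.flip (E j)) v * L.bil ℂ w (E i))) + (B.flip C') v * L.bil ℂ w C := by
    funext v w
    conv_lhs => rw [hdec w]
    simp only [map_add, map_sum, map_smul, smul_eq_mul, LinearMap.flip_apply]
    rw [show B v C = 0 from hr v, mul_zero, add_zero, mul_comm (L.bil ℂ w C)]
    congr 1
    refine Finset.sum_congr rfl fun i _ => Finset.sum_congr rfl fun j _ => ?_
    ring
  have hsum : ∀ {ι : Type} (s : Finset ι) (f : ι → (Fin (n + 2) → ℂ) → (Fin (n + 2) → ℂ) → ℂ),
      L.formTrace (fun v w => ∑ i ∈ s, f i v w) = ∑ i ∈ s, L.formTrace (f i) := by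
    intro ι s f
    classical
    induction s using Finset.induction_on with
    | empty => simpa using L.formTrace_const_mul 0 (fun _ _ => 0)
    | insert i s his ih =>
      simp only [Finset.sum_insert his]
      rw [formTrace_add, ih]
  rw [hB, formTrace_add, hsum, formTrace_mul_bil_right hL, LinearMap.flip_apply,
    show B C C' = 0 from hl _, add_zero]
  refine Finset.sum_congr rfl fun i _ => ?_
  rw [hsum]
  refine Finset.sum_congr rfl fun j _ => ?_
  rw [formTrace_const_mul, formTrace_mul_bil_right hL, LinearMap.flip_apply]

end IsCuspPair

end EvenLattice

namespace EvenLattice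

variable {n : ℕ} {L : EvenLattice n}

section Laplacian

variable {A : Set (Fin (n + 2) → ℂ)} {F : (Fin (n + 2) → ℂ) → ℂ}
  {c : Fin (n + 2) → ℤ} {c' : Fin (n + 2) → ℚ}

theorem IsCuspPair.bil_ne_zero (hc : L.IsCuspPair c c') (hA : L.IsDomainCone A) :
    ∀ z ∈ A, L.bil ℂ z (fun i => (c i : ℂ)) ≠ 0 := by
  intro z hz h0
  have hcC : (fun i => (c i : ℂ)) = toComplex fun i => (c i : ℝ) := by
    funext i; simp [toComplex]
  rw [hcC] at h0
  refine (L.bil_self_pos_of_orthogonal (hA.subset_negCone hz) h0 fun h => hc.ne_zero ?_).ne'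
    (hc.isotropic_cast ℝ)
  funext i
  have := congrFun h i
  simpa using this

theorem quad_add {K : Type*} [Field K] [CharZero K] (x y : Fin (n + 2) → K) :
    L.quad K (x + y) = L.quad K x + L.quad K y + L.bil K x y := by
  simp only [quad, bil_add_left, bil_add_right, L.bil_comm y x]
  ring

theorem quad_smul {K : Type*} [Field K] (a : K) (x : Fin (n + 2) → K) :
    L.quad K (a • x) = a ^ 2 * L.quad K x := by
  simp only [quad, bil_smul_left, bil_smul_right]
  ring

theorem quad_ratCast {K : Type*} [Field K] [CharZero K] (x : Fin (n + 2) → ℚ) :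
    L.quad K (fun i => (x i : K)) = (L.quad ℚ x : K) := by
  rw [quad, quad, bil_ratCast]
  push_cast
  rfl

theorem coneProj_add_smul {w x : Fin (n + 2) → ℂ} (hw : L.bil ℂ w w = 0) (hx : L.bil ℂ x w ≠ 0)
    (t : ℂ) : L.coneProj w (x + t • w) = L.coneProj w x := by
  have h1 : L.bil ℂ (x + t • w) w = L.bil ℂ x w := by
    rw [bil_add_left, bil_smul_left, hw, mul_zero, add_zero]
  have h2 : L.quad ℂ (x + t • w) = L.quad ℂ x + t * L.bil ℂ x w := by
    rw [quad_add, quad_smul, bil_smul_right, show L.quad ℂ w = 0 by rw [quad, hw, zero_div]]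
    ring
  rw [coneProj, coneProj, h1, h2, add_div, mul_div_assoc, div_self hx, mul_one, add_smul]
  abel

/-- The tube domain parametrizes the cone by the projection along `c`. -/
theorem IsCuspPair.coneProj_add (hc : L.IsCuspPair c c') {Y : Fin (n + 2) → ℂ}
    (hY : L.bil ℂ Y (fun i => (c i : ℂ)) = 0) (hY' : L.bil ℂ Y (fun i => (c' i : ℂ)) = 0) :
    L.coneProj (fun i => (c i : ℂ)) ((fun i => (c' i : ℂ)) + Y) = L.tubeMap c c' Y := by
  have h1 : L.bil ℂ ((fun i => (c' i : ℂ)) + Y) (fun i => (c i : ℂ)) = 1 := by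
    rw [bil_add_left, hY, add_zero, bil_comm, hc.pairing_cast]
  have h2 : L.quad ℂ ((fun i => (c' i : ℂ)) + Y) = L.quad ℂ Y + (L.quad ℚ c' : ℚ) := by
    rw [quad_add, L.bil_comm _ Y, hY', add_zero, quad_ratCast, add_comm]
  rw [coneProj, h1, h2, div_one, tubeMap]

theorem fderiv_apply_eq_zero_of_forall_add_smul {E G : Type*} [NormedAddCommGroup E]
    [NormedSpace ℂ E] [NormedAddCommGroup G] [NormedSpace ℂ G] {f : E → G} {x w : E}
    (hf : DifferentiableAt ℂ f x) (h : ∀ᶠ t : ℂ in nhds 0, f (x + t • w) = f x) :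
    fderiv ℂ f x w = 0 := by
  rw [← hf.lineDeriv_eq_fderiv, lineDeriv, Filter.EventuallyEq.deriv_eq h, deriv_const]

/-- The Laplace operator on the tube domain is that of the extension along `c`. -/
theorem laplacian_onTube (hA : L.IsDomainCone A) (hc : L.IsCuspPair c c')
    (hF : DifferentiableOn ℂ F A) {m : ℕ} (e : Module.Basis (Fin m) ℤ (L.cuspLattice c c'))
    {Z : Fin (n + 2) → ℂ} (hZ : Z ∈ L.tubeDomain c c' A) :
    L.laplacian e (L.onTube c c' F) Z =
      1 / (8 * (Real.pi : ℂ) ^ 2) * L.lap (L.extend F fun i => (c i : ℂ)) (L.tubeMap c c' Z) := by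
  have hL := hA.det_gram_ne_zero
  set C : Fin (n + 2) → ℂ := fun i => (c i : ℂ) with hC
  set C' : Fin (n + 2) → ℂ := fun i => (c' i : ℂ) with hC'
  have hCC : L.bil ℂ C C = 0 := hc.isotropic_cast ℂ
  set g := L.extend F C with hg
  have hU := isOpen_extDomain hA hCC
  have hgd : DifferentiableOn ℂ g (L.extDomain A C) := differentiableOn_extend hF
  have hgU : ∀ x ∈ L.extDomain A C, DifferentiableAt ℂ g x := fun x hx =>
    hgd.differentiableAt (hU.mem_nhds hx)
  have hg' : ∀ x ∈ L.extDomain A C, DifferentiableAt ℂ (fderiv ℂ g) x := fun x hx =>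
    (hgd.fderiv_complex hU).differentiableAt (hU.mem_nhds hx)
  have hzU : L.tubeMap c c' Z ∈ L.extDomain A C :=
    subset_extDomain hA (hc.bil_ne_zero hA) hZ.2.2
  -- invariance of the extension in the direction of `c`
  have hinv : ∀ x, L.bil ℂ x C ≠ 0 → ∀ t : ℂ, g (x + t • C) = g x := fun x hx t => by
    rw [hg, extend, extend, coneProj_add_smul hCC hx]
  have hinvD : ∀ x ∈ L.extDomain A C, ∀ t : ℂ, fderiv ℂ g (x + t • C) = fderiv ℂ g x := by
    intro x hx t
    rw [← fderiv_comp_add_right]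
    refine Filter.EventuallyEq.fderiv_eq ?_
    filter_upwards [hU.mem_nhds hx] with y hy using hinv y hy.1 t
  have hgC : ∀ x ∈ L.extDomain A C, fderiv ℂ g x C = 0 := fun x hx =>
    fderiv_apply_eq_zero_of_forall_add_smul (hgU x hx) (.of_forall (hinv x hx.1))
  have hflip : ∀ x ∈ L.extDomain A C, ∀ v w,
      fderiv ℂ (fun y => fderiv ℂ g y w) x v = fderiv ℂ (fderiv ℂ g) x v w := by
    intro x hx v w
    have := ((hg' x hx).hasFDerivAt.clm_apply (hasFDerivAt_const w x)).fderiv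
    rw [this]
    simp
  have hr : ∀ x ∈ L.extDomain A C, ∀ v, fderiv ℂ (fderiv ℂ g) x v C = 0 := by
    intro x hx v
    rw [← hflip x hx]
    have : (fun y => fderiv ℂ g y C) =ᶠ[nhds x] fun _ => 0 := by
      filter_upwards [hU.mem_nhds hx] with y hy using hgC y hy
    rw [this.fderiv_eq]
    simp
  have hl : ∀ x ∈ L.extDomain A C, ∀ w, fderiv ℂ (fderiv ℂ g) x C w = 0 := by
    intro x hx w
    rw [fderiv_apply_eq_zero_of_forall_add_smul (hg' x hx) (.of_forall (hinvD x hx))]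
    rfl
  -- the function on the tube domain in terms of the extension
  set a : Fin (n + 2) → ℂ := C' + (-(L.quad ℂ Z + (L.quad ℚ c' : ℚ))) • C with ha
  have haZ : a + Z = L.tubeMap c c' Z := by rw [ha, tubeMap, neg_smul]; abel
  have htube : ∀ Y, L.bil ℂ Y C = 0 → L.bil ℂ Y C' = 0 → L.onTube c c' F Y = g (a + Y) := by
    intro Y hY hY'
    have h1 : a + Y = (C' + Y) + (-(L.quad ℂ Z + (L.quad ℚ c' : ℚ))) • C := by rw [ha]; abel
    have h2 : L.bil ℂ (C' + Y) C ≠ 0 := by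
      rw [bil_add_left, hY, add_zero, bil_comm, hc.pairing_cast]
      exact one_ne_zero
    rw [h1, hinv _ h2, onTube, hg, extend, hc.coneProj_add hY hY']
  set E : Fin m → Fin (n + 2) → ℂ := fun i l => ((e i).1 l : ℂ) with hE
  have hEC : ∀ i, L.bil ℂ (E i) C = 0 := fun i => IsCuspPair.bil_lattice_isotropic ℂ (e i)
  have hEC' : ∀ i, L.bil ℂ (E i) C' = 0 := fun i => IsCuspPair.bil_lattice_dual ℂ (e i)
  have hadd : ∀ Y, L.bil ℂ Y C = 0 → L.bil ℂ Y C' = 0 → ∀ i (t : ℂ),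
      L.bil ℂ (Y + t • E i) C = 0 ∧ L.bil ℂ (Y + t • E i) C' = 0 := by
    intro Y hY hY' i t
    simp [bil_add_left, bil_smul_left, hY, hY', hEC, hEC']
  have hd1 : ∀ Y, L.bil ℂ Y C = 0 → L.bil ℂ Y C' = 0 → a + Y ∈ L.extDomain A C → ∀ j,
      lineDeriv ℂ (L.onTube c c' F) Y (E j) = fderiv ℂ g (a + Y) (E j) := by
    intro Y hY hY' haY j
    rw [← (hgU _ haY).lineDeriv_eq_fderiv, lineDeriv, lineDeriv]
    congr 1
    funext t
    rw [htube _ (hadd Y hY hY' j t).1 (hadd Y hY hY' j t).2, ← add_assoc a]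
  have hd2 : ∀ i j, lineDeriv ℂ (fun Y => lineDeriv ℂ (L.onTube c c' F) Y (E j)) Z (E i) =
      fderiv ℂ (fderiv ℂ g) (L.tubeMap c c' Z) (E i) (E j) := by
    intro i j
    have hd : DifferentiableAt ℂ (fun y => fderiv ℂ g y (E j)) (L.tubeMap c c' Z) :=
      (hg' _ hzU).clm_apply (differentiableAt_const _)
    rw [← hflip _ hzU, ← hd.lineDeriv_eq_fderiv, lineDeriv, lineDeriv]
    refine Filter.EventuallyEq.deriv_eq ?_
    have hcont : Continuous fun t : ℂ => L.tubeMap c c' Z + t • E i := by fun_prop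
    have hev : ∀ᶠ t : ℂ in nhds 0, L.tubeMap c c' Z + t • E i ∈ L.extDomain A C :=
      hcont.continuousAt.eventually (hU.mem_nhds (by simpa using hzU))
    filter_upwards [hev] with t ht
    have h1 : a + (Z + t • E i) = L.tubeMap c c' Z + t • E i := by rw [← haZ, ← add_assoc a]
    rw [hd1 _ (hadd Z hZ.1 hZ.2.1 i t).1 (hadd Z hZ.1 hZ.2.1 i t).2 (by rwa [h1]), h1]
  have key := hc.formTrace_eq_sum hL e (ContinuousLinearMap.coeLM ℂ ∘ₗ
      (fderiv ℂ (fderiv ℂ g) (L.tubeMap c c' Z)).toLinearMap)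
    (fun w => hl _ hzU w) (fun v => hr _ hzU v)
  rw [lap, laplacian]
  congr 1
  refine Eq.trans ?_ key.symm
  refine Finset.sum_congr rfl fun i _ => Finset.sum_congr rfl fun j _ => ?_
  exact congrArg _ (hd2 i j)

/-- The identity between the Laplacians of `FG`, `F` and `G` on the tube domain. -/
theorem laplacian_mul_eq (hA : L.IsDomainCone A) {Γ : Subgroup (GL (Fin (n + 2)) ℤ)}
    (hΓ : Γ ≤ L.OPlus A) {χF χG : Γ →* ℂˣ} {k l : ℤ} {G : (Fin (n + 2) → ℂ) → ℂ}
    (hF : L.IsReflective A Γ χF k F) (hG : L.IsReflective A Γ χG l G)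
    (hFs : L.HasSimpleZeros A F) (hGs : L.HasSimpleZeros A G) (hdisj : L.HaveDisjointZeros A F G)
    (hwt2 : ∀ H : (Fin (n + 2) → ℂ) → ℂ, IsModularForm A Γ 1 2 H → ∀ z ∈ A, H z = 0)
    (hc : L.IsCuspPair c c') {m : ℕ} (e : Module.Basis (Fin m) ℤ (L.cuspLattice c c'))
    {Z : Fin (n + 2) → ℂ} (hZ : Z ∈ L.tubeDomain c c' A) :
    ((n : ℂ) / 2 - 1 - k) * ((n : ℂ) / 2 - 1 - l) * L.laplacian e (L.onTube c c' (F * G)) Z =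
      ((n : ℂ) / 2 - 1 - l) * ((n : ℂ) / 2 - 1 - k - l) *
        (L.laplacian e (L.onTube c c' F) Z * L.onTube c c' G Z) +
      ((n : ℂ) / 2 - 1 - k) * ((n : ℂ) / 2 - 1 - k - l) *
        (L.onTube c c' F Z * L.laplacian e (L.onTube c c' G) Z) := by
  have h := bracket_eq_zero hA hΓ hF hG hFs hGs hdisj hwt2 (hc.isotropic_cast ℂ)
    (hc.bil_ne_zero hA) _ hZ.2.2
  rw [bracket] at h
  rw [laplacian_onTube hA hc hF.modular.holomorphic e hZ,
    laplacian_onTube hA hc hG.modular.holomorphic e hZ,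
    laplacian_onTube hA hc (hF.modular.mul hG.modular).holomorphic e hZ, onTube, onTube]
  linear_combination (1 / (8 * (Real.pi : ℂ) ^ 2)) * h

end Laplacian

end EvenLattice

/-! ### Absolutely convergent exponential series -/

section ExponentialSeries

open Filter Topology

/-- Termwise differentiation.  The convergence at `± i δ` dominates the terms for `|t| < δ`. -/
theorem hasSum_deriv_exp {ι : Type*} {a : ι → ℂ} {r : ι → ℝ} {g : ℂ → ℂ} {ε : ℝ} (hε : 0 < ε)
    (h : ∀ t ∈ Metric.ball (0 : ℂ) ε,
      HasSum (fun v => a v * Complex.exp (Complex.I * r v * t)) (g t)) :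
    HasSum (fun v => a v * (Complex.I * r v)) (deriv g 0) := by
  set δ := ε / 2 with hδ
  have hδ0 : 0 < δ := by positivity
  have hnorm : ∀ v (t : ℂ), ‖a v * Complex.exp (Complex.I * r v * t)‖ =
      ‖a v‖ * Real.exp (-(r v * t.im)) := by
    intro v t
    rw [norm_mul, Complex.norm_exp]
    simp [mul_assoc]
  have hmem : ∀ s : ℝ, |s| = δ → (s : ℂ) * Complex.I ∈ Metric.ball (0 : ℂ) ε := by
    intro s hs
    rw [mem_ball_zero_iff, norm_mul, Complex.norm_I, mul_one, Complex.norm_real, Real.norm_eq_abs,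
      hs]
    linarith
  have hsum : ∀ s : ℝ, |s| = δ → Summable fun v => ‖a v‖ * Real.exp (-(r v * s)) := by
    intro s hs
    have := (h _ (hmem s hs)).summable.norm
    refine this.congr fun v => ?_
    rw [hnorm]
    simp
  have hu := (hsum δ (abs_of_pos hδ0)).add (hsum (-δ) (by rw [abs_neg, abs_of_pos hδ0]))
  have hball : Metric.ball (0 : ℂ) δ ⊆ Metric.ball 0 ε := Metric.ball_subset_ball (by linarith)
  have key := Complex.hasSum_deriv_of_summable_norm
    (F := fun v t => a v * Complex.exp (Complex.I * r v * t)) hu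
    (fun v => (by fun_prop : Differentiable ℂ _).differentiableOn) Metric.isOpen_ball
    (fun v t ht => by
      rw [hnorm, ← mul_add]
      refine mul_le_mul_of_nonneg_left ?_ (norm_nonneg _)
      have him : |t.im| ≤ δ :=
        (Complex.abs_im_le_norm t).trans (mem_ball_zero_iff.1 ht).le
      rcases le_total 0 (r v) with hr | hr
      · refine le_add_of_nonneg_of_le (Real.exp_nonneg _) (Real.exp_le_exp.2 ?_)
        nlinarith [abs_le.1 him]
      · refine le_add_of_le_of_nonneg (Real.exp_le_exp.2 ?_) (Real.exp_nonneg _)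
        nlinarith [abs_le.1 him]) (Metric.mem_ball_self hδ0)
  have hg : (fun t => ∑' v, a v * Complex.exp (Complex.I * r v * t)) =ᶠ[𝓝 0] g := by
    filter_upwards [Metric.ball_mem_nhds (0 : ℂ) hδ0] with t ht
    exact (h t (hball ht)).tsum_eq
  rw [hg.deriv_eq] at key
  refine key.congr_fun fun v => ?_
  have h1 : HasDerivAt (fun t : ℂ => Complex.exp (Complex.I * r v * t)) (Complex.I * r v) 0 := by
    have := ((hasDerivAt_id (0 : ℂ)).const_mul (Complex.I * r v)).cexp
    simpa using this
  exact ((h1.const_mul (a v)).deriv).symm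

theorem tendsto_average_pow {ρ : ℂ} (hρ : ‖ρ‖ = 1) (h1 : ρ ≠ 1) :
    Tendsto (fun T : ℕ => (∑ t ∈ Finset.range T, ρ ^ t) / T) atTop (𝓝 0) := by
  have hlim : Tendsto (fun T : ℕ => (2 / ‖ρ - 1‖) / (T : ℝ)) atTop (𝓝 0) :=
    tendsto_const_div_atTop_nhds_zero_nat _
  refine squeeze_zero_norm (fun T => ?_) hlim
  rw [geom_sum_eq h1, norm_div, norm_div, Complex.norm_natCast]
  have : ‖ρ ^ T - 1‖ ≤ 2 := by
    refine (norm_sub_le _ _).trans ?_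
    rw [norm_pow, hρ, one_pow, norm_one]
    norm_num
  gcongr

/-- The coefficients of an almost periodic sequence are unique: they are recovered by averaging. -/
theorem eq_zero_of_hasSum_mul_pow {ι : Type*} {b χ : ι → ℂ} (hχ : ∀ v, ‖χ v‖ = 1)
    (hinj : Function.Injective χ) (h : ∀ t : ℕ, HasSum (fun v => b v * χ v ^ t) 0) : b = 0 := by
  classical
  funext v₀
  have hb : Summable fun v => ‖b v‖ := by
    have := (h 0).summable.norm
    simpa using this
  have hχ0 : ∀ v, χ v ≠ 0 := fun v h0 => by simpa [h0] using hχ v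
  set ρ : ι → ℂ := fun v => χ v * (χ v₀)⁻¹ with hρ
  have hρn : ∀ v, ‖ρ v‖ = 1 := fun v => by simp [hρ, hχ]
  have hsum : ∀ T : ℕ, ∑' v, b v * ((∑ t ∈ Finset.range T, ρ v ^ t) / T) = 0 := by
    intro T
    have h1 : HasSum (fun v => ∑ t ∈ Finset.range T, b v * ρ v ^ t) (∑ t ∈ Finset.range T, 0) := by
      refine hasSum_sum fun t _ => ?_
      have := (h t).mul_right ((χ v₀)⁻¹ ^ t)
      rw [zero_mul] at this
      refine this.congr_fun fun v => ?_
      rw [hρ, mul_pow]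
      ring
    have h2 := h1.div_const (T : ℂ)
    rw [Finset.sum_const_zero, zero_div] at h2
    rw [← h2.tsum_eq]
    refine tsum_congr fun v => ?_
    rw [← Finset.mul_sum, mul_div_assoc]
  have hlim := tendsto_tsum_of_dominated_convergence (𝓕 := atTop)
    (f := fun (T : ℕ) v => b v * ((∑ t ∈ Finset.range T, ρ v ^ t) / T))
    (g := fun v => if v = v₀ then b v else 0) hb (fun v => by
      rcases eq_or_ne v v₀ with rfl | hv
      · rw [if_pos rfl]
        refine tendsto_const_nhds.congr' ?_
        filter_upwards [eventually_ne_atTop 0] with T hT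
        have : (T : ℂ) ≠ 0 := Nat.cast_ne_zero.2 hT
        simp [hρ, hχ0, this]
      · rw [if_neg hv]
        have hv1 : ρ v ≠ 1 := fun h1 => hv (hinj (by
          rw [hρ] at h1
          exact (mul_inv_eq_one₀ (hχ0 v₀)).1 h1))
        simpa using (tendsto_average_pow (hρn v) hv1).const_mul (b v)) (by
      refine Eventually.of_forall fun T v => ?_
      rw [norm_mul]
      refine mul_le_of_le_one_right (norm_nonneg _) ?_
      rw [norm_div, Complex.norm_natCast]
      refine div_le_one_of_le₀ ((norm_sum_le _ _).trans ?_) (Nat.cast_nonneg _)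
      simp [norm_pow, hρn])
  simp only [hsum, tsum_ite_eq] at hlim
  exact (tendsto_nhds_unique hlim tendsto_const_nhds)

theorem finite_support_of_summable_int {ι : Type*} {a : ι → ℤ} (h : Summable fun v => (a v : ℂ)) :
    (Function.support a).Finite := by
  have h1 := h.norm.tendsto_cofinite_zero
  have h2 := h1.eventually (gt_mem_nhds (zero_lt_one : (0 : ℝ) < 1))
  refine (eventually_cofinite.1 h2).subset fun v hv hlt => hv ?_
  have : |(a v : ℝ)| < 1 := by simpa using hlt
  exact Int.abs_lt_one_iff.1 (by exact_mod_cast this)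

/-- Products of absolutely convergent exponential series. -/
theorem HasSum.convolution {M : Type*} [AddCommGroup M] {a b e : M → ℂ} {x y : ℂ}
    (he : ∀ v w, e (v + w) = e v * e w) (he0 : ∀ v, e v ≠ 0)
    (ha : HasSum (fun v => a v * e v) x) (hb : HasSum (fun v => b v * e v) y) :
    (∀ ν, Summable fun v => a v * b (ν - v)) ∧
      HasSum (fun ν => (∑' v, a v * b (ν - v)) * e ν) (x * y) := by
  have h1 : HasSum (fun p : M × M => a p.1 * e p.1 * (b p.2 * e p.2)) (x * y) := by
    have h := (summable_mul_of_summable_norm (f := fun v => a v * e v) (g := fun v => b v * e v)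
      ha.summable.norm hb.summable.norm).hasSum
    rw [← tsum_mul_tsum_of_summable_norm ha.summable.norm hb.summable.norm, ha.tsum_eq,
      hb.tsum_eq] at h
    exact h
  let σ : M × M ≃ M × M :=
    { toFun := fun p => (p.2, p.1 - p.2)
      invFun := fun p => (p.1 + p.2, p.1)
      left_inv := fun p => by simp
      right_inv := fun p => by simp }
  have h2 : HasSum ((fun p : M × M => a p.1 * e p.1 * (b p.2 * e p.2)) ∘ σ) (x * y) :=
    σ.hasSum_iff.2 h1
  have h3 : ((fun p : M × M => a p.1 * e p.1 * (b p.2 * e p.2)) ∘ σ) =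
      fun p => a p.2 * b (p.1 - p.2) * e p.1 := by
    funext p
    have : e p.1 = e p.2 * e (p.1 - p.2) := by rw [← he]; congr 1; abel
    simp only [Function.comp_apply, σ, Equiv.coe_fn_mk, this]
    ring
  rw [h3] at h2
  have h4 : ∀ ν, Summable fun v => a v * b (ν - v) := by
    intro ν
    have := h2.summable.prod_factor ν
    exact (summable_mul_right_iff (he0 ν)).1 this
  exact ⟨h4, h2.prod_fiberwise fun ν => (h4 ν).hasSum.mul_right (e ν)⟩

end ExponentialSeries

namespace EvenLattice

variable {n : ℕ} {L : EvenLattice n}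

/-! ### Fourier expansions on the tube domain -/

section Tube

variable {A : Set (Fin (n + 2) → ℂ)} {c : Fin (n + 2) → ℤ} {c' : Fin (n + 2) → ℚ}

variable (L c c') in
/-- The space `L_{c,c'} ⊗ ℚ` as a subspace of `L ⊗ ℚ`. -/
def cuspSubmodule : Submodule ℚ (Fin (n + 2) → ℚ) where
  carrier := L.cuspSpace c c'
  zero_mem' := ⟨bil_zero_left _ _, bil_zero_left _ _⟩
  add_mem' := by
    rintro x y ⟨hx, hx'⟩ ⟨hy, hy'⟩
    exact ⟨by rw [bil_add_left, hx, hy, add_zero], by rw [bil_add_left, hx', hy', add_zero]⟩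
  smul_mem' := by
    rintro a x ⟨hx, hx'⟩
    exact ⟨by rw [bil_smul_left, hx, mul_zero], by rw [bil_smul_left, hx', mul_zero]⟩

instance : AddCommGroup (L.cuspSpace c c') := inferInstanceAs (AddCommGroup (L.cuspSubmodule c c'))

instance : Module ℚ (L.cuspSpace c c') := inferInstanceAs (Module ℚ (L.cuspSubmodule c c'))

theorem cuspSpace_coe_add (v w : L.cuspSpace c c') : (v + w).1 = v.1 + w.1 := rfl

theorem cuspSpace_coe_sub (v w : L.cuspSpace c c') : (v - w).1 = v.1 - w.1 := rfl

variable (L) in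
/-- The pairing of a rational and a complex vector. -/
noncomputable def ratBil (v : Fin (n + 2) → ℚ) (Z : Fin (n + 2) → ℂ) : ℂ :=
  L.bil ℂ (fun i => (v i : ℂ)) Z

theorem ratBil_add_left (v w : Fin (n + 2) → ℚ) (Z : Fin (n + 2) → ℂ) :
    L.ratBil (v + w) Z = L.ratBil v Z + L.ratBil w Z := by
  have : (fun i => (((v + w) i : ℚ) : ℂ)) = (fun i => (v i : ℂ)) + fun i => (w i : ℂ) := by
    funext i; simp
  rw [ratBil, ratBil, ratBil, this, bil_add_left]

theorem ratBil_add_smul (v : Fin (n + 2) → ℚ) (Z E : Fin (n + 2) → ℂ) (t : ℂ) :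
    L.ratBil v (Z + t • E) = L.ratBil v Z + t * L.ratBil v E := by
  rw [ratBil, bil_add_right, bil_smul_right]; rfl

theorem ratBil_toComplex (v : Fin (n + 2) → ℚ) (w : Fin (n + 2) → ℝ) :
    L.ratBil v (toComplex w) = (L.bil ℝ (fun i => (v i : ℝ)) w : ℂ) := by
  rw [← bil_toComplex, ratBil]
  congr 1

variable (L) in
/-- The exponential `e^{2πi⟨v, Z⟩}`. -/
noncomputable def cuspExp (v : Fin (n + 2) → ℚ) (Z : Fin (n + 2) → ℂ) : ℂ :=
  Complex.exp (2 * Real.pi * Complex.I * L.ratBil v Z)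

theorem cuspExp_ne_zero (v : Fin (n + 2) → ℚ) (Z : Fin (n + 2) → ℂ) : L.cuspExp v Z ≠ 0 :=
  Complex.exp_ne_zero _

theorem cuspExp_add_left (v w : Fin (n + 2) → ℚ) (Z : Fin (n + 2) → ℂ) :
    L.cuspExp (v + w) Z = L.cuspExp v Z * L.cuspExp w Z := by
  rw [cuspExp, cuspExp, cuspExp, ← Complex.exp_add, ratBil_add_left, mul_add]

theorem norm_cuspExp (v : Fin (n + 2) → ℚ) (Z : Fin (n + 2) → ℂ) :
    ‖L.cuspExp v Z‖ = Real.exp (-(2 * Real.pi * (L.ratBil v Z).im)) := by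
  rw [cuspExp, Complex.norm_exp]
  congr 1
  simp

theorem bil_tubeMap_self (hc : L.IsCuspPair c c') {Z : Fin (n + 2) → ℂ}
    (hZ : L.bil ℂ Z (fun i => (c i : ℂ)) = 0) (hZ' : L.bil ℂ Z (fun i => (c' i : ℂ)) = 0) :
    L.bil ℂ (L.tubeMap c c' Z) (L.tubeMap c c' Z) = 0 := by
  rw [← hc.coneProj_add hZ hZ']
  refine L.bil_coneProj_self (hc.isotropic_cast ℂ) ?_
  rw [bil_add_left, hZ, add_zero, bil_comm, hc.pairing_cast]
  exact one_ne_zero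

theorem bil_tubeMap_star (hc : L.IsCuspPair c c') {Z : Fin (n + 2) → ℂ}
    (hZ : L.bil ℂ Z (fun i => (c i : ℂ)) = 0) (hZ' : L.bil ℂ Z (fun i => (c' i : ℂ)) = 0) :
    (L.bil ℂ (L.tubeMap c c' Z) (star (L.tubeMap c c' Z))).re =
      2 * L.bil ℝ (imVec Z) (imVec Z) := by
  set C : Fin (n + 2) → ℂ := fun i => (c i : ℂ) with hC
  set C' : Fin (n + 2) → ℂ := fun i => (c' i : ℂ) with hC'
  set s : ℂ := L.quad ℂ Z + (L.quad ℚ c' : ℚ) with hs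
  have hsC : star C = C := by funext i; simp [hC]
  have hsC' : star C' = C' := by funext i; simp [hC']
  have e1 : L.tubeMap c c' Z = C' + Z - s • C := rfl
  have e2 : star (L.tubeMap c c' Z) = C' + star Z - star s • C := by
    rw [e1, star_sub, star_add, star_smul, hsC, hsC']
  have h1 : L.bil ℂ C C = 0 := hc.isotropic_cast ℂ
  have h2 : L.bil ℂ C C' = 1 := hc.pairing_cast ℂ
  have h2' : L.bil ℂ C' C = 1 := by rw [bil_comm, h2]
  have h3 : L.bil ℂ (star Z) C = 0 := by rw [← hsC, bil_star, hZ, star_zero]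
  have h4 : L.bil ℂ (star Z) C' = 0 := by rw [← hsC', bil_star, hZ', star_zero]
  have h3' : L.bil ℂ C (star Z) = 0 := by rw [bil_comm, h3]
  have h4' : L.bil ℂ C' (star Z) = 0 := by rw [bil_comm, h4]
  have h5 : L.bil ℂ C' C' = 2 * ((L.quad ℚ c' : ℚ) : ℂ) := by
    rw [hC', bil_ratCast, quad]; push_cast; ring
  have h6 : L.bil ℂ (L.tubeMap c c' Z) (star (L.tubeMap c c' Z)) =
      L.bil ℂ C' C' + L.bil ℂ Z (star Z) - s - star s := by
    rw [e2, e1]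
    simp only [bil_sub_left, bil_sub_right, bil_add_left, bil_add_right, bil_smul_left,
      bil_smul_right, h1, h2, h2', hZ, hZ', h3', h4']
    ring
  have h7 : s.re = (L.bil ℝ (reVec Z) (reVec Z) - L.bil ℝ (imVec Z) (imVec Z)) / 2 +
      ((L.quad ℚ c' : ℚ) : ℝ) := by
    rw [hs, quad, Complex.add_re, ← bil_self_re]
    simp
  rw [h6, h5, bil_star_self]
  have h8 : (star s).re = s.re := Complex.conj_re s
  simp only [Complex.sub_re, Complex.add_re, h8, h7, Complex.ofReal_re, Complex.mul_re,
    Complex.re_ofNat, Complex.im_ofNat, Complex.ratCast_re, Complex.ratCast_im]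
  ring

/-- Up to scaling, every point of the cone lies in the image of the tube domain. -/
theorem exists_mem_tubeDomain (hA : L.IsDomainCone A) (hc : L.IsCuspPair c c')
    {z : Fin (n + 2) → ℂ} (hz : z ∈ A) :
    ∃ Z ∈ L.tubeDomain c c' A, ∃ t : ℂ, t ≠ 0 ∧ L.tubeMap c c' Z = t • z := by
  set C : Fin (n + 2) → ℂ := fun i => (c i : ℂ) with hC
  set C' : Fin (n + 2) → ℂ := fun i => (c' i : ℂ) with hC'
  have h1 : L.bil ℂ C C = 0 := hc.isotropic_cast ℂ
  have h2 : L.bil ℂ C C' = 1 := hc.pairing_cast ℂ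
  have h0 := hc.bil_ne_zero hA z hz
  set t := (L.bil ℂ z C)⁻¹ with ht
  have ht0 : t ≠ 0 := inv_ne_zero h0
  set x := t • z with hx
  have hxC : L.bil ℂ x C = 1 := by rw [hx, bil_smul_left, ht, inv_mul_cancel₀ h0]
  have hxA : x ∈ A := hA.smul_mem ht0 hz
  set Z := L.cuspProj C C' x with hZ
  have hZC : L.bil ℂ Z C = 0 := bil_cuspProj_isotropic h1 h2 x
  have hZC' : L.bil ℂ Z C' = 0 := bil_cuspProj_dual h2 x
  have key : L.tubeMap c c' Z = x := by
    set s := L.bil ℂ x C' - L.bil ℂ x C * L.bil ℂ C' C' with hs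
    have e1 : C' + Z = x + (-s) • C := by
      rw [hZ, cuspProj, hxC, one_smul, neg_smul, hs, hxC]
      abel
    rw [← hc.coneProj_add hZC hZC', e1, coneProj_add_smul h1 (by rw [hxC]; exact one_ne_zero),
      L.coneProj_of_isotropic (hA.bil_self hxA)]
  exact ⟨Z, ⟨hZC, hZC', by rwa [key]⟩, t, ht0, key⟩

theorem eventually_add_smul_mem_tubeDomain (hA : L.IsDomainCone A) (hc : L.IsCuspPair c c')
    {Z E : Fin (n + 2) → ℂ} (hZ : Z ∈ L.tubeDomain c c' A)
    (hE : L.bil ℂ E (fun i => (c i : ℂ)) = 0) (hE' : L.bil ℂ E (fun i => (c' i : ℂ)) = 0) :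
    ∀ᶠ t : ℂ in nhds 0, Z + t • E ∈ L.tubeDomain c c' A := by
  have hmem : ∀ t : ℂ, L.bil ℂ (Z + t • E) (fun i => (c i : ℂ)) = 0 ∧
      L.bil ℂ (Z + t • E) (fun i => (c' i : ℂ)) = 0 := fun t => by
    simp [bil_add_left, bil_smul_left, hZ.1, hZ.2.1, hE, hE']
  have hcont : Continuous fun t : ℂ => L.tubeMap c c' (Z + t • E) := by
    have : Continuous fun t : ℂ => L.bil ℂ (Z + t • E) (Z + t • E) :=
      L.continuous_bil.comp (f := fun t : ℂ => (Z + t • E, Z + t • E)) (by fun_prop)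
    unfold tubeMap quad
    fun_prop
  have hev : ∀ᶠ x in nhds (L.tubeMap c c' (Z + (0 : ℂ) • E)), L.bil ℂ x x = 0 → x ∈ A :=
    hA.eventually_mem (by simpa using hZ.2.2)
  filter_upwards [hcont.continuousAt.eventually hev] with t ht
  exact ⟨(hmem t).1, (hmem t).2, ht (bil_tubeMap_self hc (hmem t).1 (hmem t).2)⟩

/-- The tube domain is invariant under real translations. -/
theorem add_toComplex_mem_tubeDomain (hA : L.IsDomainCone A) (hc : L.IsCuspPair c c')
    {Z : Fin (n + 2) → ℂ} (hZ : Z ∈ L.tubeDomain c c' A) {w : Fin (n + 2) → ℝ}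
    (hw : L.bil ℂ (toComplex w) (fun i => (c i : ℂ)) = 0)
    (hw' : L.bil ℂ (toComplex w) (fun i => (c' i : ℂ)) = 0) :
    Z + toComplex w ∈ L.tubeDomain c c' A := by
  have hmem : ∀ t : ℝ, L.bil ℂ (Z + (t : ℂ) • toComplex w) (fun i => (c i : ℂ)) = 0 ∧
      L.bil ℂ (Z + (t : ℂ) • toComplex w) (fun i => (c' i : ℂ)) = 0 := fun t => by
    rw [bil_add_left, bil_add_left, bil_smul_left, bil_smul_left, hZ.1, hZ.2.1, hw, hw']
    simp
  have him : ∀ t : ℝ, imVec (Z + (t : ℂ) • toComplex w) = imVec Z := fun t => by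
    funext i; simp [imVec, toComplex]
  have hcont : Continuous fun t : ℝ => L.tubeMap c c' (Z + (t : ℂ) • toComplex w) := by
    have : Continuous fun t : ℝ =>
        L.bil ℂ (Z + (t : ℂ) • toComplex w) (Z + (t : ℂ) • toComplex w) :=
      L.continuous_bil.comp
        (f := fun t : ℝ => (Z + (t : ℂ) • toComplex w, Z + (t : ℂ) • toComplex w)) (by fun_prop)
    unfold tubeMap quad
    fun_prop
  have hneg := (hA.subset_negCone hZ.2.2).2
  rw [bil_tubeMap_star hc hZ.1 hZ.2.1] at hneg
  have hsub := hA.subset_of_isPreconnected (isPreconnected_range hcont) (by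
    rintro _ ⟨t, rfl⟩
    refine ⟨bil_tubeMap_self hc (hmem t).1 (hmem t).2, ?_⟩
    rw [bil_tubeMap_star hc (hmem t).1 (hmem t).2, him]
    exact hneg) (z := L.tubeMap c c' Z) ⟨0, by simp⟩ hZ.2.2
  have h1 := hmem 1
  rw [Complex.ofReal_one, one_smul] at h1
  exact ⟨h1.1, h1.2, hsub ⟨1, by simp⟩⟩

variable (L A c c') in
/-- The function `f` on the tube domain has the Fourier coefficients `a`, with absolute
convergence. -/
def IsTubeExpansion (f : (Fin (n + 2) → ℂ) → ℂ) (a : L.cuspSpace c c' → ℂ) : Prop :=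
  ∀ Z ∈ L.tubeDomain c c' A, HasSum (fun v => a v * L.cuspExp v.1 Z) (f Z)

namespace IsTubeExpansion

variable {f g : (Fin (n + 2) → ℂ) → ℂ} {a b : L.cuspSpace c c' → ℂ}

theorem add (hf : L.IsTubeExpansion A c c' f a) (hg : L.IsTubeExpansion A c c' g b) :
    L.IsTubeExpansion A c c' (f + g) (a + b) := fun Z hZ =>
  ((hf Z hZ).add (hg Z hZ)).congr_fun fun v => add_mul (a v) (b v) _

theorem const_mul (s : ℂ) (hf : L.IsTubeExpansion A c c' f a) :
    L.IsTubeExpansion A c c' (fun Z => s * f Z) (fun v => s * a v) := fun Z hZ =>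
  ((hf Z hZ).mul_left s).congr_fun fun v => mul_assoc s (a v) _

theorem congr (hf : L.IsTubeExpansion A c c' f a) (h : ∀ Z ∈ L.tubeDomain c c' A, f Z = g Z) :
    L.IsTubeExpansion A c c' g a := fun Z hZ => by
  rw [← h Z hZ]
  exact hf Z hZ

theorem mul (hf : L.IsTubeExpansion A c c' f a) (hg : L.IsTubeExpansion A c c' g b) :
    L.IsTubeExpansion A c c' (f * g) (fun ν => ∑' v, a v * b (ν - v)) := fun Z hZ =>
  (HasSum.convolution (e := fun v : L.cuspSpace c c' => L.cuspExp v.1 Z)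
    (fun v w => cuspExp_add_left v.1 w.1 Z) (fun v => cuspExp_ne_zero v.1 Z) (hf Z hZ)
    (hg Z hZ)).2

theorem lineDeriv_toComplex (hA : L.IsDomainCone A) (hc : L.IsCuspPair c c')
    (hf : L.IsTubeExpansion A c c' f a) {w : Fin (n + 2) → ℝ}
    (hw : L.bil ℂ (toComplex w) (fun i => (c i : ℂ)) = 0)
    (hw' : L.bil ℂ (toComplex w) (fun i => (c' i : ℂ)) = 0) :
    L.IsTubeExpansion A c c' (fun Y => lineDeriv ℂ f Y (toComplex w))
      (fun v => a v * (2 * Real.pi * Complex.I * L.ratBil v.1 (toComplex w))) := by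
  intro Z hZ
  obtain ⟨ε, hε, hball⟩ := Metric.eventually_nhds_iff_ball.1
    (eventually_add_smul_mem_tubeDomain hA hc hZ hw hw')
  have := hasSum_deriv_exp (a := fun v : L.cuspSpace c c' => a v * L.cuspExp v.1 Z)
    (r := fun v => 2 * Real.pi * L.bil ℝ (fun i => (v.1 i : ℝ)) w)
    (g := fun t => f (Z + t • toComplex w)) hε (fun t ht => by
      refine (hf _ (hball t ht)).congr_fun fun v => ?_
      rw [cuspExp, cuspExp, ratBil_add_smul, mul_assoc, ← Complex.exp_add, ratBil_toComplex]
      congr 2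
      push_cast
      ring)
  refine this.congr_fun fun v => ?_
  simp only [ratBil_toComplex]
  push_cast
  ring

theorem laplacian (hA : L.IsDomainCone A) (hc : L.IsCuspPair c c')
    (hf : L.IsTubeExpansion A c c' f a) {m : ℕ}
    (e : Module.Basis (Fin m) ℤ (L.cuspLattice c c')) :
    L.IsTubeExpansion A c c' (L.laplacian e f) (fun v => -(L.quad ℚ v.1 : ℚ) * a v) := by
  have hcast : ∀ i, (fun l => ((e i).1 l : ℂ)) = toComplex fun l => ((e i).1 l : ℝ) := fun i => by
    funext l; simp [toComplex]
  have hE : ∀ i, L.bil ℂ (toComplex fun l => ((e i).1 l : ℝ)) (fun i => (c i : ℂ)) = 0 :=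
    fun i => by rw [← hcast]; exact IsCuspPair.bil_lattice_isotropic ℂ (e i)
  have hE' : ∀ i, L.bil ℂ (toComplex fun l => ((e i).1 l : ℝ)) (fun i => (c' i : ℂ)) = 0 :=
    fun i => by rw [← hcast]; exact IsCuspPair.bil_lattice_dual ℂ (e i)
  intro Z hZ
  have h1 : ∀ i j, HasSum (fun v : L.cuspSpace c c' => a v *
      (2 * Real.pi * Complex.I * L.ratBil v.1 (fun l => ((e j).1 l : ℂ))) *
      (2 * Real.pi * Complex.I * L.ratBil v.1 (fun l => ((e i).1 l : ℂ))) * L.cuspExp v.1 Z)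
      (lineDeriv ℂ (fun Y => lineDeriv ℂ f Y (fun l => ((e j).1 l : ℂ))) Z
        (fun l => ((e i).1 l : ℂ))) := by
    intro i j
    rw [hcast, hcast]
    exact (hf.lineDeriv_toComplex hA hc (hE j) (hE' j)).lineDeriv_toComplex hA hc (hE i) (hE' i) Z hZ
  have h2 := (hasSum_sum (s := Finset.univ) fun i _ => hasSum_sum (s := Finset.univ) fun j _ =>
    (h1 i j).mul_left ((IsCuspPair.cuspGram e)⁻¹ i j)).mul_left (1 / (8 * (Real.pi : ℂ) ^ 2))
  refine h2.congr_fun fun v => ?_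
  have hv : L.bil ℂ (fun i => (v.1 i : ℂ)) (fun i => (c i : ℂ)) = 0 := by
    have := bil_ratCast (L := L) (K := ℂ) v.1 (fun i => (c i : ℚ))
    rw [v.2.1] at this
    simpa using this
  have hv' : L.bil ℂ (fun i => (v.1 i : ℂ)) (fun i => (c' i : ℂ)) = 0 := by
    rw [bil_ratCast, v.2.2, Rat.cast_zero]
  have h3 := congrArg (L.bil ℂ (fun i => (v.1 i : ℂ)))
    (hc.sum_inv_gram_smul hA.det_gram_ne_zero e hv hv')
  simp only [bil_sum_right, bil_smul_right] at h3
  have h4 : L.bil ℂ (fun i => (v.1 i : ℂ)) (fun i => (v.1 i : ℂ)) =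
      2 * ((L.quad ℚ v.1 : ℚ) : ℂ) := by
    rw [bil_ratCast, quad]; push_cast; ring
  rw [h4] at h3
  have hπ : (Real.pi : ℂ) ≠ 0 := Complex.ofReal_ne_zero.2 Real.pi_ne_zero
  have h5 : ∑ i, ∑ j, (IsCuspPair.cuspGram e)⁻¹ i j * (a v *
      (2 * Real.pi * Complex.I * L.ratBil v.1 (fun l => ((e j).1 l : ℂ))) *
      (2 * Real.pi * Complex.I * L.ratBil v.1 (fun l => ((e i).1 l : ℂ))) * L.cuspExp v.1 Z) =
      (a v * L.cuspExp v.1 Z * (2 * Real.pi * Complex.I) ^ 2) * (2 * ((L.quad ℚ v.1 : ℚ) : ℂ)) := by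
    rw [← h3, Finset.mul_sum]
    refine Finset.sum_congr rfl fun i _ => ?_
    rw [Finset.mul_sum]
    refine Finset.sum_congr rfl fun j _ => ?_
    rw [ratBil, ratBil]
    ring
  rw [h5, mul_pow, Complex.I_sq]
  field_simp
  ring

/-- Fourier coefficients are unique.  The expansion is restricted to a real line on which distinct
vectors have distinct frequencies modulo the integers; such a line is found with the powers of a
transcendental number. -/
theorem unique (hA : L.IsDomainCone A) (hc : L.IsCuspPair c c')
    (hf : L.IsTubeExpansion A c c' f a) (hg : L.IsTubeExpansion A c c' f b) : a = b := by
  obtain ⟨z, hz⟩ := hA.nonempty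
  obtain ⟨Z, hZ, -⟩ := exists_mem_tubeDomain hA hc hz
  set τ := liouvilleNumber 2 with hτ
  have htr : Transcendental ℚ τ := fun h =>
    transcendental_liouvilleNumber (m := 2) le_rfl ((IsFractionRing.isAlgebraic_iff ℤ ℚ ℝ).2 h)
  set w₀ : Fin (n + 2) → ℝ := fun i => τ ^ (i.1 + 1) with hw₀
  set w := L.cuspProj (fun i => (c i : ℝ)) (fun i => (c' i : ℝ)) w₀ with hw
  have hwc : L.bil ℂ (toComplex w) (fun i => (c i : ℂ)) = 0 := by
    have : (fun i => (c i : ℂ)) = toComplex fun i => (c i : ℝ) := by funext i; simp [toComplex]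
    rw [this, bil_toComplex, bil_cuspProj_isotropic (hc.isotropic_cast ℝ) (hc.pairing_cast ℝ),
      Complex.ofReal_zero]
  have hwc' : L.bil ℂ (toComplex w) (fun i => (c' i : ℂ)) = 0 := by
    have : (fun i => (c' i : ℂ)) = toComplex fun i => (c' i : ℝ) := by funext i; simp [toComplex]
    rw [this, bil_toComplex, bil_cuspProj_dual (hc.pairing_cast ℝ), Complex.ofReal_zero]
  have hvw : ∀ v : L.cuspSpace c c',
      L.bil ℝ (fun i => (v.1 i : ℝ)) w = L.bil ℝ (fun i => (v.1 i : ℝ)) w₀ := by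
    intro v
    rw [bil_comm, hw, bil_cuspProj_of_orthogonal, bil_comm]
    · have := bil_ratCast (L := L) (K := ℝ) v.1 (fun i => (c i : ℚ))
      rw [v.2.1] at this
      simpa using this
    · rw [bil_ratCast, v.2.2, Rat.cast_zero]
  -- only the zero vector has an integral frequency
  have hint : ∀ (v : L.cuspSpace c c') (m : ℤ), L.bil ℝ (fun i => (v.1 i : ℝ)) w = m → v = 0 := by
    intro v m hm
    rw [hvw] at hm
    set q : Fin (n + 2) → ℚ := fun j => L.bil ℚ (Pi.single j 1) v.1 with hq
    have hsum : L.bil ℝ (fun i => (v.1 i : ℝ)) w₀ = ∑ j, (q j : ℝ) * τ ^ (j.1 + 1) := by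
      rw [bil_comm, bil_eq_sum]
      refine Finset.sum_congr rfl fun j _ => ?_
      have hqj : q j = ∑ i, (L.gram j i : ℚ) * v.1 i := by
        rw [hq]
        change Pi.single j 1 ⬝ᵥ _ = _
        rw [single_one_dotProduct]
        rfl
      rw [hqj]
      push_cast
      rw [Finset.sum_mul]
      refine Finset.sum_congr rfl fun i _ => ?_
      rw [hw₀]
      ring
    set P : Polynomial ℚ := ∑ j, Polynomial.C (q j) * Polynomial.X ^ (j.1 + 1) -
      Polynomial.C (m : ℚ) with hP
    have hPτ : Polynomial.aeval τ P = 0 := by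
      rw [hP, map_sub, map_sum]
      simp only [map_mul, Polynomial.aeval_C, map_pow, Polynomial.aeval_X]
      rw [sub_eq_zero]
      refine (hsum.symm.trans hm).trans ?_
      simp
    have hP0 : P = 0 := by
      by_contra hP0
      exact htr ⟨P, hP0, hPτ⟩
    have hq0 : ∀ j, q j = 0 := by
      intro j
      have := congrArg (fun R => Polynomial.coeff R (j.1 + 1)) hP0
      simp only [hP, Polynomial.coeff_sub, Polynomial.finsetSum_coeff, Polynomial.coeff_C_mul,
        Polynomial.coeff_X_pow, Polynomial.coeff_C_succ, Polynomial.coeff_zero, sub_zero] at this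
      simpa [Fin.val_inj] using this
    apply Subtype.ext
    refine eq_zero_of_forall_bil_eq_zero hA.det_gram_ne_zero fun y => ?_
    rw [← Finset.univ_sum_single y, bil_comm, bil_sum_right]
    refine Finset.sum_eq_zero fun i _ => ?_
    rw [show (Pi.single i (y i) : Fin (n + 2) → ℚ) = y i • Pi.single i 1 by
      rw [← Pi.single_smul, smul_eq_mul, mul_one], bil_smul_right, bil_comm]
    exact mul_eq_zero_of_right _ (hq0 i)
  have key := eq_zero_of_hasSum_mul_pow (b := fun v => (a v - b v) * L.cuspExp v.1 Z)
    (χ := fun v : L.cuspSpace c c' => L.cuspExp v.1 (toComplex w)) (fun v => by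
      rw [norm_cuspExp, ratBil_toComplex]; simp) (by
      intro v v' hvv
      obtain ⟨m, hm⟩ := Complex.exp_eq_exp_iff_exists_int.1 hvv
      have h2 : L.ratBil v.1 (toComplex w) = L.ratBil v'.1 (toComplex w) + m := by
        have hne : (2 * Real.pi * Complex.I : ℂ) ≠ 0 := Complex.two_pi_I_ne_zero
        apply mul_left_cancel₀ hne
        rw [hm]
        ring
      rw [ratBil_toComplex, ratBil_toComplex] at h2
      have h3 : L.bil ℝ (fun i => (v.1 i : ℝ)) w = L.bil ℝ (fun i => (v'.1 i : ℝ)) w + m := by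
        exact_mod_cast h2
      refine sub_eq_zero.1 (hint (v - v') m ?_)
      have h4 : (fun i => (((v - v').1 i : ℚ) : ℝ)) =
          (fun i => (v.1 i : ℝ)) - fun i => (v'.1 i : ℝ) := by
        funext i; simp [cuspSpace_coe_sub]
      rw [h4, bil_sub_left, h3, add_sub_cancel_left]) (by
      intro t
      have hZt : Z + toComplex ((t : ℝ) • w) ∈ L.tubeDomain c c' A := by
        have e1 : toComplex ((t : ℝ) • w) = (t : ℂ) • toComplex w := by
          funext i; simp [toComplex]
        refine add_toComplex_mem_tubeDomain hA hc hZ ?_ ?_ <;>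
          rw [e1, bil_smul_left] <;> simp [hwc, hwc']
      have h1 := (hf _ hZt).sub (hg _ hZt)
      rw [sub_self] at h1
      refine h1.congr_fun fun v => ?_
      have e1 : toComplex ((t : ℝ) • w) = (t : ℂ) • toComplex w := by
        funext i; simp [toComplex]
      rw [← sub_mul, mul_assoc]
      congr 1
      rw [e1, cuspExp, cuspExp, cuspExp, ratBil_add_smul, mul_add, Complex.exp_add,
        ← Complex.exp_nat_mul]
      congr 2
      ring)
  funext v
  have := congrFun key v
  exact sub_eq_zero.1 ((mul_eq_zero.1 this).resolve_right (cuspExp_ne_zero _ _))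

/-- If the coefficients are integers, then the support is finite below every height. -/
theorem finite_sublevel {a : L.cuspSpace c c' → ℤ}
    (hf : L.IsTubeExpansion A c c' f fun v => (a v : ℂ)) {Z : Fin (n + 2) → ℂ}
    (hZ : Z ∈ L.tubeDomain c c' A) (C : ℝ) :
    {v : L.cuspSpace c c' | a v ≠ 0 ∧ (L.ratBil v.1 Z).im ≤ C}.Finite := by
  have h1 := (hf Z hZ).summable.norm.tendsto_cofinite_zero
  have h2 := h1.eventually (gt_mem_nhds (Real.exp_pos (-(2 * Real.pi * C))))
  refine (Filter.eventually_cofinite.1 h2).subset ?_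
  rintro v ⟨hv, hvC⟩ hlt
  refine absurd hlt (not_lt.2 ?_)
  rw [norm_mul, norm_cuspExp]
  have h3 : (1 : ℝ) ≤ ‖(a v : ℂ)‖ := by
    rw [Complex.norm_intCast]
    exact_mod_cast Int.one_le_abs hv
  have h4 : Real.exp (-(2 * Real.pi * C)) ≤ Real.exp (-(2 * Real.pi * (L.ratBil v.1 Z).im)) := by
    rw [Real.exp_le_exp]
    have := Real.pi_pos
    gcongr
  calc Real.exp (-(2 * Real.pi * C)) ≤ 1 * Real.exp (-(2 * Real.pi * (L.ratBil v.1 Z).im)) := by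
        rwa [one_mul]
    _ ≤ _ := by gcongr

end IsTubeExpansion

theorem IsFourierExpansion.fourierCoeff_eq (hA : L.IsDomainCone A) (hc : L.IsCuspPair c c')
    {F : (Fin (n + 2) → ℂ) → ℂ} {a : L.cuspSpace c c' → ℂ}
    (h : L.IsFourierExpansion c c' A F a) : L.fourierCoeff c c' A F = a := by
  have hex : ∃ a, L.IsFourierExpansion c c' A F a := ⟨a, h⟩
  rw [fourierCoeff, dif_pos hex]
  exact IsTubeExpansion.unique (f := L.onTube c c' F) hA hc hex.choose_spec h

end Tube

end EvenLattice

/-! ### Convolutions modulo a prime -/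

section Padic

variable {p : ℕ} [hp : Fact p.Prime]

theorem primeDvd_iff_padicNorm_lt_one (q : ℚ) : PrimeDvd p q ↔ padicNorm p q < 1 := by
  have hq : padicNorm p q = padicNorm p (q.num : ℚ) / padicNorm p ((q.den : ℤ) : ℚ) := by
    rw [← padicNorm.div]
    congr 1
    exact_mod_cast (Rat.num_div_den q).symm
  have hden0 : (0 : ℚ) < padicNorm p ((q.den : ℤ) : ℚ) :=
    lt_of_le_of_ne (padicNorm.nonneg _) (Ne.symm (padicNorm.nonzero (by
      exact_mod_cast q.den_ne_zero)))
  rw [PrimeDvd, hq, div_lt_one hden0]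
  constructor
  · intro h
    have h1 : padicNorm p ((q.den : ℤ) : ℚ) = 1 := by
      rw [padicNorm.int_eq_one_iff]
      intro hd
      have h2 : p ∣ q.num.natAbs := Int.natCast_dvd.1 h
      have h3 : p ∣ q.den := Int.natCast_dvd_natCast.1 hd
      have := Nat.dvd_gcd h2 h3
      rw [q.reduced.gcd_eq_one] at this
      exact hp.out.one_lt.ne' (Nat.dvd_one.1 this)
    rw [h1]
    exact (padicNorm.int_lt_one_iff _).2 h
  · intro h
    exact (padicNorm.int_lt_one_iff _).1 (h.trans_le (padicNorm.of_int _))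

theorem padicNorm_mul_lt_one {x y : ℚ} (hx : padicNorm p x < 1) (hy : padicNorm p y ≤ 1) :
    padicNorm p (x * y) < 1 := by
  rw [padicNorm.mul]
  exact (mul_le_of_le_one_right (padicNorm.nonneg _) hy).trans_lt hx

theorem padicNorm_mul_le_one {x y : ℚ} (hx : padicNorm p x ≤ 1) (hy : padicNorm p y ≤ 1) :
    padicNorm p (x * y) ≤ 1 := by
  rw [padicNorm.mul]
  exact mul_le_one₀ hx (padicNorm.nonneg _) hy

theorem padicNorm_add_lt_one {x y : ℚ} (hx : padicNorm p x < 1) (hy : padicNorm p y < 1) :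
    padicNorm p (x + y) < 1 :=
  padicNorm.nonarchimedean.trans_lt (max_lt hx hy)

/-- The elements of minimal height in a set which is finite below every height. -/
theorem exists_finset_of_minimal {M : Type*} (h : M → ℝ) {S : Set M} (hS : S.Nonempty)
    (hfin : ∀ C : ℝ, {v ∈ S | h v ≤ C}.Finite) :
    ∃ (A : Finset M) (m : ℝ), A.Nonempty ∧ (∀ v ∈ A, h v = m ∧ v ∈ S) ∧
      ∀ v ∈ S, m ≤ h v ∧ (h v = m → v ∈ A) := by
  classical
  obtain ⟨v₁, hv₁⟩ := hS
  obtain ⟨v₀, hv₀, hmin⟩ := (hfin (h v₁)).toFinset.exists_min_image h ⟨v₁, by simpa using hv₁⟩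
  have hv₀' : v₀ ∈ S ∧ h v₀ ≤ h v₁ := by simpa using hv₀
  refine ⟨(hfin (h v₀)).toFinset.filter fun v => h v = h v₀, h v₀, ⟨v₀, by simpa using hv₀'.1⟩,
    fun v hv => ?_, fun v hv => ⟨?_, fun heq => ?_⟩⟩
  · simp only [Finset.mem_filter, Set.Finite.mem_toFinset] at hv
    exact ⟨hv.2, hv.1.1⟩
  · rcases le_total (h v) (h v₁) with hle | hle
    · exact hmin v (by simpa using ⟨hv, hle⟩)
    · exact hv₀'.2.trans hle
  · simpa [heq] using hv

variable {M : Type*} [AddCommGroup M] [UniqueSums M]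

/-- Gauss' lemma for formal series: if the product of `X` and `b` vanishes modulo `p` and `b` does
not, then `X` does.  Among the terms of minimal height that do not vanish modulo `p` there are two
whose sum is attained only once. -/
theorem padicNorm_lt_one_of_convolution (h : M →+ ℝ) {X : M → ℚ} {b : M → ℤ}
    (hX : ∀ v, padicNorm p (X v) ≤ 1) (hXfin : ∀ C : ℝ, {v | X v ≠ 0 ∧ h v ≤ C}.Finite)
    (hbfin : ∀ C : ℝ, {v | b v ≠ 0 ∧ h v ≤ C}.Finite) (hb : ∃ v, ¬ (p : ℤ) ∣ b v)
    (s : M → Finset M) (hs : ∀ ν v, X v * b (ν - v) ≠ 0 → v ∈ s ν)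
    (hconv : ∀ ν, padicNorm p (∑ v ∈ s ν, X v * b (ν - v)) < 1) (v : M) :
    padicNorm p (X v) < 1 := by
  classical
  by_contra hv
  have hX0 : ∀ v, ¬ padicNorm p (X v) < 1 → X v ≠ 0 := fun v hv h0 => hv (by simp [h0])
  have hb0 : ∀ v, ¬ (p : ℤ) ∣ b v → b v ≠ 0 := fun v hv h0 => hv (by simp [h0])
  obtain ⟨B₁, m₁, hne₁, hB₁, hm₁⟩ := exists_finset_of_minimal h
    (S := {v | ¬ padicNorm p (X v) < 1}) ⟨v, hv⟩
    fun C => (hXfin C).subset fun v hv => ⟨hX0 v hv.1, hv.2⟩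
  obtain ⟨B₂, m₂, hne₂, hB₂, hm₂⟩ := exists_finset_of_minimal h
    (S := {v | ¬ (p : ℤ) ∣ b v}) hb fun C => (hbfin C).subset fun v hv => ⟨hb0 v hv.1, hv.2⟩
  obtain ⟨x, hx, y, hy, hxy⟩ := UniqueSums.uniqueAdd_of_nonempty hne₁ hne₂
  have hxX := (hB₁ x hx).2
  have hyb := (hB₂ y hy).2
  have hyν : x + y - x = y := add_sub_cancel_left x y
  have hxs : x ∈ s (x + y) := hs _ _ (by
    rw [hyν]
    exact mul_ne_zero (hX0 x hxX) (Int.cast_ne_zero.2 (hb0 y hyb)))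
  have hrest : padicNorm p (∑ v ∈ (s (x + y)).erase x, X v * b (x + y - v)) < 1 := by
    refine padicNorm.sum_lt' (fun v hv => ?_) one_pos
    by_contra hcon
    have hvX : ¬ padicNorm p (X v) < 1 := fun hlt =>
      hcon (padicNorm_mul_lt_one hlt (padicNorm.of_int _))
    have hvb : ¬ (p : ℤ) ∣ b (x + y - v) := fun hd => hcon (by
      rw [mul_comm]
      exact padicNorm_mul_lt_one ((padicNorm.int_lt_one_iff _).2 hd) (hX v))
    have h1 := (hm₁ v hvX).1
    have h2 := (hm₂ _ hvb).1
    have h3 : h v + h (x + y - v) = m₁ + m₂ := by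
      rw [← map_add, add_sub_cancel, map_add, (hB₁ x hx).1, (hB₂ y hy).1]
    exact (Finset.mem_erase.1 hv).1 (hxy ((hm₁ v hvX).2 (by linarith))
      ((hm₂ _ hvb).2 (by linarith)) (add_sub_cancel v (x + y))).1
  have hterm : padicNorm p (X x * b y) < 1 := by
    have h1 := Finset.add_sum_erase _ (fun v => X v * (b (x + y - v) : ℚ)) hxs
    simp only [hyν] at h1
    rw [eq_sub_of_add_eq h1, sub_eq_add_neg]
    exact padicNorm_add_lt_one (hconv _) (by rwa [padicNorm.neg])
  rw [padicNorm.mul, (padicNorm.int_eq_one_iff _).2 hyb, mul_one] at hterm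
  exact hxX hterm

theorem exists_eq_pow_mul_of_ne_zero {ι : Type*} {b : ι → ℤ} (hb : ∃ v, b v ≠ 0) :
    ∃ (m : ℕ) (b' : ι → ℤ), (∀ v, b v = (p : ℤ) ^ m * b' v) ∧ ∃ v, ¬ (p : ℤ) ∣ b' v := by
  classical
  obtain ⟨v₀, hv₀⟩ := hb
  have hex : ∃ m : ℕ, ∃ v, ¬ (p : ℤ) ^ (m + 1) ∣ b v := by
    have hfin : FiniteMultiplicity (p : ℤ) (b v₀) := by
      rw [Int.finiteMultiplicity_iff]
      exact ⟨by simpa using hp.out.one_lt.ne', hv₀⟩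
    obtain ⟨m, hm⟩ := hfin
    exact ⟨m, v₀, hm⟩
  have hdvd : ∀ v, (p : ℤ) ^ Nat.find hex ∣ b v := by
    intro v
    rcases hm : Nat.find hex with _ | m
    · simp
    · by_contra hcon
      exact Nat.find_min hex (m := m) (by omega) ⟨v, hcon⟩
  choose b' hb' using hdvd
  refine ⟨_, b', hb', ?_⟩
  obtain ⟨v, hv⟩ := Nat.find_spec hex
  refine ⟨v, fun ⟨q, hq⟩ => hv ⟨q, ?_⟩⟩
  rw [hb', hq]
  ring

/-- If `α` vanishes modulo `p`, then the relation between the coefficients reduces to the vanishing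
modulo `p` of the product of `∑ Q(v) a(v) e^v` and `∑ b(v) e^v`.  The common power of `p` in the `b(v)`
can be removed from the relation. -/
theorem padicNorm_mul_lt_one_of_relation (h : M →+ ℝ) {a b : M → ℤ} {Q : M → ℚ} {α β γ : ℚ}
    (hafin : ∀ C : ℝ, {v | a v ≠ 0 ∧ h v ≤ C}.Finite)
    (hbfin : ∀ C : ℝ, {v | b v ≠ 0 ∧ h v ≤ C}.Finite) (hb : ∃ v, b v ≠ 0)
    (s : M → Finset M) (hs : ∀ ν v, a v * b (ν - v) ≠ 0 → v ∈ s ν)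
    (hrel : ∀ ν, α * β * Q ν * ∑ v ∈ s ν, (a v * b (ν - v) : ℚ) =
      ∑ v ∈ s ν, (β * γ * Q v + α * γ * Q (ν - v)) * (a v * b (ν - v)))
    (hQa : ∀ v, a v ≠ 0 → padicNorm p (Q v) ≤ 1) (hQb : ∀ v, b v ≠ 0 → padicNorm p (Q v) ≤ 1)
    (hQc : ∀ ν, ∑ v ∈ s ν, (a v * b (ν - v) : ℚ) ≠ 0 → padicNorm p (Q ν) ≤ 1)
    (hα : padicNorm p α < 1) (hβ : padicNorm p β = 1) (hγ : padicNorm p γ = 1) (v : M) :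
    padicNorm p (Q v * a v) < 1 := by
  obtain ⟨m, b', hbb, hb'⟩ := exists_eq_pow_mul_of_ne_zero (p := p) hb
  have hpm : (p : ℚ) ^ m ≠ 0 := pow_ne_zero _ (Nat.cast_ne_zero.2 hp.out.ne_zero)
  have hpm' : (p : ℤ) ^ m ≠ 0 := pow_ne_zero _ (Int.natCast_ne_zero.2 hp.out.ne_zero)
  have hb0 : ∀ v, b v ≠ 0 ↔ b' v ≠ 0 := fun v => by simp [hbb, hp.out.ne_zero]
  have hbQ : ∀ v, (b v : ℚ) = (p : ℚ) ^ m * b' v := fun v => by rw [hbb]; push_cast; rfl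
  have hc : ∀ ν, ∑ v ∈ s ν, (a v * b (ν - v) : ℚ) =
      (p : ℚ) ^ m * ∑ v ∈ s ν, (a v * b' (ν - v) : ℚ) := fun ν => by
    rw [Finset.mul_sum]
    exact Finset.sum_congr rfl fun v _ => by rw [hbQ]; ring
  have hint : ∀ (a : M → ℤ) (b : M → ℤ) (t : Finset M) (ν : M),
      padicNorm p (∑ v ∈ t, (a v * b (ν - v) : ℚ)) ≤ 1 := by
    intro a b t ν
    have : ∑ v ∈ t, (a v * b (ν - v) : ℚ) = ((∑ v ∈ t, a v * b (ν - v) : ℤ) : ℚ) := by push_cast; rfl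
    rw [this]
    exact padicNorm.of_int _
  have hQa' : ∀ v, padicNorm p (Q v * a v) ≤ 1 := by
    intro v
    rcases eq_or_ne (a v) 0 with h0 | h0
    · simp [h0]
    · exact padicNorm_mul_le_one (hQa v h0) (padicNorm.of_int _)
  refine padicNorm_lt_one_of_convolution h (X := fun v => Q v * a v) (b := b') hQa'
    (fun C => (hafin C).subset fun v hv => ⟨fun h0 => hv.1 (by simp [h0]), hv.2⟩)
    (fun C => (hbfin C).subset fun v hv => ⟨(hb0 v).2 hv.1, hv.2⟩) hb' s (fun ν v hv => ?_)
    (fun ν => ?_) v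
  · refine hs ν v (mul_ne_zero (fun h0 => hv (by simp [h0])) ((hb0 _).2 fun h0 => hv (by simp [h0])))
  · have h1 : α * β * Q ν * ∑ v ∈ s ν, (a v * b' (ν - v) : ℚ) =
        β * γ * ∑ v ∈ s ν, Q v * a v * b' (ν - v) +
          α * γ * ∑ v ∈ s ν, (a v * (Q (ν - v) * b' (ν - v))) := by
      have h2 := hrel ν
      rw [hc] at h2
      apply mul_left_cancel₀ hpm
      calc (p : ℚ) ^ m * (α * β * Q ν * ∑ v ∈ s ν, (a v * b' (ν - v) : ℚ)) =
            α * β * Q ν * ((p : ℚ) ^ m * ∑ v ∈ s ν, (a v * b' (ν - v) : ℚ)) := by ring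
        _ = ∑ v ∈ s ν, (β * γ * Q v + α * γ * Q (ν - v)) * (a v * b (ν - v)) := h2
        _ = _ := by
          rw [Finset.mul_sum, Finset.mul_sum, ← Finset.sum_add_distrib, Finset.mul_sum]
          exact Finset.sum_congr rfl fun v _ => by rw [hbQ]; ring
    have hleft : padicNorm p (α * β * Q ν * ∑ v ∈ s ν, (a v * b' (ν - v) : ℚ)) < 1 := by
      rcases eq_or_ne (∑ v ∈ s ν, (a v * b' (ν - v) : ℚ)) 0 with h0 | h0
      · simp [h0]
      · rw [mul_assoc, mul_assoc]
        exact padicNorm_mul_lt_one hα (padicNorm_mul_le_one hβ.le (padicNorm_mul_le_one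
          (hQc ν (by rw [hc]; exact mul_ne_zero hpm h0)) (hint _ _ _ _)))
    have hright : padicNorm p (α * γ * ∑ v ∈ s ν, (a v * (Q (ν - v) * b' (ν - v)))) < 1 := by
      rw [mul_assoc]
      refine padicNorm_mul_lt_one hα (padicNorm_mul_le_one hγ.le ?_)
      refine padicNorm.sum_le' (fun v _ => padicNorm_mul_le_one (padicNorm.of_int _) ?_) zero_le_one
      rcases eq_or_ne (b' (ν - v)) 0 with h0 | h0
      · simp [h0]
      · exact padicNorm_mul_le_one (hQb _ ((hb0 _).2 h0)) (padicNorm.of_int _)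
    have h3 : padicNorm p (β * γ * ∑ v ∈ s ν, Q v * a v * b' (ν - v)) < 1 := by
      rw [eq_sub_of_add_eq h1.symm, sub_eq_add_neg]
      exact padicNorm_add_lt_one hleft (by rwa [padicNorm.neg])
    rwa [padicNorm.mul, padicNorm.mul, hβ, hγ, one_mul, one_mul] at h3

omit [UniqueSums M] in
/-- If `γ` vanishes modulo `p`, then so does the right-hand side of the relation. -/
theorem padicNorm_mul_sum_lt_one_of_relation {a b : M → ℤ} {Q : M → ℚ} {α β γ : ℚ} {s : Finset M}
    {ν : M} (hrel : α * β * Q ν * ∑ v ∈ s, (a v * b (ν - v) : ℚ) =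
      ∑ v ∈ s, (β * γ * Q v + α * γ * Q (ν - v)) * (a v * b (ν - v)))
    (hQa : ∀ v, a v ≠ 0 → padicNorm p (Q v) ≤ 1) (hQb : ∀ v, b v ≠ 0 → padicNorm p (Q v) ≤ 1)
    (hα : padicNorm p α = 1) (hβ : padicNorm p β = 1) (hγ : padicNorm p γ < 1) :
    padicNorm p (Q ν * ∑ v ∈ s, (a v * b (ν - v) : ℚ)) < 1 := by
  have h1 : padicNorm p (α * β * Q ν * ∑ v ∈ s, (a v * b (ν - v) : ℚ)) < 1 := by
    rw [hrel]
    refine padicNorm.sum_lt' (fun v _ => ?_) one_pos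
    have h0 : (β * γ * Q v + α * γ * Q (ν - v)) * (a v * b (ν - v)) =
        γ * (β * ((Q v * a v) * b (ν - v)) + α * ((Q (ν - v) * b (ν - v)) * a v)) := by ring
    rw [h0]
    refine padicNorm_mul_lt_one hγ (padicNorm.nonarchimedean.trans (max_le ?_ ?_))
    · refine padicNorm_mul_le_one hβ.le (padicNorm_mul_le_one ?_ (padicNorm.of_int _))
      rcases eq_or_ne (a v) 0 with h0 | h0
      · simp [h0]
      · exact padicNorm_mul_le_one (hQa v h0) (padicNorm.of_int _)
    · refine padicNorm_mul_le_one hα.le (padicNorm_mul_le_one ?_ (padicNorm.of_int _))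
      rcases eq_or_ne (b (ν - v)) 0 with h0 | h0
      · simp [h0]
      · exact padicNorm_mul_le_one (hQb _ h0) (padicNorm.of_int _)
  rwa [mul_assoc, padicNorm.mul, padicNorm.mul, hα, hβ, one_mul, one_mul] at h1

end Padic

namespace EvenLattice

variable {n : ℕ} {L : EvenLattice n}

/-! ### Congruences between Fourier coefficients -/

section Congruences

variable {A : Set (Fin (n + 2) → ℂ)} {c : Fin (n + 2) → ℤ} {c' : Fin (n + 2) → ℚ}
  {F G : (Fin (n + 2) → ℂ) → ℂ}

theorem exists_fourierCoeff_ne_zero (hA : L.IsDomainCone A) (hc : L.IsCuspPair c c')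
    {Γ : Subgroup (GL (Fin (n + 2)) ℤ)} {χ : Γ →* ℂˣ} {k : ℤ} (hF : L.IsReflective A Γ χ k F)
    (hFint : L.HasIntegralFourierCoeffs c c' A F) : ∃ v, L.fourierCoeff c c' A F v ≠ 0 := by
  by_contra! hall
  have hzero : ∀ z ∈ A, F z = 0 := by
    intro z hz
    obtain ⟨Z, hZ, t, ht, htz⟩ := exists_mem_tubeDomain hA hc hz
    have h1 := hFint.1 Z hZ
    simp only [hall, zero_mul] at h1
    have h2 := h1.unique hasSum_zero
    rw [onTube, htz, hF.modular.homogeneous t ht z hz] at h2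
    exact (mul_eq_zero.1 h2).resolve_left (zpow_ne_zero _ ht)
  obtain ⟨z, hz, w, hw, hzw⟩ := hF.nonconstant
  exact hzw (by rw [hzero z hz, hzero w hw])

theorem padicNorm_quad_le_one {p : ℕ} [Fact p.Prime] (hp : ¬ p ∣ L.fourierDenom c c' A F)
    (v : L.cuspSpace c c') (hv : L.fourierCoeff c c' A F v ≠ 0) :
    padicNorm p (L.quad ℚ v.1) ≤ 1 := by
  set S := {D : ℕ | 0 < D ∧ ∀ v, L.fourierCoeff c c' A F v ≠ 0 →
    ∃ m : ℤ, (D : ℚ) * L.quad ℚ v.1 = m} with hS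
  have hD : L.fourierDenom c c' A F = sInf S := rfl
  have hne : S.Nonempty := by
    by_contra hne
    rw [hD, Set.not_nonempty_iff_eq_empty.1 hne, Nat.sInf_empty] at hp
    exact hp (dvd_zero p)
  obtain ⟨m, hm⟩ := (Nat.sInf_mem hne).2 v hv
  have h1 : padicNorm p ((sInf S : ℕ) : ℚ) = 1 := (padicNorm.nat_eq_one_iff _).2 hp
  have h2 := congrArg (padicNorm p) hm
  rw [padicNorm.mul, h1, one_mul] at h2
  rw [h2]
  exact padicNorm.of_int m

/-- The Fourier coefficients of `FG` are convolutions of integers.  By absolute convergence the sums are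
finite. -/
theorem IsFourierExpansion.exists_mul (hA : L.IsDomainCone A) (hc : L.IsCuspPair c c')
    {a b : L.cuspSpace c c' → ℤ}
    (hF : L.IsFourierExpansion c c' A F fun v => (a v : ℂ))
    (hG : L.IsFourierExpansion c c' A G fun v => (b v : ℂ)) :
    ∃ s : L.cuspSpace c c' → Finset (L.cuspSpace c c'),
      (∀ ν v, a v * b (ν - v) ≠ 0 → v ∈ s ν) ∧
      L.IsFourierExpansion c c' A (F * G) (fun ν => ((∑ v ∈ s ν, a v * b (ν - v) : ℤ) : ℂ)) := by
  have hF' : L.IsTubeExpansion A c c' (L.onTube c c' F) fun v => (a v : ℂ) := hF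
  have hG' : L.IsTubeExpansion A c c' (L.onTube c c' G) fun v => (b v : ℂ) := hG
  obtain ⟨z, hz⟩ := hA.nonempty
  obtain ⟨Z, hZ, -⟩ := exists_mem_tubeDomain hA hc hz
  have hfin : ∀ ν, (Function.support fun v => a v * b (ν - v)).Finite := fun ν => by
    have h := (HasSum.convolution (e := fun v : L.cuspSpace c c' => L.cuspExp v.1 Z)
      (fun v w => cuspExp_add_left v.1 w.1 Z) (fun v => cuspExp_ne_zero v.1 Z) (hF' Z hZ)
      (hG' Z hZ)).1 ν
    refine finite_support_of_summable_int (h.congr fun v => ?_)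
    push_cast
    rfl
  have hmem : ∀ ν v, a v * b (ν - v) ≠ 0 → v ∈ (hfin ν).toFinset := fun ν v hv =>
    (hfin ν).mem_toFinset.2 hv
  refine ⟨fun ν => (hfin ν).toFinset, hmem, ?_⟩
  have h1 : L.IsTubeExpansion A c c' (L.onTube c c' (F * G))
      (fun ν => ((∑ v ∈ (hfin ν).toFinset, a v * b (ν - v) : ℤ) : ℂ)) := by
    intro Z hZ
    refine ((hF'.mul hG') Z hZ).congr_fun fun ν => ?_
    congr 1
    beta_reduce
    rw [tsum_eq_sum (s := (hfin ν).toFinset) fun v hv => ?_]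
    · push_cast; rfl
    · by_contra h0
      exact hv (hmem ν v (by exact_mod_cast h0))
  exact h1

/-- The identity between Laplacians in terms of Fourier coefficients. -/
theorem relation_of_laplacian_eq (hA : L.IsDomainCone A) (hc : L.IsCuspPair c c')
    {a b : L.cuspSpace c c' → ℤ}
    (hF : L.IsFourierExpansion c c' A F fun v => (a v : ℂ))
    (hG : L.IsFourierExpansion c c' A G fun v => (b v : ℂ))
    {s : L.cuspSpace c c' → Finset (L.cuspSpace c c')}
    (hs : ∀ ν v, a v * b (ν - v) ≠ 0 → v ∈ s ν)
    (hFG : L.IsFourierExpansion c c' A (F * G)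
      (fun ν => ((∑ v ∈ s ν, a v * b (ν - v) : ℤ) : ℂ)))
    {α β γ : ℚ} {m : ℕ} (e : Module.Basis (Fin m) ℤ (L.cuspLattice c c'))
    (h : ∀ Z ∈ L.tubeDomain c c' A, (α : ℂ) * β * L.laplacian e (L.onTube c c' (F * G)) Z =
      β * γ * (L.laplacian e (L.onTube c c' F) Z * L.onTube c c' G Z) +
        α * γ * (L.onTube c c' F Z * L.laplacian e (L.onTube c c' G) Z))
    (ν : L.cuspSpace c c') :
    α * β * L.quad ℚ ν.1 * ∑ v ∈ s ν, (a v * b (ν - v) : ℚ) =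
      ∑ v ∈ s ν, (β * γ * L.quad ℚ v.1 + α * γ * L.quad ℚ (ν - v).1) * (a v * b (ν - v)) := by
  have hF' : L.IsTubeExpansion A c c' (L.onTube c c' F) fun v => (a v : ℂ) := hF
  have hG' : L.IsTubeExpansion A c c' (L.onTube c c' G) fun v => (b v : ℂ) := hG
  have hFG' : L.IsTubeExpansion A c c' (L.onTube c c' (F * G))
    fun ν => ((∑ v ∈ s ν, a v * b (ν - v) : ℤ) : ℂ) := hFG
  have h1 := (hFG'.laplacian hA hc e).const_mul ((α : ℂ) * β)
  have h2 := (((hF'.laplacian hA hc e).mul hG').const_mul ((β : ℂ) * γ)).add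
    ((hF'.mul (hG'.laplacian hA hc e)).const_mul ((α : ℂ) * γ))
  have h3 := congrFun (h1.unique hA hc (h2.congr fun Z hZ => (h Z hZ).symm)) ν
  simp only [Pi.add_apply] at h3
  have h0 : ∀ v, v ∉ s ν → (a v : ℂ) * b (ν - v) = 0 := fun v hv => by
    by_contra h0
    exact hv (hs ν v (by exact_mod_cast h0))
  rw [tsum_eq_sum (s := s ν) fun v hv => by rw [mul_assoc, h0 v hv, mul_zero],
    tsum_eq_sum (s := s ν) fun v hv => by rw [mul_left_comm, h0 v hv, mul_zero], Finset.mul_sum,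
    Finset.mul_sum, ← Finset.sum_add_distrib] at h3
  have h4 : ((α * β * L.quad ℚ ν.1 * ∑ v ∈ s ν, (a v * b (ν - v) : ℚ) : ℚ) : ℂ) =
      ((∑ v ∈ s ν, (β * γ * L.quad ℚ v.1 + α * γ * L.quad ℚ (ν - v).1) * (a v * b (ν - v)) : ℚ) :
        ℂ) := by
    push_cast at h3 ⊢
    rw [← neg_inj, ← Finset.sum_neg_distrib]
    refine Eq.trans ?_ (h3.trans (Finset.sum_congr rfl fun v _ => ?_))
    · ring
    · ring
  exact_mod_cast h4

/-- A congruence `Q(ν) a(ν) ≡ 0` modulo `p` means that the form is singular modulo `p`. -/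
theorem isSingularMod_of_padicNorm_lt_one {p : ℕ} [Fact p.Prime]
    (hp : ¬ p ∣ L.fourierDenom c c' A F) (hFint : L.HasIntegralFourierCoeffs c c' A F)
    {a : L.cuspSpace c c' → ℤ} (ha : ∀ v, L.fourierCoeff c c' A F v = a v)
    (h : ∀ v, padicNorm p (L.quad ℚ v.1 * a v) < 1) : L.IsSingularMod c c' A p F := by
  refine ⟨hp, hFint, fun v hv => ?_⟩
  rw [primeDvd_iff_padicNorm_lt_one, not_lt] at hv
  have h1 : padicNorm p (a v) < 1 := by
    have := h v
    rw [padicNorm.mul] at this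
    exact (le_mul_of_one_le_left (padicNorm.nonneg _) hv).trans_lt this
  obtain ⟨m, hm⟩ := (padicNorm.int_lt_one_iff _).1 h1
  exact ⟨m, by rw [ha, hm]; push_cast; rfl⟩

theorem padicNorm_eq_one_of_not_primeDvd {p : ℕ} [Fact p.Prime] {q : ℚ}
    (hq : padicNorm p q ≤ 1) (h : ¬ PrimeDvd p q) : padicNorm p q = 1 :=
  le_antisymm hq (not_lt.1 fun hlt => h ((primeDvd_iff_padicNorm_lt_one q).2 hlt))

theorem padicNorm_add_eq_one {p : ℕ} [Fact p.Prime] {x y : ℚ} (hx : padicNorm p x < 1)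
    (hy : padicNorm p y = 1) : padicNorm p (x + y) = 1 := by
  rw [padicNorm.add_eq_max_of_ne (by rw [hy]; exact hx.ne), hy, max_eq_right hx.le]

/-- The congruences for `F` and `FG`; those for `G` follow by symmetry. -/
theorem isSingularMod_of_laplacian_eq (hA : L.IsDomainCone A) (hc : L.IsCuspPair c c')
    {Γ : Subgroup (GL (Fin (n + 2)) ℤ)} {χ : Γ →* ℂˣ} {l : ℤ} (hGr : L.IsReflective A Γ χ l G)
    (hF : L.HasIntegralFourierCoeffs c c' A F) (hG : L.HasIntegralFourierCoeffs c c' A G)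
    {p : ℕ} [Fact p.Prime] (hpF : ¬ p ∣ L.fourierDenom c c' A F)
    (hpG : ¬ p ∣ L.fourierDenom c c' A G) (hpFG : ¬ p ∣ L.fourierDenom c c' A (F * G))
    {α β γ : ℚ} {m : ℕ} (e : Module.Basis (Fin m) ℤ (L.cuspLattice c c'))
    (h : ∀ Z ∈ L.tubeDomain c c' A, (α : ℂ) * β * L.laplacian e (L.onTube c c' (F * G)) Z =
      β * γ * (L.laplacian e (L.onTube c c' F) Z * L.onTube c c' G Z) +
        α * γ * (L.onTube c c' F Z * L.laplacian e (L.onTube c c' G) Z)) :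
    (padicNorm p α < 1 → padicNorm p β = 1 → padicNorm p γ = 1 → L.IsSingularMod c c' A p F) ∧
      (padicNorm p α = 1 → padicNorm p β = 1 → padicNorm p γ < 1 →
        L.IsSingularMod c c' A p (F * G)) := by
  choose a ha using hF.2
  choose b hb using hG.2
  have hFe : L.IsFourierExpansion c c' A F fun v => (a v : ℂ) := by
    rw [← funext ha]; exact hF.1
  have hGe : L.IsFourierExpansion c c' A G fun v => (b v : ℂ) := by
    rw [← funext hb]; exact hG.1
  obtain ⟨s, hs, hFGe⟩ := IsFourierExpansion.exists_mul hA hc hFe hGe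
  have hFGc := hFGe.fourierCoeff_eq hA hc
  have hFGint : L.HasIntegralFourierCoeffs c c' A (F * G) := by
    refine ⟨by rw [hFGc]; exact hFGe, fun ν => ⟨∑ v ∈ s ν, a v * b (ν - v), ?_⟩⟩
    rw [hFGc]
  have hrel := relation_of_laplacian_eq hA hc hFe hGe hs hFGe e h
  have hQa : ∀ v, a v ≠ 0 → padicNorm p (L.quad ℚ v.1) ≤ 1 := fun v hv =>
    padicNorm_quad_le_one hpF v (by rw [ha]; exact_mod_cast hv)
  have hQb : ∀ v, b v ≠ 0 → padicNorm p (L.quad ℚ v.1) ≤ 1 := fun v hv =>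
    padicNorm_quad_le_one hpG v (by rw [hb]; exact_mod_cast hv)
  refine ⟨fun hα hβ hγ => ?_, fun hα hβ hγ => ?_⟩
  · obtain ⟨z, hz⟩ := hA.nonempty
    obtain ⟨Z, hZ, -⟩ := exists_mem_tubeDomain hA hc hz
    -- the terms are ordered by their decay at a point of the tube domain
    let ht : L.cuspSpace c c' →+ ℝ := AddMonoidHom.mk' (fun v => (L.ratBil v.1 Z).im) fun v w => by
      rw [cuspSpace_coe_add, ratBil_add_left, Complex.add_im]
    have hb0 : ∃ v, b v ≠ 0 := by
      obtain ⟨v, hv⟩ := exists_fourierCoeff_ne_zero hA hc hGr hG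
      rw [hb] at hv
      exact ⟨v, by exact_mod_cast hv⟩
    have hfa : L.IsTubeExpansion A c c' (L.onTube c c' F) fun v => (a v : ℂ) := hFe
    have hfb : L.IsTubeExpansion A c c' (L.onTube c c' G) fun v => (b v : ℂ) := hGe
    refine isSingularMod_of_padicNorm_lt_one hpF hF ha fun v => ?_
    refine padicNorm_mul_lt_one_of_relation ht (Q := fun v => L.quad ℚ v.1)
      (fun C => hfa.finite_sublevel hZ C) (fun C => hfb.finite_sublevel hZ C) hb0 s hs hrel hQa hQb
      (fun ν hν => ?_) hα hβ hγ v
    refine padicNorm_quad_le_one hpFG ν ?_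
    rw [hFGc]
    beta_reduce
    exact_mod_cast hν
  · refine isSingularMod_of_padicNorm_lt_one hpFG hFGint (fun ν => by rw [hFGc]) fun ν => ?_
    have key := padicNorm_mul_sum_lt_one_of_relation (p := p) (a := a) (b := b) (s := s ν) (ν := ν)
      (Q := fun v => L.quad ℚ v.1) (hrel ν) hQa hQb hα hβ hγ
    beta_reduce at key
    push_cast
    exact key

end Congruences

end EvenLattice

theorem mainTheorem1 (n : ℕ) (hn : 3 ≤ n) (L : EvenLattice n)
    (A : Set (Fin (n + 2) → ℂ)) (hA : L.IsDomainCone A)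
    (Γ : Subgroup (GL (Fin (n + 2)) ℤ)) (hΓ : Γ ≤ L.OPlus A)
    (hΓfin : Γ.IsFiniteRelIndex (L.OPlus A))
    (χF χG : Γ →* ℂˣ) (k l : ℤ) (F G : (Fin (n + 2) → ℂ) → ℂ)
    (hF : L.IsReflective A Γ χF k F) (hG : L.IsReflective A Γ χG l G)
    (hFsimple : L.HasSimpleZeros A F) (hGsimple : L.HasSimpleZeros A G)
    (hdisj : L.HaveDisjointZeros A F G)
    (hwt2 : ∀ H : (Fin (n + 2) → ℂ) → ℂ,
      EvenLattice.IsModularForm A Γ 1 2 H → ∀ z ∈ A, H z = 0)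
    (c : Fin (n + 2) → ℤ) (c' : Fin (n + 2) → ℚ) (hc : L.IsCuspPair c c') :
    -- the identity on the tube domain
    (∀ (m : ℕ) (e : Module.Basis (Fin m) ℤ (L.cuspLattice c c')),
      ∀ Z ∈ L.tubeDomain c c' A,
        ((n : ℂ) / 2 - 1 - k) * ((n : ℂ) / 2 - 1 - l) *
            L.laplacian e (L.onTube c c' (F * G)) Z
          = ((n : ℂ) / 2 - 1 - l) * ((n : ℂ) / 2 - 1 - k - l) *
              (L.laplacian e (L.onTube c c' F) Z * L.onTube c c' G Z)
            + ((n : ℂ) / 2 - 1 - k) * ((n : ℂ) / 2 - 1 - k - l) *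
              (L.onTube c c' F Z * L.laplacian e (L.onTube c c' G) Z)) ∧
    -- the congruences
    (L.HasIntegralFourierCoeffs c c' A F → L.HasIntegralFourierCoeffs c c' A G →
      ∀ p : ℕ, p.Prime →
        ¬ p ∣ L.fourierDenom c c' A F → ¬ p ∣ L.fourierDenom c c' A G →
        ¬ p ∣ L.fourierDenom c c' A (F * G) →
        (PrimeDvd p ((n : ℚ) / 2 - 1 - k) → ¬ (p : ℤ) ∣ l →
            ¬ PrimeDvd p ((n : ℚ) / 2 - 1 - l) → L.IsSingularMod c c' A p F) ∧
        (PrimeDvd p ((n : ℚ) / 2 - 1 - l) → ¬ (p : ℤ) ∣ k →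
            ¬ PrimeDvd p ((n : ℚ) / 2 - 1 - k) → L.IsSingularMod c c' A p G) ∧
        (PrimeDvd p ((n : ℚ) / 2 - 1 - (k + l)) → ¬ (p : ℤ) ∣ k → ¬ (p : ℤ) ∣ l →
            L.IsSingularMod c c' A p (F * G))) := by
  have hid := fun (m : ℕ) (e : Module.Basis (Fin m) ℤ (L.cuspLattice c c'))
      (Z : Fin (n + 2) → ℂ) (hZ : Z ∈ L.tubeDomain c c' A) =>
    EvenLattice.laplacian_mul_eq hA hΓ hF hG hFsimple hGsimple hdisj hwt2 hc e hZ
  refine ⟨hid, fun hFint hGint p hp hpF hpG hpFG => ?_⟩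
  have : Fact p.Prime := ⟨hp⟩
  set α : ℚ := (n : ℚ) / 2 - 1 - k with hα
  set β : ℚ := (n : ℚ) / 2 - 1 - l with hβ
  set γ : ℚ := (n : ℚ) / 2 - 1 - (k + l) with hγ
  let e := Module.finBasis ℤ (L.cuspLattice c c')
  have hFG := EvenLattice.isSingularMod_of_laplacian_eq hA hc hG hFint hGint hpF hpG hpFG
    (α := α) (β := β) (γ := γ) e fun Z hZ => by
      have := hid _ e Z hZ
      push_cast [hα, hβ, hγ]
      linear_combination this
  have hGF := EvenLattice.isSingularMod_of_laplacian_eq hA hc hF hGint hFint hpG hpF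
    (by rwa [mul_comm]) (α := β) (β := α) (γ := γ) e fun Z hZ => by
      have := hid _ e Z hZ
      rw [mul_comm G F]
      push_cast [hα, hβ, hγ]
      linear_combination this
  have hunit : ∀ m : ℤ, ¬ (p : ℤ) ∣ m → padicNorm p (m : ℚ) = 1 := fun m hm =>
    (padicNorm.int_eq_one_iff m).2 hm
  have hle : ∀ (x : ℚ) (a b : ℤ), padicNorm p x < 1 → padicNorm p (x + ((a - b : ℤ) : ℚ)) ≤ 1 :=
    fun x a b hx => padicNorm.nonarchimedean.trans (max_le hx.le (padicNorm.of_int _))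
  refine ⟨fun h1 h2 h3 => ?_, fun h1 h2 h3 => ?_, fun h1 h2 h3 => ?_⟩
  · rw [primeDvd_iff_padicNorm_lt_one] at h1
    refine hFG.1 h1 (EvenLattice.padicNorm_eq_one_of_not_primeDvd ?_ h3) ?_
    · have := hle α k l h1
      rwa [show α + ((k - l : ℤ) : ℚ) = β by rw [hα, hβ]; push_cast; ring] at this
    · rw [show γ = α + -(l : ℚ) by rw [hα, hγ]; ring]
      exact EvenLattice.padicNorm_add_eq_one h1 (by rw [padicNorm.neg]; exact hunit l h2)
  · rw [primeDvd_iff_padicNorm_lt_one] at h1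
    refine hGF.1 h1 (EvenLattice.padicNorm_eq_one_of_not_primeDvd ?_ h3) ?_
    · have := hle β l k h1
      rwa [show β + ((l - k : ℤ) : ℚ) = α by rw [hα, hβ]; push_cast; ring] at this
    · rw [show γ = β + -(k : ℚ) by rw [hβ, hγ]; ring]
      exact EvenLattice.padicNorm_add_eq_one h1 (by rw [padicNorm.neg]; exact hunit k h2)
  · rw [primeDvd_iff_padicNorm_lt_one] at h1
    refine hFG.2 ?_ ?_ h1
    · rw [show α = γ + (l : ℚ) by rw [hα, hγ]; ring]
      exact EvenLattice.padicNorm_add_eq_one h1 (hunit l h3)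
    · rw [show β = γ + (k : ℚ) by rw [hβ, hγ]; ring]
      exact EvenLattice.padicNorm_add_eq_one h1 (hunit k h2)
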